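/- Let $\omega>0$, let $J$ be a real, skew-symmetric, invertible $2\times2$ matrix, and let $q$ and $w$ be $2\times2$ matrices whose entries are real distributions of order $0$ on $\mathbb R$ (equivalently, distributional derivatives of real functions of locally bounded variation, i.e. real local measures), with $q$ symmetric and $w$ non-negative (the matrix $w(\phi)$ is symmetric positive semi-definite for every test function $\phi\ge 0$). Assume that all entries $r$ of $q$ and $w$ are $\omega$-periodic, i.e. $r(\phi(\cdot+\omega))=r(\phi)$ for every test function $\phi$. For a matrix-valued local measure $r$ let $\Delta_r(x)=r(\{x\})$ be its jump at $x$, and assume that the matrices $$J\pm\tfrac12\bigl(\Delta_q(x)-\lambda\Delta_w(x)\bigr)$$ are invertible for all $x,\lambda\in\mathbb R$. Let $\mathcal L^2(w)$ be the space of functions $f:\mathbb R\to\mathbb C^2$ which are measurable with respect to the positive measure $\operatorname{tr}w$ and satisfy $\|f\|^2=\int f^*wf<\infty$, and let $L^2(w)$ be the quotient of $\mathcal L^2(w)$ by the kernel of $\|\cdot\|$, with inner product $\langle f,g\rangle=\int f^*wg$. A function $u$ of locally bounded variation is called balanced if $u(x)=\frac12(u^+(x)+u^-(x))$ for every $x\in\mathbb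 R$, where $u^\pm$ are the right- and left-hand limits. Let $$T_{\max}=\{([u],[f])\in L^2(w)\times L^2(w): u,f\in\mathcal L^2(w),\ u \text{ balanced and of locally bounded variation},\ Ju'+qu=wf\},$$ where the equation is understood in the sense of distributions. Then the linear relation $T_{\max}$ has no eigenvalues: for every $\lambda\in\mathbb C$, real or not, $(u,\lambda u)\in T_{\max}$ implies $u=0$ in $L^2(w)$. Moreover $T_{\max}$ is self-adjoint, i.e. $T_{\max}^*=T_{\max}$, where $T^*=\{(v,g): \langle f,v\rangle=\langle u,g\rangle\text{ for all }(u,f)\in T\}$. -/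

import Mathlib

open MeasureTheory Filter Topology TopologicalSpace
open scoped Matrix ComplexOrder ComplexConjugate Distributions

noncomputable section

namespace DistributionalSystem

/-! ### Real distributions of order zero -/

/-- A real distribution of order zero on the line, i.e. (Riesz) a real local measure `dR` with `R`
of locally bounded variation, given by its Jordan decomposition: `dR = pos - neg` with locally
finite, mutually singular Borel measures. The decomposition is unique, so every real distribution
of order zero is exactly one element of this type. -/
@[ext]
structure OrderZero where
  pos : Measure ℝ
  neg : Measure ℝ
  locallyFinite_pos : IsLocallyFiniteMeasure pos
  locallyFinite_neg : IsLocallyFiniteMeasure neg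
  mutuallySingular : pos.MutuallySingular neg

attribute [instance] OrderZero.locallyFinite_pos OrderZero.locallyFinite_neg

namespace OrderZero

/-- The value `r(φ) = ∫ φ dR` of the distribution `r` at `φ`. -/
def integral (r : OrderZero) {E : Type*} [NormedAddCommGroup E] [NormedSpace ℝ E] (φ : ℝ → E) : E :=
  ∫ x, φ x ∂r.pos - ∫ x, φ x ∂r.neg

/-- The jump `Δ_r(x) = R⁺(x) - R⁻(x)`, i.e. the mass `dR({x})`. -/
def jump (r : OrderZero) (x : ℝ) : ℝ := r.pos.real {x} - r.neg.real {x}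

/-- `ω` is a period of `r`: `r(φ(· + ω)) = r(φ)` for every test function `φ`. -/
def IsPeriod (r : OrderZero) (ω : ℝ) : Prop :=
  ∀ φ : 𝓓((⊤ : Opens ℝ), ℂ), r.integral (fun x => φ (x + ω)) = r.integral φ

end OrderZero

variable {ι : Type*} [Fintype ι]

/-! ### The space `L²(w)` -/

/-- The matrix `w` of distributions is non-negative: `w(φ)` is (symmetric and) positive
semi-definite for every non-negative test function `φ`. -/
def IsNonneg (w : Matrix ι ι OrderZero) : Prop :=
  ∀ φ : 𝓓((⊤ : Opens ℝ), ℝ), (∀ x, 0 ≤ φ x) →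
    (Matrix.of fun i j => (w i j).integral φ).PosSemidef

/-- The jump matrix `Δ_r(x)`. -/
def jumpMatrix (r : Matrix ι ι OrderZero) (x : ℝ) : Matrix ι ι ℝ :=
  Matrix.of fun i j => (r i j).jump x

/-- The scalar measure `tr w`. (For non-negative `w` the negative parts of the diagonal entries
vanish.) -/
def traceMeasure (w : Matrix ι ι OrderZero) : Measure ℝ := ∑ i, (w i i).pos

/-- The entrywise Radon–Nikodym derivative of `w` with respect to `tr w`. -/
def rawDensity (w : Matrix ι ι OrderZero) (x : ℝ) : Matrix ι ι ℂ :=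
  Matrix.of fun i j => ((((w i j).pos.rnDeriv (traceMeasure w) x).toReal -
    ((w i j).neg.rnDeriv (traceMeasure w) x).toReal : ℝ) : ℂ)

open Classical in
/-- The Radon–Nikodym derivative `W̃` of `w` with respect to `tr w`. For non-negative `w` it is
positive semi-definite almost everywhere; on the exceptional null set it is set to `0`. -/
def density (w : Matrix ι ι OrderZero) (x : ℝ) : Matrix ι ι ℂ :=
  if (rawDensity w x).PosSemidef then rawDensity w x else 0

/-- The density `f* W̃ g` of `f* w g` with respect to `tr w`. -/
def pairing (w : Matrix ι ι OrderZero) (f g : ℝ → ι → ℂ) (x : ℝ) : ℂ :=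
  star (f x) ⬝ᵥ (density w x *ᵥ g x)

instance (w : Matrix ι ι OrderZero) : IsLocallyFiniteMeasure (traceMeasure w) := by
  have : IsFiniteMeasureOnCompacts (traceMeasure w) := by
    constructor
    intro K hK
    simp only [traceMeasure, Measure.coe_finsetSum, Finset.sum_apply]
    exact ENNReal.sum_lt_top.2 fun i _ => hK.measure_lt_top
  infer_instance

lemma density_posSemidef (w : Matrix ι ι OrderZero) (x : ℝ) : (density w x).PosSemidef := by
  unfold density
  split_ifs with h
  · exact h
  · exact Matrix.PosSemidef.zero

lemma isClosed_posSemidef : IsClosed {M : Matrix ι ι ℂ | M.PosSemidef} := by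
  have : {M : Matrix ι ι ℂ | M.PosSemidef} =
      {M | Mᴴ = M} ∩ ⋂ x : ι → ℂ, {M | 0 ≤ star x ⬝ᵥ (M *ᵥ x)} := by
    ext M
    simp [Matrix.posSemidef_iff_dotProduct_mulVec, Matrix.IsHermitian]
  rw [this]
  refine (isClosed_eq (by fun_prop) (by fun_prop)).inter (isClosed_iInter fun x => ?_)
  exact isClosed_le (by fun_prop) (by fun_prop)

lemma measurable_density (w : Matrix ι ι OrderZero) (i j : ι) :
    Measurable fun x => density w x i j := by
  have hraw : ∀ i j, Measurable fun x => rawDensity w x i j := by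
    intro i j
    simp only [rawDensity, Matrix.of_apply]
    exact Complex.measurable_ofReal.comp
      ((Measure.measurable_rnDeriv _ _).ennreal_toReal.sub
        (Measure.measurable_rnDeriv _ _).ennreal_toReal)
  have hset : MeasurableSet {x | (rawDensity w x).PosSemidef} := by
    have hm : Measurable (fun x i j => rawDensity w x i j) :=
      measurable_pi_iff.2 fun i => measurable_pi_iff.2 fun j => hraw i j
    have hc : IsClosed {M : ι → ι → ℂ | Matrix.PosSemidef (M : Matrix ι ι ℂ)} := isClosed_posSemidef
    exact hm hc.measurableSet
  have : (fun x => density w x i j) =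
      {x | (rawDensity w x).PosSemidef}.indicator fun x => rawDensity w x i j := by
    classical
    ext x
    by_cases h : (rawDensity w x).PosSemidef
    · rw [Set.indicator_of_mem (by exact h)]; simp [density, h]
    · rw [Set.indicator_of_notMem (by exact h)]; simp [density, h]
  rw [this]
  exact (hraw i j).indicator hset

lemma aemeasurable_pairing (w : Matrix ι ι OrderZero) {f g : ℝ → ι → ℂ}
    (hf : AEMeasurable f (traceMeasure w)) (hg : AEMeasurable g (traceMeasure w)) :
    AEMeasurable (pairing w f g) (traceMeasure w) := by
  have hf' := aemeasurable_pi_iff.1 hf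
  have hg' := aemeasurable_pi_iff.1 hg
  have : pairing w f g = fun x => ∑ i, conj (f x i) * ∑ j, density w x i j * g x j := by
    ext x; simp [pairing, dotProduct, Matrix.mulVec]
  rw [this]
  refine Finset.aemeasurable_fun_sum _ fun i _ => ?_
  refine (Complex.continuous_conj.measurable.comp_aemeasurable (hf' i)).mul ?_
  exact Finset.aemeasurable_fun_sum _ fun j _ => (measurable_density w i j).aemeasurable.mul (hg' j)

lemma pairing_self_nonneg (w : Matrix ι ι OrderZero) (f : ℝ → ι → ℂ) (x : ℝ) :
    0 ≤ pairing w f f x := (density_posSemidef w x).dotProduct_mulVec_nonneg _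

lemma pairing_add_left (w : Matrix ι ι OrderZero) (f g h : ℝ → ι → ℂ) (x : ℝ) :
    pairing w (f + g) h x = pairing w f h x + pairing w g h x := by
  simp [pairing, add_dotProduct]

lemma pairing_add_right (w : Matrix ι ι OrderZero) (f g h : ℝ → ι → ℂ) (x : ℝ) :
    pairing w h (f + g) x = pairing w h f x + pairing w h g x := by
  simp [pairing, dotProduct_add, Matrix.mulVec_add]

lemma pairing_smul_left (w : Matrix ι ι OrderZero) (c : ℂ) (f g : ℝ → ι → ℂ) (x : ℝ) :
    pairing w (c • f) g x = conj c * pairing w f g x := by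
  simp [pairing, smul_dotProduct]

lemma pairing_smul_right (w : Matrix ι ι OrderZero) (c : ℂ) (f g : ℝ → ι → ℂ) (x : ℝ) :
    pairing w f (c • g) x = c * pairing w f g x := by
  simp [pairing, Matrix.mulVec_smul, dotProduct_smul]

lemma conj_pairing (w : Matrix ι ι OrderZero) (f g : ℝ → ι → ℂ) (x : ℝ) :
    conj (pairing w g f x) = pairing w f g x := by
  have h := (density_posSemidef w x).isHermitian
  have h2 : star (star (g x) ⬝ᵥ (density w x *ᵥ f x)) = star (f x) ⬝ᵥ (density w x *ᵥ g x) := by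
    rw [Matrix.star_dotProduct, Matrix.star_mulVec, h.eq, ← Matrix.dotProduct_mulVec]
    simp
  exact h2

/-- The space `𝓛²(w)` of all `f : ℝ → ℂⁿ` which are measurable with respect to `tr w` and satisfy
`∫ f* w f < ∞`. -/
def sqIntegrable (w : Matrix ι ι OrderZero) : Submodule ℂ (ℝ → ι → ℂ) where
  carrier := {f | AEMeasurable f (traceMeasure w) ∧ Integrable (pairing w f f) (traceMeasure w)}
  zero_mem' := by
    refine ⟨aemeasurable_const, ?_⟩
    have : pairing w 0 0 = fun _ => (0 : ℂ) := by ext x; simp [pairing]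
    rw [this]; exact integrable_zero _ _ _
  add_mem' := by
    rintro f g ⟨hf, hf'⟩ ⟨hg, hg'⟩
    refine ⟨hf.add hg, ?_⟩
    refine Integrable.mono' (g := fun x => 2 * ‖pairing w f f x‖ + 2 * ‖pairing w g g x‖)
      ((hf'.norm.const_mul 2).add (hg'.norm.const_mul 2))
      (aemeasurable_pairing w (hf.add hg) (hf.add hg)).aestronglyMeasurable (ae_of_all _ fun x => ?_)
    have h0 := pairing_self_nonneg w (f + (-1 : ℂ) • g) x
    have h1 := pairing_self_nonneg w (f + g) x
    have h2 := pairing_self_nonneg w f x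
    have h3 := pairing_self_nonneg w g x
    have e : ∀ z : ℂ, 0 ≤ z → ‖z‖ = z.re := fun z hz =>
      (Complex.re_eq_norm.2 hz).symm
    rw [e _ h1, e _ h2, e _ h3]
    have h0' := (Complex.le_def.1 h0).1
    simp only [pairing_add_left, pairing_add_right, pairing_smul_left, pairing_smul_right,
      Complex.zero_re, map_neg, map_one, neg_mul, one_mul, Complex.add_re, Complex.neg_re] at h0' ⊢
    linarith
  smul_mem' := by
    rintro c f ⟨hf, hf'⟩
    refine ⟨hf.const_smul c, ?_⟩
    have : pairing w (c • f) (c • f) = fun x => conj c * (c * pairing w f f x) := by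
      ext x; rw [pairing_smul_left, pairing_smul_right]
    rw [this]
    exact (hf'.const_mul _).const_mul _

lemma integrable_pairing (w : Matrix ι ι OrderZero) {f g : ℝ → ι → ℂ}
    (hf : f ∈ sqIntegrable w) (hg : g ∈ sqIntegrable w) :
    Integrable (pairing w f g) (traceMeasure w) := by
  have h1 := ((sqIntegrable w).add_mem hf hg).2
  have h2 := ((sqIntegrable w).add_mem hf ((sqIntegrable w).smul_mem Complex.I hg)).2
  have h3 := hf.2
  have h4 := hg.2
  have : pairing w f g = fun x => (1 / 2 : ℂ) * (pairing w (f + g) (f + g) x -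
      Complex.I * pairing w (f + Complex.I • g) (f + Complex.I • g) x -
      (1 - Complex.I) * (pairing w f f x + pairing w g g x)) := by
    ext x
    simp only [pairing_add_left, pairing_add_right, pairing_smul_left, pairing_smul_right,
      Complex.conj_I]
    linear_combination ((1 / 2) * pairing w f g x - (1 / 2) * pairing w g f x -
      Complex.I / 2 * pairing w g g x) * Complex.I_sq
  rw [this]
  exact (((h1.sub (h2.const_mul _)).sub ((h3.add h4).const_mul _)).const_mul _)

/-- `𝓛²(w)` with the semi-inner product `∫ f* w g` (and no other structure). -/
def PreL2 (w : Matrix ι ι OrderZero) : Type _ := sqIntegrable w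

instance (w : Matrix ι ι OrderZero) : AddCommGroup (PreL2 w) :=
  inferInstanceAs (AddCommGroup (sqIntegrable w))

instance (w : Matrix ι ι OrderZero) : Module ℂ (PreL2 w) :=
  inferInstanceAs (Module ℂ (sqIntegrable w))

/-- The function underlying an element of `𝓛²(w)`. -/
def PreL2.toFun {w : Matrix ι ι OrderZero} : PreL2 w →ₗ[ℂ] (ℝ → ι → ℂ) :=
  (sqIntegrable w).subtype

lemma PreL2.toFun_mem {w : Matrix ι ι OrderZero} (f : PreL2 w) : f.toFun ∈ sqIntegrable w :=
  Subtype.property (p := fun f => f ∈ sqIntegrable w) f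

/-- The semi-inner product `⟨f, g⟩ = ∫ f* w g = ∫ f* W̃ g d(tr w)`. -/
abbrev preInnerCore (w : Matrix ι ι OrderZero) : PreInnerProductSpace.Core ℂ (PreL2 w) where
  inner f g := ∫ x, pairing w f.toFun g.toFun x ∂traceMeasure w
  conj_inner_symm f g := by
    rw [← integral_conj]
    simp only [conj_pairing]
  re_inner_nonneg f := by
    have h : (0 : ℂ) ≤ ∫ x, pairing w f.toFun f.toFun x ∂traceMeasure w :=
      integral_nonneg fun x => pairing_self_nonneg w _ x
    exact (Complex.le_def.1 h).1
  add_left f g h := by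
    rw [← integral_add (integrable_pairing w f.toFun_mem h.toFun_mem)
      (integrable_pairing w g.toFun_mem h.toFun_mem)]
    simp only [map_add, pairing_add_left]
  smul_left f g c := by
    rw [← integral_const_mul]
    simp only [map_smul, pairing_smul_left]

instance (w : Matrix ι ι OrderZero) : SeminormedAddCommGroup (PreL2 w) :=
  InnerProductSpace.Core.toSeminormedAddCommGroup (c := preInnerCore w)

instance (w : Matrix ι ι OrderZero) : InnerProductSpace ℂ (PreL2 w) :=
  InnerProductSpace.ofCore (preInnerCore w)

/-- `L²(w)`, the quotient of `𝓛²(w)` by the kernel of the semi-norm. -/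
abbrev L2 (w : Matrix ι ι OrderZero) : Type _ := SeparationQuotient (PreL2 w)

/-- The class map `f ↦ [f]`. -/
def toL2 (w : Matrix ι ι OrderZero) : PreL2 w →ₗ[ℂ] L2 w :=
  (SeparationQuotient.mkCLM ℂ (PreL2 w)).toLinearMap

/-! ### The differential equation and the maximal relation -/

/-- `u` is balanced: it has one-sided limits `u^±` everywhere and `u = (u⁺ + u⁻) / 2`. -/
def IsBalanced (u : ℝ → ι → ℂ) : Prop :=
  ∀ x, ∃ a b, Tendsto u (𝓝[<] x) (𝓝 a) ∧ Tendsto u (𝓝[>] x) (𝓝 b) ∧ u x = (1 / 2 : ℂ) • (a + b)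

/-- `J u' + q u = w f` in the sense of distributions: for every test function `φ`,
`-∫ φ' J u dx + ∫ φ q u = ∫ φ w f`, where `w f = W̃ f tr w`. -/
def Solves (J : Matrix ι ι ℝ) (q w : Matrix ι ι OrderZero) (u f : ℝ → ι → ℂ) : Prop :=
  ∀ (φ : 𝓓((⊤ : Opens ℝ), ℂ)) (i : ι),
    -∑ j, (J i j : ℂ) * (∫ x, deriv φ x * u x j) +
      ∑ j, (q i j).integral (fun x => φ x * u x j) =
    ∫ x, φ x * (density w x *ᵥ f x) i ∂traceMeasure w

lemma locallyIntegrable_of_bv {u : ℝ → ι → ℂ} (hu : LocallyBoundedVariationOn u Set.univ)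
    (μ : Measure ℝ) [IsLocallyFiniteMeasure μ] (j : ι) :
    LocallyIntegrable (fun x => u x j) μ := by
  have key : ∀ v : ℝ → ℝ, LocallyBoundedVariationOn v Set.univ → LocallyIntegrable v μ := by
    intro v hv
    obtain ⟨p, q, hp, hq, rfl⟩ := hv.exists_monotoneOn_sub_monotoneOn
    exact (monotoneOn_univ.1 hp).locallyIntegrable.sub (monotoneOn_univ.1 hq).locallyIntegrable
  have hj : LocallyBoundedVariationOn (fun x => u x j) Set.univ :=
    (LipschitzWith.eval (α := fun _ : ι => ℂ) j).comp_locallyBoundedVariationOn hu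
  have hre := key _ (Complex.reCLM.lipschitz.comp_locallyBoundedVariationOn hj)
  have him := key _ (Complex.imCLM.lipschitz.comp_locallyBoundedVariationOn hj)
  intro x
  obtain ⟨s, hs, h1⟩ := hre x
  obtain ⟨t, ht, h2⟩ := him x
  refine ⟨s ∩ t, inter_mem hs ht, ?_⟩
  have h1' := Integrable.ofReal (𝕜 := ℂ) (h1.mono_set (Set.inter_subset_left (t := t)))
  have h2' := Integrable.ofReal (𝕜 := ℂ) (h2.mono_set (Set.inter_subset_right (s := s)))
  refine (h1'.add (h2'.mul_const Complex.I)).congr (ae_of_all _ fun y => ?_)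
  simp

lemma integrable_mul_of_bv {u : ℝ → ι → ℂ} (hu : LocallyBoundedVariationOn u Set.univ)
    (μ : Measure ℝ) [IsLocallyFiniteMeasure μ] (j : ι) {φ : ℝ → ℂ} (hφ : Continuous φ)
    (hφ' : HasCompactSupport φ) : Integrable (fun x => φ x * u x j) μ :=
  (locallyIntegrable_of_bv hu μ j).integrable_smul_left_of_hasCompactSupport hφ hφ'

lemma density_diag_le_one (w : Matrix ι ι OrderZero) (i : ι) :
    ∀ᵐ x ∂traceMeasure w, ‖density w x i i‖ ≤ 1 := by
  have hle : (w i i).pos ≤ traceMeasure w :=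
    Finset.single_le_sum (f := fun i => (w i i).pos) (fun _ _ => Measure.zero_le _)
      (Finset.mem_univ i)
  filter_upwards [Measure.rnDeriv_le_one_of_le hle] with x hx
  unfold density
  split_ifs with h
  · have h0 : 0 ≤ rawDensity w x i i := h.diag_nonneg
    rw [← Complex.re_eq_norm.2 h0]
    simp only [rawDensity, Matrix.of_apply, Complex.ofReal_re]
    have h1 : ((w i i).pos.rnDeriv (traceMeasure w) x).toReal ≤ 1 := by
      simpa using ENNReal.toReal_mono ENNReal.one_ne_top hx
    have h2 : 0 ≤ ((w i i).neg.rnDeriv (traceMeasure w) x).toReal := ENNReal.toReal_nonneg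
    linarith
  · simp

lemma integrable_mul_density (w : Matrix ι ι OrderZero) {f : ℝ → ι → ℂ} (hf : f ∈ sqIntegrable w)
    (i : ι) {φ : ℝ → ℂ} (hφ : Continuous φ) (hφ' : HasCompactSupport φ) :
    Integrable (fun x => φ x * (density w x *ᵥ f x) i) (traceMeasure w) := by
  classical
  set g : ℝ → ι → ℂ := fun x => Pi.single i (conj (φ x)) with hg
  have hpair : ∀ h : ℝ → ι → ℂ, pairing w g h = fun x => φ x * (density w x *ᵥ h x) i := by
    intro h
    ext x
    have : star (g x) = Pi.single i (φ x) := by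
      ext k
      by_cases hk : k = i
      · subst hk; simp [hg]
      · simp [hg, hk]
    simp [pairing, this]
  have hgm : g ∈ sqIntegrable w := by
    have hm : AEMeasurable g (traceMeasure w) := by
      refine aemeasurable_pi_iff.2 fun k => ?_
      by_cases hk : k = i
      · subst hk
        simp only [hg, Pi.single_eq_same]
        exact (Complex.continuous_conj.comp hφ).measurable.aemeasurable
      · simp [hg, hk]
    refine ⟨hm, ?_⟩
    have hint : Integrable (fun x => ‖φ x‖ * ‖φ x‖) (traceMeasure w) :=
      (hφ.norm.mul hφ.norm).integrable_of_hasCompactSupport (hφ'.norm.mul_right)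
    refine hint.mono' (aemeasurable_pairing w hm hm).aestronglyMeasurable ?_
    filter_upwards [density_diag_le_one w i] with x hx
    rw [hpair]
    have : (density w x *ᵥ g x) i = density w x i i * conj (φ x) := by
      simp [hg]
    simp only [this, norm_mul, RCLike.norm_conj]
    have := norm_nonneg (φ x)
    gcongr
    nlinarith
  rw [← hpair]
  exact integrable_pairing w hgm hf

lemma OrderZero.integral_add' (r : OrderZero) {φ ψ : ℝ → ℂ} (h1 : Integrable φ r.pos)
    (h2 : Integrable φ r.neg) (h3 : Integrable ψ r.pos) (h4 : Integrable ψ r.neg) :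
    r.integral (fun x => φ x + ψ x) = r.integral φ + r.integral ψ := by
  simp only [OrderZero.integral]
  rw [integral_add h1 h3, integral_add h2 h4]
  ring

lemma bv_add {u v : ℝ → ι → ℂ} {s : Set ℝ} (hu : BoundedVariationOn u s)
    (hv : BoundedVariationOn v s) : BoundedVariationOn (u + v) s := by
  refine ne_top_of_le_ne_top (ENNReal.add_ne_top.2 ⟨hu, hv⟩) (iSup_le fun p => ?_)
  refine le_trans (Finset.sum_le_sum fun i _ => edist_add_add_le _ _ _ _) ?_
  rw [Finset.sum_add_distrib]
  exact add_le_add (eVariationOn.sum_le p.2.2.1 (fun _ => p.2.2.2 _))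
    (eVariationOn.sum_le p.2.2.1 (fun _ => p.2.2.2 _))

/-- The maximal relation on the level of functions: all `(u, f) ∈ 𝓛²(w) × 𝓛²(w)` such that `u` is
balanced and of locally bounded variation and `J u' + q u = w f`. -/
def preTmax (J : Matrix ι ι ℝ) (q w : Matrix ι ι OrderZero) :
    Submodule ℂ (PreL2 w × PreL2 w) where
  carrier := {p | LocallyBoundedVariationOn p.1.toFun Set.univ ∧ IsBalanced p.1.toFun ∧
    Solves J q w p.1.toFun p.2.toFun}
  zero_mem' := by
    refine ⟨?_, ?_, ?_⟩
    · simp only [Prod.fst_zero, map_zero]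
      exact (LipschitzWith.const (0 : ι → ℂ)).locallyBoundedVariationOn _
    · intro x
      simp only [Prod.fst_zero, map_zero]
      exact ⟨0, 0, tendsto_const_nhds, tendsto_const_nhds, by simp⟩
    · intro φ i
      simp [OrderZero.integral]
  add_mem' := by
    rintro ⟨u, f⟩ ⟨v, g⟩ ⟨hu, hub, hus⟩ ⟨hv, hvb, hvs⟩
    refine ⟨?_, ?_, ?_⟩
    · simp only [Prod.mk_add_mk, map_add]
      intro a b ha hb
      exact bv_add (hu a b ha hb) (hv a b ha hb)
    · intro x
      obtain ⟨a, b, h1, h2, h3⟩ := hub x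
      obtain ⟨a', b', h1', h2', h3'⟩ := hvb x
      refine ⟨a + a', b + b', ?_, ?_, ?_⟩
      · simp only [Prod.mk_add_mk, map_add]; exact h1.add h1'
      · simp only [Prod.mk_add_mk, map_add]; exact h2.add h2'
      · simp only [Prod.mk_add_mk, map_add, Pi.add_apply] at h3 h3' ⊢
        rw [h3, h3', ← smul_add]
        congr 1
        abel
    · intro φ i
      have hφ := φ.continuous
      have hφ' := φ.hasCompactSupport
      have hd : Continuous (deriv φ) := φ.contDiff.continuous_deriv (by simp)
      have hd' : HasCompactSupport (deriv φ) := hφ'.deriv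
      have e1 := hus φ i
      have e2 := hvs φ i
      simp only [Prod.mk_add_mk, map_add, Pi.add_apply, mul_add, Matrix.mulVec_add] at e1 e2 ⊢
      rw [integral_add (integrable_mul_density w f.toFun_mem i hφ hφ')
        (integrable_mul_density w g.toFun_mem i hφ hφ'), ← e1, ← e2]
      have a1 : ∀ j, (∫ x, (deriv φ x * u.toFun x j + deriv φ x * v.toFun x j)) =
          (∫ x, deriv φ x * u.toFun x j) + ∫ x, deriv φ x * v.toFun x j := fun j =>
        integral_add (integrable_mul_of_bv hu _ j hd hd') (integrable_mul_of_bv hv _ j hd hd')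
      have a2 : ∀ j, (q i j).integral (fun x => φ x * u.toFun x j + φ x * v.toFun x j) =
          (q i j).integral (fun x => φ x * u.toFun x j) +
            (q i j).integral (fun x => φ x * v.toFun x j) := fun j =>
        OrderZero.integral_add' _ (integrable_mul_of_bv hu _ j hφ hφ')
          (integrable_mul_of_bv hu _ j hφ hφ') (integrable_mul_of_bv hv _ j hφ hφ')
          (integrable_mul_of_bv hv _ j hφ hφ')
      simp only [a1, a2, mul_add, Finset.sum_add_distrib]
      ring
  smul_mem' := by
    rintro c ⟨u, f⟩ ⟨hu, hub, hus⟩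
    refine ⟨?_, ?_, ?_⟩
    · simp only [Prod.smul_mk, map_smul]
      exact (lipschitzWith_smul c).comp_locallyBoundedVariationOn hu
    · intro x
      obtain ⟨a, b, h1, h2, h3⟩ := hub x
      refine ⟨c • a, c • b, ?_, ?_, ?_⟩
      · simp only [Prod.smul_mk, map_smul]; exact h1.const_smul c
      · simp only [Prod.smul_mk, map_smul]; exact h2.const_smul c
      · simp only [Prod.smul_mk, map_smul, Pi.smul_apply] at h3 ⊢
        rw [h3, ← smul_add, smul_comm]
    · intro φ i
      have e := hus φ i
      simp only [Prod.smul_mk, map_smul, Pi.smul_apply, Matrix.mulVec_smul, smul_eq_mul] at e ⊢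
      simp only [OrderZero.integral, mul_left_comm _ c, integral_const_mul, ← mul_sub,
        ← Finset.mul_sum] at e ⊢
      rw [← e]
      ring

/-- The maximal relation `T_max = {([u], [f]) : (u, f) ∈ 𝓣_max}` in `L²(w) × L²(w)`. -/
def Tmax (J : Matrix ι ι ℝ) (q w : Matrix ι ι OrderZero) : Submodule ℂ (L2 w × L2 w) :=
  (preTmax J q w).map ((toL2 w).prodMap (toL2 w))

/-- `z` is an eigenvalue of the linear relation `T`: there is `u ≠ 0` with `(u, z u) ∈ T`. -/
def IsEigenvalue {H : Type*} [AddCommGroup H] [Module ℂ H] (T : Submodule ℂ (H × H)) (z : ℂ) :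
    Prop := ∃ u : H, u ≠ 0 ∧ (u, z • u) ∈ T

lemma inner_toL2 (w : Matrix ι ι OrderZero) (f g : PreL2 w) :
    inner ℂ (toL2 w f) (toL2 w g) = ∫ x, pairing w f.toFun g.toFun x ∂traceMeasure w := rfl

end DistributionalSystem

end

open DistributionalSystem

noncomputable section

namespace DistributionalSystem

/-! ### Primitives of complex measures -/

/-! All coefficients are written as densities with respect to one locally finite measure μ, the sum
of tr w and the variations of the entries of q. A balanced solution u is then encoded by its
right-hand limits U and a density h of u': the left-hand limit at x is U - μ{x} h and u = U -
(μ{x}/2) h. The distributional equation becomes the pointwise relation J h + Q u = R, μ-almost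
everywhere. At an atom this is a linear equation for the jump, solvable because J ± (μ{x}/2) Q is
invertible; away from it a Volterra iteration applies (`exists_isSol`). Integration by parts in
symmetric form gives Lagrange's identity (`lagrange`), which yields uniqueness and a two-dimensional
space of homogeneous solutions.

Periodicity enters through translations by nω. They are isometries of L²(w) and tend weakly to zero
(`tendsto_integral_pairing_comp_add`). For real λ they map square integrable solutions of the
homogeneous equation to such solutions. In a space of dimension at most two, weak convergence to
zero is norm convergence, while the norms stay constant; hence such a solution has norm zero
(`isNull_of_hom`). This excludes real eigenvalues. Nonreal eigenvalues are excluded by symmetry of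
T_max, so no solvability is needed for nonreal λ.

Symmetry amounts to the vanishing of the boundary terms in Lagrange's identity along a sequence of
intervals, and there are two cases. If no nontrivial homogeneous solution (λ = 0) is annihilated by
w, the equation is definite on some interval (a, b]. Every value at a is then attained by a solution
that vanishes at b and is driven by a right-hand side supported in (a, b]. Pairing it with
translates of u, weak convergence shows that U(a ± nω) tends to 0 (`IsDefiniteOn.tendsto_zero`). If
instead w annihilates a nontrivial homogeneous solution k, then every square integrable u in the
domain has norm zero (`isNull_of_exists_null`). Indeed kᵀJu is constant; after subtraction of a
multiple of a second homogeneous solution the remainder is pointwise parallel to k on either side of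
each point, and w annihilates it. That step needs w({x}) to annihilate both one-sided limits of k at
an atom, which is where invertibility for all real λ is used (`mulVec_jump_eq_zero`).

The inclusion T_max* ⊆ T_max needs no periodicity. If f has bounded support and is orthogonal to the
homogeneous solutions, then Ju' + qu = wf has a boundedly supported solution; testing (v, g) ∈
T_max* against these pairs shows that v differs from a solution of Jy' + qy = wg by a homogeneous
solution, up to a function annihilated by w (`adjoint_le`). -/

/-- `U` is a primitive of the complex measure `h μ`; it is continuous from the right. -/
structure IsPrimitive (μ : Measure ℝ) (U h : ℝ → ℂ) : Prop where
  locallyIntegrable : LocallyIntegrable h μ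
  sub_eq : ∀ a b, U b - U a = ∫ t in a..b, h t ∂μ

lemma _root_.MeasureTheory.LocallyIntegrable.integrableOn_Ioc {E : Type*} [NormedAddCommGroup E] {μ : Measure ℝ}
    {h : ℝ → E} (hh : LocallyIntegrable h μ) (a b : ℝ) : IntegrableOn h (Set.Ioc a b) μ :=
  (hh.integrableOn_isCompact isCompact_Icc).mono_set Set.Ioc_subset_Icc_self

lemma _root_.MeasureTheory.LocallyIntegrable.intervalIntegrable' {E : Type*} [NormedAddCommGroup E] {μ : Measure ℝ}
    {h : ℝ → E} (hh : LocallyIntegrable h μ) (a b : ℝ) : IntervalIntegrable h μ a b :=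
  ⟨hh.integrableOn_Ioc a b, hh.integrableOn_Ioc b a⟩

lemma isPrimitive_integral {μ : Measure ℝ} {h : ℝ → ℂ} (hh : LocallyIntegrable h μ) (x₀ : ℝ)
    (c : ℂ) : IsPrimitive μ (fun x => c + ∫ t in x₀..x, h t ∂μ) h := by
  refine ⟨hh, fun a b => ?_⟩
  rw [← intervalIntegral.integral_add_adjacent_intervals (hh.intervalIntegrable' x₀ a)
    (hh.intervalIntegrable' a b)]
  ring

/-! ### Calculus of primitives: one-sided limits and integration by parts. -/

namespace IsPrimitive

variable {μ ν : Measure ℝ} {U V h k : ℝ → ℂ}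

lemma sub_eq_Ioc (hU : IsPrimitive μ U h) {a b : ℝ} (hab : a ≤ b) :
    U b - U a = ∫ t in Set.Ioc a b, h t ∂μ := by
  rw [hU.sub_eq, intervalIntegral.integral_of_le hab]

lemma add (hU : IsPrimitive μ U h) (hV : IsPrimitive μ V k) :
    IsPrimitive μ (fun x => U x + V x) (fun x => h x + k x) := by
  refine ⟨hU.1.add hV.1, fun a b => ?_⟩
  rw [intervalIntegral.integral_add (hU.1.intervalIntegrable' a b) (hV.1.intervalIntegrable' a b),
    ← hU.sub_eq, ← hV.sub_eq]
  ring

lemma const_mul (hU : IsPrimitive μ U h) (c : ℂ) :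
    IsPrimitive μ (fun x => c * U x) (fun x => c * h x) := by
  refine ⟨hU.1.smul c, fun a b => ?_⟩
  rw [intervalIntegral.integral_const_mul, ← hU.sub_eq]
  ring

lemma star (hU : IsPrimitive μ U h) :
    IsPrimitive μ (fun x => conj (U x)) (fun x => conj (h x)) := by
  refine ⟨?_, fun a b => ?_⟩
  · intro x
    obtain ⟨s, hs, hi⟩ := hU.1 x
    exact ⟨s, hs, (Complex.conjLIE.toContinuousLinearEquiv.toContinuousLinearMap.integrable_comp hi)⟩
  · rw [← map_sub, hU.sub_eq]
    simp only [intervalIntegral, map_sub, integral_conj]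

lemma tendsto_right (hU : IsPrimitive μ U h) (x : ℝ) : Tendsto U (𝓝[>] x) (𝓝 (U x)) := by
  have key : Tendsto (fun y => ∫ t, (Set.Ioc x y).indicator h t ∂μ) (𝓝[>] x) (𝓝 (∫ t, (0 : ℂ) ∂μ)) := by
    refine tendsto_integral_filter_of_dominated_convergence
      (fun t => ‖(Set.Ioc x (x + 1)).indicator h t‖) ?_ ?_ ?_ ?_
    · exact Eventually.of_forall fun y =>
        ((hU.1.integrableOn_Ioc x y).integrable_indicator measurableSet_Ioc).aestronglyMeasurable
    · have : ∀ᶠ y in 𝓝[>] x, y < x + 1 := nhdsWithin_le_nhds (eventually_lt_nhds (by linarith))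
      filter_upwards [this] with y hy
      refine ae_of_all _ fun t => ?_
      exact norm_indicator_le_of_subset (Set.Ioc_subset_Ioc_right hy.le) _ _
    · exact ((hU.1.integrableOn_Ioc x (x + 1)).integrable_indicator measurableSet_Ioc).norm
    · refine ae_of_all _ fun t => ?_
      refine tendsto_const_nhds.congr' ?_
      by_cases ht : x < t
      · have : ∀ᶠ y in 𝓝[>] x, y < t := nhdsWithin_le_nhds (eventually_lt_nhds ht)
        filter_upwards [this] with y hy
        rw [Set.indicator_of_notMem]
        exact fun hm => absurd hm.2 (not_le.2 hy)
      · refine Eventually.of_forall fun y => ?_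
        beta_reduce
        rw [Set.indicator_of_notMem]
        exact fun hm => ht hm.1
  have h2 : Tendsto (fun y => U x + ∫ t, (Set.Ioc x y).indicator h t ∂μ) (𝓝[>] x) (𝓝 (U x)) := by
    simpa using tendsto_const_nhds.add key
  refine h2.congr' ?_
  filter_upwards [self_mem_nhdsWithin] with y hy
  rw [integral_indicator measurableSet_Ioc, ← hU.sub_eq_Ioc (le_of_lt hy)]
  ring

/-- The intervals `Ioc y x` shrink to the point x, not to the empty set, as y increases to x; the
atom at x survives the dominated convergence and is the jump of U. -/
lemma tendsto_left (hU : IsPrimitive μ U h) (x : ℝ) :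
    Tendsto U (𝓝[<] x) (𝓝 (U x - μ.real {x} * h x)) := by
  have key : Tendsto (fun y => ∫ t, (Set.Ioc y x).indicator h t ∂μ) (𝓝[<] x)
      (𝓝 (∫ t, ({x} : Set ℝ).indicator h t ∂μ)) := by
    refine tendsto_integral_filter_of_dominated_convergence
      (fun t => ‖(Set.Ioc (x - 1) x).indicator h t‖) ?_ ?_ ?_ ?_
    · exact Eventually.of_forall fun y =>
        ((hU.1.integrableOn_Ioc y x).integrable_indicator measurableSet_Ioc).aestronglyMeasurable
    · have : ∀ᶠ y in 𝓝[<] x, x - 1 < y := nhdsWithin_le_nhds (eventually_gt_nhds (by linarith))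
      filter_upwards [this] with y hy
      refine ae_of_all _ fun t => ?_
      exact norm_indicator_le_of_subset (Set.Ioc_subset_Ioc_left hy.le) _ _
    · exact ((hU.1.integrableOn_Ioc (x - 1) x).integrable_indicator measurableSet_Ioc).norm
    · refine ae_of_all _ fun t => ?_
      refine tendsto_const_nhds.congr' ?_
      rcases lt_trichotomy t x with ht | rfl | ht
      · have : ∀ᶠ y in 𝓝[<] x, t < y := nhdsWithin_le_nhds (eventually_gt_nhds ht)
        filter_upwards [this] with y hy
        rw [Set.indicator_of_notMem (by simpa using ht.ne), Set.indicator_of_notMem]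
        exact fun hm => absurd hm.1 (not_lt.2 hy.le)
      · filter_upwards [self_mem_nhdsWithin] with y hy
        rw [Set.indicator_of_mem (by simp), Set.indicator_of_mem (Set.mem_Ioc.2 ⟨hy, le_rfl⟩)]
      · refine Eventually.of_forall fun y => ?_
        beta_reduce
        rw [Set.indicator_of_notMem (by simpa using ht.ne'), Set.indicator_of_notMem]
        exact fun hm => absurd hm.2 (not_le.2 ht)
  have e : ∫ t, ({x} : Set ℝ).indicator h t ∂μ = μ.real {x} * h x := by
    rw [integral_indicator (measurableSet_singleton x), integral_singleton, Complex.real_smul]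
  rw [e] at key
  refine (tendsto_const_nhds.sub key).congr' ?_
  filter_upwards [self_mem_nhdsWithin] with y hy
  rw [integral_indicator measurableSet_Ioc, ← hU.sub_eq_Ioc (le_of_lt hy)]
  ring

lemma sub_eq_Ioo (hU : IsPrimitive μ U h) {a b : ℝ} (hab : a < b) :
    U b - μ.real {b} * h b - U a = ∫ t in Set.Ioo a b, h t ∂μ := by
  have h1 := hU.sub_eq_Ioc hab.le
  rw [← Set.Ioo_union_right hab, setIntegral_union (by simp) (measurableSet_singleton b)
    ((hU.1.integrableOn_Ioc a b).mono_set Set.Ioo_subset_Ioc_self)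
    ((hU.1.integrableOn_Ioc a b).mono_set (by simpa using hab)), integral_singleton,
    Complex.real_smul] at h1
  linear_combination h1

variable [IsLocallyFiniteMeasure μ] [IsLocallyFiniteMeasure ν]

/-- Integration by parts for primitives of two measures. -/
lemma mul_sub_mul (hU : IsPrimitive μ U h) (hV : IsPrimitive ν V k) {a b : ℝ} (hab : a ≤ b) :
    IntegrableOn (fun t => (U t - μ.real {t} * h t) * k t) (Set.Ioc a b) ν ∧
    IntegrableOn (fun t => h t * V t) (Set.Ioc a b) μ ∧
    U b * V b - U a * V a = (∫ t in Set.Ioc a b, (U t - μ.real {t} * h t) * k t ∂ν) +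
      ∫ t in Set.Ioc a b, h t * V t ∂μ := by
  have hi := hU.1.integrableOn_Ioc a b
  have ki := hV.1.integrableOn_Ioc a b
  set μ' := μ.restrict (Set.Ioc a b) with hμ'
  set ν' := ν.restrict (Set.Ioc a b) with hν'
  have hp : Integrable (fun z : ℝ × ℝ => h z.1 * k z.2) (μ'.prod ν') := hi.mul_prod ki
  -- Fubini on the square, cut along the diagonal. The diagonal is given to the half t ≤ s, so
  -- integrating out s over s < t produces the left-hand limit of U, while integrating out t over t
  -- ≤ s produces V itself.
  have hm : MeasurableSet {z : ℝ × ℝ | z.1 < z.2} := measurableSet_lt measurable_fst measurable_snd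
  have hp1 := hp.indicator hm
  have hp2 := hp.indicator hm.compl
  have i1 := hp1.integral_prod_right
  have i2 := hp2.integral_prod_left
  have e1 : ∀ t ∈ Set.Ioc a b, ∫ s, {z : ℝ × ℝ | z.1 < z.2}.indicator
      (fun z : ℝ × ℝ => h z.1 * k z.2) (s, t) ∂μ' = (U t - μ.real {t} * h t - U a) * k t := by
    intro t ht
    rw [hU.sub_eq_Ioo ht.1, ← integral_mul_const]
    have : (fun s => {z : ℝ × ℝ | z.1 < z.2}.indicator
      (fun z : ℝ × ℝ => h z.1 * k z.2) (s, t)) = (Set.Iio t).indicator (fun s => h s * k t) := by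
      ext s
      by_cases hs : s < t
      · rw [Set.indicator_of_mem (by exact hs), Set.indicator_of_mem (by exact hs)]
      · rw [Set.indicator_of_notMem (by exact hs), Set.indicator_of_notMem (by exact hs)]
    rw [this, integral_indicator measurableSet_Iio, hμ', Measure.restrict_restrict measurableSet_Iio]
    congr 2
    ext s
    simp only [Set.mem_inter_iff, Set.mem_Iio, Set.mem_Ioc, Set.mem_Ioo]
    constructor
    · rintro ⟨h1, h2, -⟩; exact ⟨h2, h1⟩
    · rintro ⟨h1, h2⟩; exact ⟨h2, h1, (h2.trans_le ht.2).le⟩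
  have e2 : ∀ s ∈ Set.Ioc a b, ∫ t, {z : ℝ × ℝ | z.1 < z.2}ᶜ.indicator
      (fun z : ℝ × ℝ => h z.1 * k z.2) (s, t) ∂ν' = h s * (V s - V a) := by
    intro s hs
    rw [hV.sub_eq_Ioc hs.1.le, ← integral_const_mul]
    have : (fun t => {z : ℝ × ℝ | z.1 < z.2}ᶜ.indicator
      (fun z : ℝ × ℝ => h z.1 * k z.2) (s, t)) = (Set.Iic s).indicator (fun t => h s * k t) := by
      ext t
      by_cases ht : t ≤ s
      · rw [Set.indicator_of_mem (by simpa using ht), Set.indicator_of_mem (by exact ht)]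
      · rw [Set.indicator_of_notMem (by simpa using ht), Set.indicator_of_notMem (by exact ht)]
    rw [this, integral_indicator measurableSet_Iic, hν', Measure.restrict_restrict measurableSet_Iic]
    congr 2
    ext t
    simp only [Set.mem_inter_iff, Set.mem_Iic, Set.mem_Ioc]
    constructor
    · rintro ⟨h1, h2, -⟩; exact ⟨h2, h1⟩
    · rintro ⟨h1, h2⟩; exact ⟨h2, h1, h2.trans hs.2⟩
  have a1 : ∀ᵐ t ∂ν', _ := (ae_restrict_iff' measurableSet_Ioc).2 (ae_of_all _ e1)
  have a2 : ∀ᵐ t ∂μ', _ := (ae_restrict_iff' measurableSet_Ioc).2 (ae_of_all _ e2)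
  have i1' := i1.congr a1
  have i2' := i2.congr a2
  have c1 : Integrable (fun t => U a * k t) ν' := Integrable.const_mul ki _
  have c2 : Integrable (fun t => h t * V a) μ' := Integrable.mul_const hi _
  have j1 : Integrable (fun t => (U t - μ.real {t} * h t) * k t) ν' :=
    (i1'.add c1).congr (ae_of_all _ fun t => by simp; ring)
  have j2 : Integrable (fun t => h t * V t) μ' :=
    (i2'.add c2).congr (ae_of_all _ fun t => by simp; ring)
  refine ⟨j1, j2, ?_⟩
  have total : (U b - U a) * (V b - V a) = (∫ t, (U t - μ.real {t} * h t - U a) * k t ∂ν') +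
      ∫ t, h t * (V t - V a) ∂μ' := by
    rw [← integral_congr_ae a1, ← integral_congr_ae a2, ← integral_prod_symm _ hp1,
      ← integral_prod _ hp2, ← integral_add hp1 hp2, hU.sub_eq_Ioc hab, hV.sub_eq_Ioc hab,
      ← integral_prod_mul]
    congr 1
    ext z
    exact (Set.indicator_self_add_compl_apply {z : ℝ × ℝ | z.1 < z.2}
      (fun z : ℝ × ℝ => h z.1 * k z.2) z).symm
  have t1 : (∫ t, (U t - μ.real {t} * h t - U a) * k t ∂ν') =
      (∫ t, (U t - μ.real {t} * h t) * k t ∂ν') - U a * (V b - V a) := by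
    rw [hV.sub_eq_Ioc hab, ← integral_const_mul, ← integral_sub j1 c1]
    congr 1; ext t; ring
  have t2 : (∫ t, h t * (V t - V a) ∂μ') = (∫ t, h t * V t ∂μ') - (U b - U a) * V a := by
    rw [hU.sub_eq_Ioc hab, ← integral_mul_const, ← integral_sub j2 c2]
    congr 1; ext t; ring
  linear_combination total + t1 + t2

/-- The symmetric form of integration by parts: `d(UV) = (h v + u k) μ` with the balanced
representatives `u`, `v` of `U`, `V`. -/
lemma mul (hU : IsPrimitive μ U h) (hV : IsPrimitive μ V k) :
    IsPrimitive μ (fun x => U x * V x) (fun t => h t * (V t - μ.real {t} / 2 * k t) +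
      (U t - μ.real {t} / 2 * h t) * k t) := by
  -- The diagonal term μ{t} h k is subtracted once in all; sharing it equally between the two
  -- summands turns both factors into balanced values.
  have e : (fun t => h t * (V t - μ.real {t} / 2 * k t) + (U t - μ.real {t} / 2 * h t) * k t) =
      fun t => (U t - μ.real {t} * h t) * k t + h t * V t := by
    ext t; ring
  rw [e]
  have hle : ∀ a b, a ≤ b → IntegrableOn
      (fun t => (U t - μ.real {t} * h t) * k t + h t * V t) (Set.Ioc a b) μ ∧ U b * V b - U a * V a =
      ∫ t in Set.Ioc a b, ((U t - μ.real {t} * h t) * k t + h t * V t) ∂μ := by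
    intro a b hab
    obtain ⟨h1, h2, h3⟩ := hU.mul_sub_mul hV hab
    exact ⟨h1.add h2, by rw [h3, integral_add h1 h2]⟩
  refine ⟨fun x => ⟨Set.Ioc (x - 1) (x + 1), ?_, (hle _ _ (by linarith)).1⟩, fun a b => ?_⟩
  · exact Ioc_mem_nhds (by linarith) (by linarith)
  · rcases le_total a b with hab | hab
    · rw [intervalIntegral.integral_of_le hab, ← (hle a b hab).2]
    · rw [intervalIntegral.integral_of_ge hab, ← (hle b a hab).2]
      ring

end IsPrimitive

end DistributionalSystem

namespace DistributionalSystem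

open scoped ENNReal

/-! ### Volterra integral equations -/

/-- The points strictly before `t` on the way from `0⁺` to `t`. -/
def between (t : ℝ) : Set ℝ := {s | (0 < s ∧ s < t) ∨ (t < s ∧ s ≤ 0)}

lemma between_of_pos {t : ℝ} (ht : 0 < t) : between t = Set.Ioo 0 t := by
  ext s; simp only [between, Set.mem_ofPred_eq, Set.mem_Ioo]
  constructor
  · rintro (h | h)
    · exact h
    · linarith
  · exact Or.inl

lemma between_of_nonpos {t : ℝ} (ht : t ≤ 0) : between t = Set.Ioc t 0 := by
  ext s; simp only [between, Set.mem_ofPred_eq, Set.mem_Ioc]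
  constructor
  · rintro (h | h)
    · linarith
    · exact h
  · exact Or.inr

lemma between_subset_Icc (t : ℝ) : between t ⊆ Set.Icc (-|t|) |t| := by
  rintro s (⟨h1, h2⟩ | ⟨h1, h2⟩)
  · exact ⟨by linarith [abs_nonneg t], h2.le.trans (le_abs_self t)⟩
  · exact ⟨by linarith [neg_abs_le t], h2.trans (abs_nonneg t)⟩

lemma between_subset {s t : ℝ} (h : s ∈ between t) : between s ⊆ between t := by
  rintro r (⟨h1, h2⟩ | ⟨h1, h2⟩) <;> rcases h with ⟨h3, h4⟩ | ⟨h3, h4⟩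
  · exact Or.inl ⟨h1, h2.trans h4⟩
  · linarith
  · linarith
  · exact Or.inr ⟨h3.trans h1, h2⟩

lemma notMem_between_of_mem {s t : ℝ} (h : s ∈ between t) : t ∉ between s := by
  rintro (⟨h1, h2⟩ | ⟨h1, h2⟩) <;> rcases h with ⟨h3, h4⟩ | ⟨h3, h4⟩ <;> linarith

lemma measurableSet_between_prod : MeasurableSet {p : ℝ × ℝ | p.2 ∈ between p.1} := by
  have h1 : MeasurableSet {p : ℝ × ℝ | 0 < p.2} := measurableSet_lt measurable_const measurable_snd
  have h2 : MeasurableSet {p : ℝ × ℝ | p.2 < p.1} := measurableSet_lt measurable_snd measurable_fst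
  have h3 : MeasurableSet {p : ℝ × ℝ | p.1 < p.2} := measurableSet_lt measurable_fst measurable_snd
  have h4 : MeasurableSet {p : ℝ × ℝ | p.2 ≤ 0} := measurableSet_le measurable_snd measurable_const
  exact (h1.inter h2).union (h3.inter h4)

lemma measurableSet_between (t : ℝ) : MeasurableSet (between t) :=
  measurable_prodMk_left (x := t) measurableSet_between_prod

lemma measurable_setLIntegral_between {κ : Measure ℝ} [SFinite κ] {f : ℝ → ℝ≥0∞}
    (hf : Measurable f) : Measurable fun t => ∫⁻ s in between t, f s ∂κ := by
  have : (fun t => ∫⁻ s in between t, f s ∂κ) = fun t => ∫⁻ s,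
      {p : ℝ × ℝ | p.2 ∈ between p.1}.indicator (fun p => f p.2) (t, s) ∂κ := by
    ext t
    rw [← lintegral_indicator (measurableSet_between t)]
    rfl
  rw [this]
  exact ((hf.comp measurable_snd).indicator measurableSet_between_prod).lintegral_prod_right'

/-- The iterated integrals `∫_{t ≻ s₁ ≻ ⋯ ≻ sₙ} dκ ⋯ dκ`. -/
def iterMass (κ : Measure ℝ) : ℕ → ℝ → ℝ≥0∞
  | 0, _ => 1
  | n + 1, t => ∫⁻ s in between t, iterMass κ n s ∂κ

lemma measurable_iterMass (κ : Measure ℝ) [SFinite κ] (n : ℕ) : Measurable (iterMass κ n) := by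
  induction n with
  | zero => exact measurable_const
  | succ n ih => exact measurable_setLIntegral_between ih

/-- The right side is the mass of chains of n points together with a free extra point before t. The
extra point can stand strictly inside the chain order at n + 1 positions; these give disjoint events
of mass `iterMass κ (n + 1) t` each. Coincidences at atoms are lost, whence only an inequality, but
in the useful direction. The induction separates the points before the outermost point s of the
chain from those after it. -/
lemma iterMass_succ_le (κ : Measure ℝ) [SFinite κ] (n : ℕ) (t : ℝ) :
    (n + 1) * iterMass κ (n + 1) t ≤ κ (between t) * iterMass κ n t := by
  induction n generalizing t with
  | zero => simp [iterMass]
  | succ n ih =>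
    have hJ := measurable_iterMass κ n
    have hb : Measurable fun s => κ (between s) := by
      simpa using measurable_setLIntegral_between (κ := κ) (f := fun _ => 1) measurable_const
    have hm : MeasurableSet {p : ℝ × ℝ | p.1 ∈ between p.2} :=
      measurable_swap measurableSet_between_prod
    have swap : ∫⁻ r in between t, iterMass κ (n + 1) r ∂κ =
        ∫⁻ s in between t, iterMass κ n s * κ ({r | s ∈ between r} ∩ between t) ∂κ := by
      have e1 : ∀ r ∈ between t, iterMass κ (n + 1) r = ∫⁻ s in between t,
          {p : ℝ × ℝ | p.2 ∈ between p.1}.indicator (fun p => iterMass κ n p.2) (r, s) ∂κ := by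
        intro r hr
        rw [iterMass, ← lintegral_indicator (measurableSet_between r),
          ← lintegral_indicator (measurableSet_between t)]
        congr 1
        ext s
        by_cases hs : s ∈ between r
        · rw [Set.indicator_of_mem hs, Set.indicator_of_mem (between_subset hr hs),
            Set.indicator_of_mem (by exact hs)]
        · rw [Set.indicator_of_notMem hs]
          by_cases hs' : s ∈ between t
          · rw [Set.indicator_of_mem hs', Set.indicator_of_notMem (by exact hs)]
          · rw [Set.indicator_of_notMem hs']
      rw [setLIntegral_congr_fun (measurableSet_between t) e1, lintegral_lintegral_swap]
      · refine lintegral_congr fun s => ?_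
        have hms : MeasurableSet {r | s ∈ between r} :=
          measurable_prodMk_right (y := s) measurableSet_between_prod
        have : (fun r => {p : ℝ × ℝ | p.2 ∈ between p.1}.indicator
            (fun p => iterMass κ n p.2) (r, s)) =
            {r | s ∈ between r}.indicator fun _ => iterMass κ n s := by
          ext r; rfl
        rw [this, lintegral_indicator hms, lintegral_const, Measure.restrict_restrict hms,
          Measure.restrict_apply_univ]
      · exact ((hJ.comp measurable_snd).indicator measurableSet_between_prod).aemeasurable
    calc ((n + 1 : ℕ) + 1 : ℝ≥0∞) * iterMass κ (n + 1 + 1) t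
        = (∫⁻ s in between t, (n + 1) * iterMass κ (n + 1) s ∂κ) +
          ∫⁻ s in between t, iterMass κ (n + 1) s ∂κ := by
          rw [lintegral_const_mul _ (measurable_iterMass κ _), iterMass]
          push_cast
          ring
      _ ≤ (∫⁻ s in between t, κ (between s) * iterMass κ n s ∂κ) +
          ∫⁻ s in between t, iterMass κ n s * κ ({r | s ∈ between r} ∩ between t) ∂κ := by
          rw [swap]
          exact add_le_add_left (lintegral_mono fun s => ih s) _
      _ = ∫⁻ s in between t, (κ (between s) * iterMass κ n s +
          iterMass κ n s * κ ({r | s ∈ between r} ∩ between t)) ∂κ :=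
          (lintegral_add_left (hb.mul hJ) _).symm
      _ ≤ ∫⁻ s in between t, κ (between t) * iterMass κ n s ∂κ := by
          refine setLIntegral_mono (hJ.const_mul _) fun s hs => ?_
          rw [mul_comm (iterMass κ n s), ← add_mul]
          gcongr
          -- The points before s and the points of `between t` after s are disjoint parts of
          -- `between t`.
          rw [← measure_union' ?_ (measurableSet_between s)]
          · exact measure_mono (Set.union_subset (between_subset hs) Set.inter_subset_right)
          · refine Set.disjoint_left.2 fun r hr hr' => ?_
            exact notMem_between_of_mem hr hr'.1
      _ = κ (between t) * iterMass κ (n + 1) t := by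
          rw [lintegral_const_mul _ hJ, iterMass]

lemma factorial_mul_iterMass_le (κ : Measure ℝ) [SFinite κ] (n : ℕ) (t : ℝ) :
    (n.factorial : ℝ≥0∞) * iterMass κ n t ≤ κ (between t) ^ n := by
  induction n with
  | zero => simp [iterMass]
  | succ n ih =>
    calc ((n + 1).factorial : ℝ≥0∞) * iterMass κ (n + 1) t
        = n.factorial * ((n + 1) * iterMass κ (n + 1) t) := by
          rw [Nat.factorial_succ]; push_cast; ring
      _ ≤ n.factorial * (κ (between t) * iterMass κ n t) := by
          exact mul_le_mul_right (iterMass_succ_le κ n t) _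
      _ = κ (between t) * (n.factorial * iterMass κ n t) := by ring
      _ ≤ κ (between t) * κ (between t) ^ n := by gcongr
      _ = κ (between t) ^ (n + 1) := by ring

lemma tsum_iterMass_lt_top (κ : Measure ℝ) [SFinite κ] {t : ℝ} (ht : κ (between t) ≠ ∞) :
    ∑' n, iterMass κ n t < ∞ := by
  set x := (κ (between t)).toReal with hx
  have h : ∀ n, iterMass κ n t ≤ ENNReal.ofReal (x ^ n / n.factorial) := by
    intro n
    have h1 := factorial_mul_iterMass_le κ n t
    have hf : (n.factorial : ℝ≥0∞) ≠ 0 := by exact_mod_cast n.factorial_ne_zero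
    rw [ENNReal.ofReal_div_of_pos (by positivity), ENNReal.ofReal_pow ENNReal.toReal_nonneg,
      ENNReal.ofReal_toReal ht, ENNReal.ofReal_natCast, ENNReal.le_div_iff_mul_le
      (Or.inl hf) (Or.inl (ENNReal.natCast_ne_top _)), mul_comm]
    exact h1
  calc ∑' n, iterMass κ n t ≤ ∑' n, ENNReal.ofReal (x ^ n / n.factorial) := ENNReal.tsum_le_tsum h
    _ = ENNReal.ofReal (∑' n, x ^ n / n.factorial) :=
      (ENNReal.ofReal_tsum_of_nonneg (fun n => by positivity) (Real.summable_pow_div_factorial x)).symm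
    _ < ∞ := ENNReal.ofReal_lt_top

/-! ### Neumann series for Volterra equations with atoms. -/

section Volterra

variable {E : Type*} [NormedAddCommGroup E] [NormedSpace ℝ E]

lemma stronglyMeasurable_integral_between {μ : Measure ℝ} [SFinite μ] {f : ℝ → E}
    (hf : StronglyMeasurable f) : StronglyMeasurable fun t => ∫ s in between t, f s ∂μ := by
  have : (fun t => ∫ s in between t, f s ∂μ) = fun t => ∫ s,
      {p : ℝ × ℝ | p.2 ∈ between p.1}.indicator (fun p => f p.2) (t, s) ∂μ := by
    ext t
    rw [← integral_indicator (measurableSet_between t)]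
    rfl
  rw [this]
  exact ((hf.comp_measurable measurable_snd).indicator
    measurableSet_between_prod).integral_prod_right'

/-- The iterates of the Volterra operator `f ↦ A ∫_{between t} f dμ`. -/
def volterraIter (μ : Measure ℝ) (A : ℝ → E →L[ℝ] E) (G : ℝ → E) : ℕ → ℝ → E
  | 0, t => G t
  | n + 1, t => A t (∫ s in between t, volterraIter μ A G n s ∂μ)

variable [CompleteSpace E]

/-- A linear Volterra equation whose kernel is locally integrable has a solution. -/
theorem exists_volterra_solution (μ : Measure ℝ) [SFinite μ] (A : ℝ → E →L[ℝ] E)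
    (hA : ∀ V : ℝ → E, StronglyMeasurable V → StronglyMeasurable fun t => A t (V t))
    (a : ℝ → ℝ≥0∞) (ha : Measurable a) (haA : ∀ t x, ‖A t x‖ₑ ≤ a t * ‖x‖ₑ) (ha' : ∀ t, a t ≠ ∞)
    (hai : ∀ t, ∫⁻ s in between t, a s ∂μ ≠ ∞)
    (G : ℝ → E) (hG : StronglyMeasurable G) (hGi : ∀ t, ∫⁻ s in between t, ‖G s‖ₑ ∂μ ≠ ∞) :
    ∃ h : ℝ → E, StronglyMeasurable h ∧ (∀ t, IntegrableOn h (between t) μ) ∧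
      ∀ t, h t = G t + A t (∫ s in between t, h s ∂μ) := by
  set H := volterraIter μ A G with hH
  have Hm : ∀ n, StronglyMeasurable (H n) := by
    intro n
    induction n with
    | zero => exact hG
    | succ n ih => exact hA _ (stronglyMeasurable_integral_between ih)
  set κ := μ.withDensity a with hκ
  have hκb : ∀ t, κ (between t) ≠ ∞ := by
    intro t
    rw [hκ, withDensity_apply _ (measurableSet_between t)]
    exact hai t
  set M : ℕ → ℝ → ℝ≥0∞ := fun n t => ∫⁻ s in between t, ‖H n s‖ₑ ∂μ with hM
  have hstep : ∀ n t, ‖H (n + 1) t‖ₑ ≤ a t * M n t := by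
    intro n t
    refine (haA t _).trans ?_
    gcongr
    exact enorm_integral_le_lintegral_enorm _
  -- `M 0` increases along `between`, so it can be pulled out of the iterated integrals; what
  -- remains are iterated masses of κ = a μ, summable thanks to the factorial bound. No smallness of
  -- the atoms is needed because `between t` excludes t.
  have hMb : ∀ n t, M n t ≤ M 0 t * iterMass κ n t := by
    intro n
    induction n with
    | zero => intro t; simp [iterMass]
    | succ n ih =>
      intro t
      calc M (n + 1) t ≤ ∫⁻ s in between t, a s * (M 0 t * iterMass κ n s) ∂μ := by
            refine setLIntegral_mono (ha.mul ((measurable_iterMass κ n).const_mul _)) fun s hs => ?_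
            refine (hstep n s).trans ?_
            gcongr
            refine (ih s).trans ?_
            gcongr
            exact lintegral_mono_set (between_subset hs)
        _ = M 0 t * iterMass κ (n + 1) t := by
            rw [iterMass, hκ, restrict_withDensity (measurableSet_between t),
              lintegral_withDensity_eq_lintegral_mul _ ha (measurable_iterMass _ n),
              ← lintegral_const_mul _ (ha.mul (measurable_iterMass _ n))]
            congr 1
            ext s
            simp only [Pi.mul_apply]
            ring
  have hMs : ∀ t, ∑' n, M n t ≠ ∞ := by
    intro t
    refine ne_top_of_le_ne_top ?_ (ENNReal.tsum_le_tsum fun n => hMb n t)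
    rw [ENNReal.tsum_mul_left]
    exact ENNReal.mul_ne_top (hGi t) (tsum_iterMass_lt_top κ (hκb t)).ne
  have hsum1 : ∀ t, Summable fun n => H (n + 1) t := by
    intro t
    refine Summable.of_norm ?_
    have hfin : ∑' n, ‖H (n + 1) t‖ₑ ≠ ∞ := by
      refine ne_top_of_le_ne_top ?_ (ENNReal.tsum_le_tsum fun n => hstep n t)
      rw [ENNReal.tsum_mul_left]
      exact ENNReal.mul_ne_top (ha' t) (hMs t)
    simpa [← toReal_enorm] using ENNReal.summable_toReal hfin
  have hsum : ∀ t, Summable fun n => H n t := fun t => (summable_nat_add_iff 1).1 (hsum1 t)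
  have htsm : StronglyMeasurable fun t => ∑' n, H n t := by
    refine stronglyMeasurable_of_tendsto atTop
      (f := fun N t => ∑ n ∈ Finset.range N, H n t) (fun N => ?_) ?_
    · exact Finset.stronglyMeasurable_fun_sum _ fun n _ => Hm n
    · exact tendsto_pi_nhds.2 fun t => (hsum t).hasSum.tendsto_sum_nat
  refine ⟨fun t => ∑' n, H n t, htsm, fun t => ⟨htsm.aestronglyMeasurable, ?_⟩, fun t => ?_⟩
  · refine lt_of_le_of_lt (lintegral_mono fun s => enorm_tsum_le_tsum_enorm) ?_
    rw [lintegral_tsum fun n => (Hm n).enorm.aemeasurable]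
    exact lt_top_iff_ne_top.2 (hMs t)
  · beta_reduce
    rw [integral_tsum (fun n => (Hm n).aestronglyMeasurable) (hMs t),
      (hsum t).tsum_eq_zero_add]
    congr 1
    have hs : Summable fun n => ∫ s in between t, H n s ∂μ := by
      refine Summable.of_norm ?_
      have hfin : ∑' n, ‖∫ s in between t, H n s ∂μ‖ₑ ≠ ∞ :=
        ne_top_of_le_ne_top (hMs t)
          (ENNReal.tsum_le_tsum fun n => enorm_integral_le_lintegral_enorm _)
      simpa [← toReal_enorm] using ENNReal.summable_toReal hfin
    rw [(A t).map_tsum hs]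
    rfl

end Volterra
end DistributionalSystem

namespace DistributionalSystem

open scoped ENNReal

/-! ### Systems with measure coefficients -/

/-- The coefficients of a system `J u' + q u = r` with `q = Q μ` for which the initial value
problem is uniquely solvable. -/
structure IsRegularSystem (μ : Measure ℝ) (J : Matrix (Fin 2) (Fin 2) ℂ)
    (Q : ℝ → Matrix (Fin 2) (Fin 2) ℂ) : Prop where
  skew : Jᵀ = -J
  ne_zero : J 1 0 ≠ 0
  symm : ∀ x, (Q x)ᵀ = Q x
  measurable : ∀ i j, Measurable fun x => Q x i j
  bdd : ∃ C : ℝ, ∀ᵐ x ∂μ, ∀ i j, ‖Q x i j‖ ≤ C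
  det_ne : ∀ x, (J + (μ.real {x} / 2 : ℂ) • Q x).det ≠ 0

/-- The balanced representative of a primitive `U` of `h μ`. -/
def bal (μ : Measure ℝ) (U h : ℝ → Fin 2 → ℂ) (x : ℝ) (j : Fin 2) : ℂ :=
  U x j - μ.real {x} / 2 * h x j

/-- `bal μ U h` is a balanced solution of `J u' + Q μ u = R μ`; `U` is the family of its right-hand
limits and `h` is the density of `u'`. -/
structure IsSol (μ : Measure ℝ) (J : Matrix (Fin 2) (Fin 2) ℂ) (Q : ℝ → Matrix (Fin 2) (Fin 2) ℂ)
    (R : ℝ → Fin 2 → ℂ) (U h : ℝ → Fin 2 → ℂ) : Prop where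
  prim : ∀ j, IsPrimitive μ (fun x => U x j) (fun x => h x j)
  eqn : ∀ᵐ x ∂μ, J *ᵥ h x = R x - Q x *ᵥ bal μ U h x

lemma mulVec_fin_two (A : Matrix (Fin 2) (Fin 2) ℂ) (x : Fin 2 → ℂ) (i : Fin 2) :
    (A *ᵥ x) i = A i 0 * x 0 + A i 1 * x 1 := by
  simp [Matrix.mulVec, dotProduct, Fin.sum_univ_two]

lemma measurable_measure_singleton (μ : Measure ℝ) [SFinite μ] :
    Measurable fun t => μ.real {t} := by
  have hm : MeasurableSet {p : ℝ × ℝ | p.2 = p.1} :=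
    measurableSet_eq_fun measurable_snd measurable_fst
  exact (measurable_measure_prodMk_left (ν := μ) hm).ennreal_toReal

lemma inv_fin_two_apply (X : Matrix (Fin 2) (Fin 2) ℂ) (i j : Fin 2) :
    X⁻¹ i j = X.det⁻¹ * X.adjugate i j := by
  rw [Matrix.inv_def, Ring.inverse_eq_inv', Matrix.smul_apply, smul_eq_mul]

lemma norm_adjugate_fin_two_le {X : Matrix (Fin 2) (Fin 2) ℂ} {c : ℝ} (h : ∀ i j, ‖X i j‖ ≤ c)
    (i j : Fin 2) : ‖X.adjugate i j‖ ≤ c := by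
  rw [Matrix.adjugate_fin_two]
  fin_cases i <;> fin_cases j <;> simp [h]

namespace IsRegularSystem

variable {μ : Measure ℝ} [IsLocallyFiniteMeasure μ] {J : Matrix (Fin 2) (Fin 2) ℂ}
  {Q : ℝ → Matrix (Fin 2) (Fin 2) ℂ}

omit [IsLocallyFiniteMeasure μ] in
lemma J_apply (S : IsRegularSystem μ J Q) : J 0 0 = 0 ∧ J 1 1 = 0 ∧ J 0 1 = -J 1 0 := by
  have h := S.skew
  refine ⟨?_, ?_, ?_⟩
  · have := congrFun (congrFun h 0) 0
    simp only [Matrix.transpose_apply, Matrix.neg_apply] at this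
    linear_combination this / 2
  · have := congrFun (congrFun h 1) 1
    simp only [Matrix.transpose_apply, Matrix.neg_apply] at this
    linear_combination this / 2
  · simpa using congrFun (congrFun h 1) 0

omit [IsLocallyFiniteMeasure μ] in
lemma Q_apply (S : IsRegularSystem μ J Q) (x : ℝ) : Q x 1 0 = Q x 0 1 :=
  congrFun (congrFun (S.symm x) 0) 1

-- In the determinant of a 2×2 skew matrix plus a multiple of a symmetric one the mixed terms
-- cancel, so only the square of the multiplier matters. Hence invertibility with one sign implies
-- it with the other, which is what solving both to the right and to the left of 0 requires.
omit [IsLocallyFiniteMeasure μ] in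
lemma det_eq (S : IsRegularSystem μ J Q) (x : ℝ) {e : ℂ} (he : e * e = 1) :
    (J + (e * (μ.real {x} / 2) : ℂ) • Q x).det =
      J 1 0 ^ 2 + (μ.real {x} / 2 : ℂ) ^ 2 * (Q x).det := by
  obtain ⟨h0, h1, h2⟩ := S.J_apply
  simp only [Matrix.det_fin_two, Matrix.add_apply, Matrix.smul_apply, smul_eq_mul, h0, h1, h2,
    S.Q_apply x]
  linear_combination (μ.real {x} / 2 : ℂ) ^ 2 * (Q x 0 0 * Q x 1 1 - Q x 0 1 * Q x 0 1) * he

omit [IsLocallyFiniteMeasure μ] in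
lemma det_ne' (S : IsRegularSystem μ J Q) (x : ℝ) {e : ℂ} (he : e * e = 1) :
    (J + (e * (μ.real {x} / 2) : ℂ) • Q x).det ≠ 0 := by
  have := S.det_ne x
  rw [← one_mul (μ.real {x} / 2 : ℂ), S.det_eq x (one_mul 1)] at this
  rwa [S.det_eq x he]

/-- A compact set contains only finitely many atoms of mass at least δ, and at those any bound will
do. At all other points the perturbation of J is small: with δ = c / (C + 1) one has μ{x} C ≤ c, so
that the determinant stays at least c² / 2 in absolute value. -/
lemma inv_bdd (S : IsRegularSystem μ J Q) {e : ℝ → ℂ} (he : ∀ x, e x * e x = 1) {K : Set ℝ}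
    (hK : IsCompact K) : ∃ C : ℝ, ∀ᵐ x ∂μ, x ∈ K → ∀ i j,
      ‖(J + (e x * (μ.real {x} / 2) : ℂ) • Q x)⁻¹ i j‖ ≤ C := by
  obtain ⟨C₀, hC₀⟩ := S.bdd
  set C := max C₀ 0 with hCdef
  have hC : ∀ᵐ x ∂μ, ∀ i j, ‖Q x i j‖ ≤ C := by
    filter_upwards [hC₀] with x hx i j using (hx i j).trans (le_max_left _ _)
  have hC0 : 0 ≤ C := le_max_right _ _
  set c := ‖J 1 0‖ with hc
  have hcpos : 0 < c := norm_pos_iff.2 S.ne_zero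
  set δ := c / (C + 1) with hδ
  have hδpos : 0 < δ := by positivity
  have hF : {x | x ∈ K ∧ δ ≤ μ.real {x}}.Finite := by
    have hfin : (μ.restrict K) (⋃ x : ℝ, {x}) ≠ ∞ :=
      ne_top_of_le_ne_top hK.measure_lt_top.ne
        ((measure_mono (Set.subset_univ _)).trans (Measure.restrict_apply_univ K).le)
    refine (Measure.finite_const_le_meas_of_disjoint_iUnion (μ.restrict K)
      (ε := ENNReal.ofReal δ) (by simpa using hδpos) (As := fun x : ℝ => ({x} : Set ℝ))
      (fun x => measurableSet_singleton x) ?_ hfin).subset ?_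
    · intro x y hxy
      simpa using hxy
    · rintro x ⟨hx, hx'⟩
      simp only [Set.mem_ofPred_eq]
      rw [Measure.restrict_apply (measurableSet_singleton x),
        Set.inter_eq_left.2 (by simpa using hx)]
      exact ENNReal.ofReal_le_of_le_toReal hx'
  have hJ : ∀ i j, ‖J i j‖ ≤ c := by
    obtain ⟨h0, h1, h2⟩ := S.J_apply
    intro i j
    fin_cases i <;> fin_cases j <;> simp [h0, h1, h2, hc]
  have hX : ∀ x, (∀ i j, ‖Q x i j‖ ≤ C) → μ.real {x} < δ → ∀ i j,
      ‖(J + (e x * (μ.real {x} / 2) : ℂ) • Q x)⁻¹ i j‖ ≤ 2 * (c + c) / c ^ 2 := by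
    intro x hx hm i j
    have hm0 : 0 ≤ μ.real {x} := measureReal_nonneg
    have hne : ‖e x‖ = 1 := by
      have := congrArg norm (he x)
      rw [norm_mul, norm_one] at this
      nlinarith [norm_nonneg (e x)]
    have hδC : δ * C ≤ c := by
      rw [hδ, div_mul_eq_mul_div, div_le_iff₀ (by positivity)]
      nlinarith
    have hmC : μ.real {x} * C ≤ c := le_trans (by gcongr) hδC
    have hnm : ‖(μ.real {x} / 2 : ℂ)‖ = μ.real {x} / 2 := by
      rw [norm_div, Complex.norm_real, Real.norm_of_nonneg hm0]; simp
    have hentry : ∀ i j, ‖(J + (e x * (μ.real {x} / 2) : ℂ) • Q x) i j‖ ≤ c + c := by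
      intro i j
      rw [Matrix.add_apply, Matrix.smul_apply, smul_eq_mul]
      refine (norm_add_le _ _).trans (add_le_add (hJ i j) ?_)
      rw [norm_mul, norm_mul, hne, hnm, one_mul]
      have := hx i j
      have := norm_nonneg (Q x i j)
      nlinarith
    have hdet : c ^ 2 / 2 ≤ ‖(J + (e x * (μ.real {x} / 2) : ℂ) • Q x).det‖ := by
      rw [S.det_eq x (he x)]
      have h1 : ‖(Q x).det‖ ≤ 2 * C ^ 2 := by
        rw [Matrix.det_fin_two]
        refine (norm_sub_le _ _).trans ?_
        rw [norm_mul, norm_mul]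
        have := hx 0 0; have := hx 0 1; have := hx 1 0; have := hx 1 1
        have a1 : ‖Q x 0 0‖ * ‖Q x 1 1‖ ≤ C * C := by gcongr
        have a2 : ‖Q x 0 1‖ * ‖Q x 1 0‖ ≤ C * C := by gcongr
        linarith
      have h2 : ‖(μ.real {x} / 2 : ℂ) ^ 2 * (Q x).det‖ ≤ c ^ 2 / 2 := by
        rw [norm_mul, norm_pow, hnm]
        calc (μ.real {x} / 2) ^ 2 * ‖(Q x).det‖ ≤ (μ.real {x} / 2) ^ 2 * (2 * C ^ 2) := by gcongr
          _ = (μ.real {x} * C) ^ 2 / 2 := by ring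
          _ ≤ c ^ 2 / 2 := by gcongr
      have h3 := norm_sub_le_norm_add (J 1 0 ^ 2) ((μ.real {x} / 2 : ℂ) ^ 2 * (Q x).det)
      rw [norm_pow] at h3
      linarith
    rw [inv_fin_two_apply, norm_mul, norm_inv]
    have := norm_adjugate_fin_two_le hentry i j
    calc ‖(J + (e x * (μ.real {x} / 2) : ℂ) • Q x).det‖⁻¹ *
          ‖(J + (e x * (μ.real {x} / 2) : ℂ) • Q x).adjugate i j‖
        ≤ (c ^ 2 / 2)⁻¹ * (c + c) := by gcongr
      _ = 2 * (c + c) / c ^ 2 := by field_simp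
  set D : ℝ → ℝ := fun x => ∑ i, ∑ j, ‖(J + (e x * (μ.real {x} / 2) : ℂ) • Q x)⁻¹ i j‖ with hD
  have hDn : ∀ x, 0 ≤ D x := fun x => Finset.sum_nonneg fun i _ =>
    Finset.sum_nonneg fun j _ => norm_nonneg _
  refine ⟨2 * (c + c) / c ^ 2 + ∑ x ∈ hF.toFinset, D x, ?_⟩
  filter_upwards [hC] with x hx hxK i j
  have hs : 0 ≤ ∑ x ∈ hF.toFinset, D x := Finset.sum_nonneg fun x _ => hDn x
  by_cases hm : δ ≤ μ.real {x}
  · have h1 : D x ≤ ∑ x ∈ hF.toFinset, D x :=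
      Finset.single_le_sum (fun x _ => hDn x) (by simpa using ⟨hxK, hm⟩)
    have h2 : ‖(J + (e x * (μ.real {x} / 2) : ℂ) • Q x)⁻¹ i j‖ ≤ D x :=
      (Finset.single_le_sum (f := fun j => ‖(J + (e x * (μ.real {x} / 2) : ℂ) • Q x)⁻¹ i j‖)
        (fun j _ => norm_nonneg _) (Finset.mem_univ j)).trans
      (Finset.single_le_sum
        (f := fun i => ∑ j, ‖(J + (e x * (μ.real {x} / 2) : ℂ) • Q x)⁻¹ i j‖)
        (fun i _ => Finset.sum_nonneg fun j _ => norm_nonneg _) (Finset.mem_univ i))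
    have : 0 ≤ 2 * (c + c) / c ^ 2 := by positivity
    linarith
  · linarith [hX x hx (not_le.1 hm) i j]

end IsRegularSystem
end DistributionalSystem

namespace DistributionalSystem

open scoped ENNReal

/-! ### Existence of solutions -/

lemma enorm_mulVec_le (A : Matrix (Fin 2) (Fin 2) ℂ) (x : Fin 2 → ℂ) :
    ‖A *ᵥ x‖ₑ ≤ (∑ i, ∑ j, ‖A i j‖ₑ) * ‖x‖ₑ := by
  have h : ‖A *ᵥ x‖ ≤ (∑ i, ∑ j, ‖A i j‖) * ‖x‖ := by
    refine (pi_norm_le_iff_of_nonneg (by positivity)).2 fun i => ?_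
    have h1 : ‖(A *ᵥ x) i‖ ≤ (∑ j, ‖A i j‖) * ‖x‖ := by
      rw [Matrix.mulVec, dotProduct, Finset.sum_mul]
      refine (norm_sum_le _ _).trans (Finset.sum_le_sum fun j _ => ?_)
      rw [norm_mul]
      gcongr
      exact norm_le_pi_norm x j
    refine h1.trans ?_
    refine mul_le_mul_of_nonneg_right ?_ (norm_nonneg x)
    exact Finset.single_le_sum (f := fun i => ∑ j, ‖A i j‖)
      (fun i _ => Finset.sum_nonneg fun j _ => norm_nonneg _) (Finset.mem_univ i)
  calc ‖A *ᵥ x‖ₑ = ENNReal.ofReal ‖A *ᵥ x‖ := (ofReal_norm _).symm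
    _ ≤ ENNReal.ofReal ((∑ i, ∑ j, ‖A i j‖) * ‖x‖) := ENNReal.ofReal_le_ofReal h
    _ = _ := by
      rw [ENNReal.ofReal_mul (by positivity), ofReal_norm, ENNReal.ofReal_sum_of_nonneg
        (fun i _ => by positivity)]
      congr 1
      refine Finset.sum_congr rfl fun i _ => ?_
      rw [ENNReal.ofReal_sum_of_nonneg (fun i _ => by positivity)]
      simp only [ofReal_norm]

lemma measurable_mulVec {A : ℝ → Matrix (Fin 2) (Fin 2) ℂ} (hA : ∀ i j, Measurable fun x => A x i j)
    {V : ℝ → Fin 2 → ℂ} (hV : Measurable V) : Measurable fun x => A x *ᵥ V x := by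
  refine measurable_pi_iff.2 fun i => ?_
  simp only [mulVec_fin_two]
  exact ((hA i 0).mul (measurable_pi_iff.1 hV 0)).add ((hA i 1).mul (measurable_pi_iff.1 hV 1))

lemma setLIntegral_between_ne_top {μ : Measure ℝ} {f : ℝ → ℂ} (hf : LocallyIntegrable f μ) (t : ℝ) :
    ∫⁻ s in between t, ‖f s‖ₑ ∂μ ≠ ∞ :=
  ((hf.integrableOn_isCompact (k := Set.Icc (-|t|) |t|) isCompact_Icc).mono_set
    (between_subset_Icc t)).2.ne

lemma locallyIntegrable_bdd_mul {μ : Measure ℝ} {f g : ℝ → ℂ} (hg : LocallyIntegrable g μ)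
    (hf : AEStronglyMeasurable f μ)
    (hb : ∀ K : Set ℝ, IsCompact K → ∃ C : ℝ, ∀ᵐ x ∂μ, x ∈ K → ‖f x‖ ≤ C) :
    LocallyIntegrable (fun x => f x * g x) μ := by
  intro x
  refine ⟨Set.Icc (x - 1) (x + 1), Icc_mem_nhds (by linarith) (by linarith), ?_⟩
  obtain ⟨C, hC⟩ := hb _ (isCompact_Icc (a := x - 1) (b := x + 1))
  exact (hg.integrableOn_isCompact isCompact_Icc).bdd_mul hf.restrict
    ((ae_restrict_iff' measurableSet_Icc).2 hC)

lemma locallyIntegrable_of_between {μ : Measure ℝ} {h : ℝ → ℂ}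
    (hi : ∀ t, IntegrableOn h (between t) μ) : LocallyIntegrable h μ := by
  intro x
  have h1 := hi (|x| + 1)
  have h2 := hi (-(|x| + 1))
  rw [between_of_pos (by positivity)] at h1
  rw [between_of_nonpos (by linarith [abs_nonneg x])] at h2
  refine ⟨Set.Ioo (-(|x| + 1)) (|x| + 1), Ioo_mem_nhds ?_ ?_, (h2.union h1).mono_set ?_⟩
  · linarith [neg_abs_le x]
  · linarith [le_abs_self x]
  · rintro y ⟨hy1, hy2⟩
    rcases le_or_gt y 0 with hy | hy
    · exact Or.inl ⟨hy1, hy⟩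
    · exact Or.inr ⟨hy, hy2⟩

/-- The mass of a singleton enters a primitive with opposite signs on the two half-lines. -/
lemma between_integral_eq {μ : Measure ℝ} {h : ℝ → ℂ} (hh : LocallyIntegrable h μ) (t : ℝ) :
    (if 0 < t then 1 else -1) * ∫ s in between t, h s ∂μ =
      (∫ s in (0 : ℝ)..t, h s ∂μ) - μ.real {t} / 2 * h t -
        (if 0 < t then 1 else -1) * (μ.real {t} / 2) * h t := by
  have hP := isPrimitive_integral hh 0 0
  split_ifs with ht
  · rw [between_of_pos ht, ← hP.sub_eq_Ioo ht, intervalIntegral.integral_same]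
    ring
  · rw [between_of_nonpos (not_lt.1 ht), ← hP.sub_eq_Ioc (not_lt.1 ht),
      intervalIntegral.integral_same]
    ring

namespace IsRegularSystem

variable {μ : Measure ℝ} [IsLocallyFiniteMeasure μ] {J : Matrix (Fin 2) (Fin 2) ℂ}
  {Q : ℝ → Matrix (Fin 2) (Fin 2) ℂ}

/-- The inhomogeneous initial value problem is solvable. -/
theorem exists_isSol (S : IsRegularSystem μ J Q) {R : ℝ → Fin 2 → ℂ}
    (hR : ∀ j, LocallyIntegrable (fun x => R x j) μ) (c : Fin 2 → ℂ) :
    ∃ U h : ℝ → Fin 2 → ℂ, IsSol μ J Q R U h ∧ U 0 = c := by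
  classical
  have hRm : AEStronglyMeasurable R μ :=
    (aemeasurable_pi_iff.2 fun j => (hR j).aestronglyMeasurable.aemeasurable).aestronglyMeasurable
  set R' := hRm.mk R with hR'
  have hRR' : R =ᵐ[μ] R' := hRm.ae_eq_mk
  have hR'm : Measurable R' := hRm.stronglyMeasurable_mk.measurable
  -- The sign of the direction away from 0⁺. To the right, U already contains the full atom at t, so
  -- u is half an atom ahead of the integral over `between t`; to the left it is half an atom
  -- behind.
  set e : ℝ → ℂ := fun t => if 0 < t then 1 else -1 with he
  have he1 : ∀ t, e t * e t = 1 := by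
    intro t; simp only [he]; split_ifs <;> ring
  have hem : Measurable e := Measurable.ite measurableSet_Ioi measurable_const measurable_const
  set B : ℝ → Matrix (Fin 2) (Fin 2) ℂ := fun x => J + (e x * (μ.real {x} / 2) : ℂ) • Q x with hB
  have hBm : ∀ i j, Measurable fun x => B x i j := by
    intro i j
    simp only [hB, Matrix.add_apply, Matrix.smul_apply, smul_eq_mul]
    exact measurable_const.add ((hem.mul ((Complex.measurable_ofReal.comp
      (measurable_measure_singleton μ)).div_const 2)).mul (S.measurable i j))
  have hBinv : ∀ i j, Measurable fun x => (B x)⁻¹ i j := by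
    intro i j
    simp only [inv_fin_two_apply, Matrix.adjugate_fin_two, Matrix.det_fin_two]
    refine Measurable.mul ((((hBm 0 0).mul (hBm 1 1)).sub ((hBm 0 1).mul (hBm 1 0))).inv) ?_
    fin_cases i <;> fin_cases j <;> simp [hBm]
  have hBu : ∀ x, B x * (B x)⁻¹ = 1 := fun x =>
    Matrix.mul_nonsing_inv _ (isUnit_iff_ne_zero.2 (S.det_ne' x (he1 x)))
  have hBb : ∀ i j, ∀ K : Set ℝ, IsCompact K → ∃ C : ℝ, ∀ᵐ x ∂μ, x ∈ K → ‖(B x)⁻¹ i j‖ ≤ C := by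
    intro i j K hK
    obtain ⟨C, hC⟩ := S.inv_bdd he1 hK
    exact ⟨C, hC.mono fun x hx hxK => hx hxK i j⟩
  have hinvmul : ∀ g : ℝ → ℂ, LocallyIntegrable g μ → ∀ i j,
      LocallyIntegrable (fun x => (B x)⁻¹ i j * g x) μ := fun g hg i j =>
    locallyIntegrable_bdd_mul hg (hBinv i j).aestronglyMeasurable (hBb i j)
  have hQl : ∀ i j, LocallyIntegrable (fun x => Q x i j) μ := by
    intro i j
    obtain ⟨C, hC⟩ := S.bdd
    have := locallyIntegrable_bdd_mul (μ := μ) (locallyIntegrable_const (1 : ℂ))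
      (S.measurable i j).aestronglyMeasurable
      (fun K _ => ⟨C, hC.mono fun x hx _ => hx i j⟩)
    simpa using this
  set N : ℝ → Matrix (Fin 2) (Fin 2) ℂ := fun x => (-e x) • ((B x)⁻¹ * Q x) with hN
  have hNe : ∀ x i j, N x i j = -e x * ((B x)⁻¹ i 0 * Q x 0 j + (B x)⁻¹ i 1 * Q x 1 j) := by
    intro x i j
    simp [hN, Matrix.mul_apply, Fin.sum_univ_two]
  have hNm : ∀ i j, Measurable fun x => N x i j := by
    intro i j
    simp only [hNe]
    exact hem.neg.mul (((hBinv i 0).mul (S.measurable 0 j)).add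
      ((hBinv i 1).mul (S.measurable 1 j)))
  have hNl : ∀ i j, LocallyIntegrable (fun x => N x i j) μ := by
    intro i j
    simp only [hNe]
    refine locallyIntegrable_bdd_mul ((hinvmul _ (hQl 0 j) i 0).add (hinvmul _ (hQl 1 j) i 1))
      hem.neg.aestronglyMeasurable fun K _ => ⟨1, ae_of_all _ fun x _ => ?_⟩
    simp only [he, norm_neg]
    split_ifs <;> simp
  -- Inserting u = c + e ∫ h + e (μ{x}/2) h into J h = R - Q u and moving the local term to the left
  -- gives B h = R - Q (c + e ∫ h), with the integral over `between x`. Multiplication by B⁻¹ is the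
  -- Volterra equation with kernel `N` and inhomogeneity `G`.
  set G : ℝ → Fin 2 → ℂ := fun x => (B x)⁻¹ *ᵥ (R' x - Q x *ᵥ c) with hG
  have hGm : Measurable G :=
    measurable_mulVec hBinv (hR'm.sub (measurable_mulVec S.measurable measurable_const))
  have hGl : ∀ j, LocallyIntegrable (fun x => G x j) μ := by
    have h0 : ∀ j, LocallyIntegrable (fun x => R' x j - (Q x *ᵥ c) j) μ := by
      intro j
      have h1 : LocallyIntegrable (fun x => R' x j) μ :=
        (hR j).congr (hRR'.mono fun x hx => congrFun hx j)
      have h2 : LocallyIntegrable (fun x => (Q x *ᵥ c) j) μ := by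
        simp only [mulVec_fin_two, mul_comm _ (c _)]
        exact ((hQl j 0).smul (c 0)).add ((hQl j 1).smul (c 1))
      exact h1.sub h2
    intro j
    simp only [hG, mulVec_fin_two, Pi.sub_apply]
    exact (hinvmul _ (by simpa only [mulVec_fin_two] using h0 0) j 0).add
      (hinvmul _ (by simpa only [mulVec_fin_two] using h0 1) j 1)
  obtain ⟨h, hm, hi, heq⟩ := exists_volterra_solution μ
    (fun x => ((Matrix.mulVecLin (N x)).toContinuousLinearMap).restrictScalars ℝ)
    (fun V hV => (measurable_mulVec hNm hV.measurable).stronglyMeasurable)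
    (fun x => ∑ i, ∑ j, ‖N x i j‖ₑ)
    (Finset.measurable_fun_sum _ fun i _ => Finset.measurable_fun_sum _ fun j _ =>
      (hNm i j).enorm)
    (fun t x => enorm_mulVec_le (N t) x)
    (fun t => (ENNReal.sum_lt_top.2 fun i _ => ENNReal.sum_lt_top.2 fun j _ => enorm_lt_top).ne)
    (fun t => by
      rw [lintegral_finsetSum _ fun i _ => Finset.measurable_fun_sum _ fun j _ => (hNm i j).enorm]
      refine (ENNReal.sum_lt_top.2 fun i _ => ?_).ne
      rw [lintegral_finsetSum _ fun j _ => (hNm i j).enorm]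
      exact ENNReal.sum_lt_top.2 fun j _ =>
        (setLIntegral_between_ne_top (hNl i j) t).lt_top)
    G hGm.stronglyMeasurable
    (fun t => by
      have : IntegrableOn G (between t) μ := Integrable.of_eval fun j =>
        ((hGl j).integrableOn_isCompact (k := Set.Icc (-|t|) |t|) isCompact_Icc).mono_set
          (between_subset_Icc t)
      exact this.2.ne)
  have hij : ∀ j t, IntegrableOn (fun x => h x j) (between t) μ := fun j t =>
    (hi t).eval j
  have hl : ∀ j, LocallyIntegrable (fun x => h x j) μ := fun j => locallyIntegrable_of_between (hij j)
  refine ⟨fun x j => c j + ∫ t in (0 : ℝ)..x, h t j ∂μ, h,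
    ⟨fun j => isPrimitive_integral (hl j) 0 (c j), ?_⟩, by simp⟩
  filter_upwards [hRR'] with x hx
  set u := bal μ (fun x j => c j + ∫ t in (0 : ℝ)..x, h t j ∂μ) h x with hu
  have hV : ∀ j, (∫ s in between x, h s ∂μ) j = ∫ s in between x, h s j ∂μ := fun j =>
    eval_integral (fun j => hij j x) j
  have huV : u = c + e x • (∫ s in between x, h s ∂μ) + (e x * (μ.real {x} / 2)) • h x := by
    ext j
    simp only [hu, bal, Pi.add_apply, Pi.smul_apply, smul_eq_mul, hV, he,
      between_integral_eq (hl j)]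
    ring
  have hBh : B x *ᵥ h x = R' x - Q x *ᵥ (c + e x • (∫ s in between x, h s ∂μ)) := by
    have : h x = (B x)⁻¹ *ᵥ (R' x - Q x *ᵥ (c + e x • (∫ s in between x, h s ∂μ))) := by
      conv_lhs => rw [heq x]
      simp only [hG, hN, ContinuousLinearMap.coe_restrictScalars',
        LinearMap.coe_toContinuousLinearMap', Matrix.mulVecLin_apply, Matrix.smul_mulVec,
        Matrix.mulVec_add, Matrix.mulVec_sub, Matrix.mulVec_smul, Matrix.mulVec_mulVec, neg_smul, Matrix.neg_mulVec]
      abel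
    rw [this, Matrix.mulVec_mulVec, hBu, Matrix.one_mulVec]
  rw [hx, huV, Matrix.mulVec_add, ← sub_sub, ← hBh, hB, Matrix.add_mulVec, Matrix.smul_mulVec,
    Matrix.mulVec_smul]
  abel

end IsRegularSystem
end DistributionalSystem

namespace DistributionalSystem

open scoped ENNReal

/-! ### Lagrange's identity and uniqueness -/

lemma IsPrimitive.congr_ae {μ : Measure ℝ} {U h k : ℝ → ℂ} (hU : IsPrimitive μ U h)
    (hk : h =ᵐ[μ] k) : IsPrimitive μ U k := by
  refine ⟨hU.1.congr hk, fun a b => ?_⟩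
  rw [hU.sub_eq]
  exact intervalIntegral.integral_congr_ae (hk.mono fun x hx _ => hx)

lemma IsPrimitive.eq_of_zero {μ : Measure ℝ} {U h : ℝ → ℂ} (hU : IsPrimitive μ U h)
    (hk : h =ᵐ[μ] 0) (a b : ℝ) : U a = U b := by
  have := (hU.congr_ae hk).sub_eq a b
  simp only [Pi.zero_apply, intervalIntegral.integral_zero] at this
  exact (sub_eq_zero.1 this).symm

lemma IsPrimitive.comp_add {μ : Measure ℝ} {U h : ℝ → ℂ} {ω : ℝ}
    (hμ : MeasurePreserving (fun x => x + ω) μ μ) (hU : IsPrimitive μ U h) :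
    IsPrimitive μ (fun x => U (x + ω)) (fun x => h (x + ω)) := by
  have hemb := measurableEmbedding_addRight ω
  have hio : ∀ a b, IntegrableOn (fun x => h (x + ω)) (Set.Ioc a b) μ := by
    intro a b
    have e : (fun x => x + ω) ⁻¹' Set.Ioc (a + ω) (b + ω) = Set.Ioc a b := by
      simp
    rw [← e]
    exact (hμ.integrableOn_comp_preimage hemb).2 (hU.1.integrableOn_Ioc _ _)
  have hle : ∀ a b, a ≤ b → U (b + ω) - U (a + ω) = ∫ t in Set.Ioc a b, h (t + ω) ∂μ := by
    intro a b hab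
    have e : (fun x => x + ω) ⁻¹' Set.Ioc (a + ω) (b + ω) = Set.Ioc a b := by
      simp
    rw [← e, hμ.setIntegral_preimage_emb hemb, ← hU.sub_eq_Ioc (by linarith)]
  refine ⟨fun x => ⟨Set.Ioc (x - 1) (x + 1), Ioc_mem_nhds (by linarith) (by linarith), hio _ _⟩,
    fun a b => ?_⟩
  rcases le_total a b with hab | hab
  · rw [intervalIntegral.integral_of_le hab, ← hle a b hab]
  · rw [intervalIntegral.integral_of_ge hab, ← hle b a hab]
    ring

lemma measureReal_singleton_add {μ : Measure ℝ} {ω : ℝ}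
    (hμ : MeasurePreserving (fun x => x + ω) μ μ) (x : ℝ) : μ.real {x + ω} = μ.real {x} := by
  have h := hμ.measure_preimage_emb (measurableEmbedding_addRight ω) {x + ω}
  have e : (fun x => x + ω) ⁻¹' {x + ω} = {x} := by
    ext y; simp
  rw [e] at h
  rw [Measure.real, Measure.real, h]

lemma bal_add (μ : Measure ℝ) (U h V k : ℝ → Fin 2 → ℂ) :
    bal μ (U + V) (h + k) = bal μ U h + bal μ V k := by
  ext x j; simp [bal]; ring

lemma bal_smul (μ : Measure ℝ) (c : ℂ) (U h : ℝ → Fin 2 → ℂ) :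
    bal μ (c • U) (c • h) = c • bal μ U h := by
  ext x j; simp [bal]; ring

lemma bal_comp_add {μ : Measure ℝ} {ω : ℝ} (hμ : MeasurePreserving (fun x => x + ω) μ μ)
    (U h : ℝ → Fin 2 → ℂ) :
    bal μ (fun x => U (x + ω)) (fun x => h (x + ω)) = fun x => bal μ U h (x + ω) := by
  ext x j; simp [bal, measureReal_singleton_add hμ]

lemma bal_conj (μ : Measure ℝ) (U h : ℝ → Fin 2 → ℂ) :
    bal μ (star U) (star h) = star (bal μ U h) := by
  ext x j; simp [bal]

namespace IsSol

variable {μ : Measure ℝ} {J : Matrix (Fin 2) (Fin 2) ℂ}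
  {Q : ℝ → Matrix (Fin 2) (Fin 2) ℂ} {R S U h V k : ℝ → Fin 2 → ℂ}

lemma congr (hU : IsSol μ J Q R U h) (hRS : R =ᵐ[μ] S) : IsSol μ J Q S U h := by
  refine ⟨hU.prim, ?_⟩
  filter_upwards [hU.eqn, hRS] with x h1 h2
  rw [h1, h2]

lemma add (hU : IsSol μ J Q R U h) (hV : IsSol μ J Q S V k) :
    IsSol μ J Q (R + S) (U + V) (h + k) := by
  refine ⟨fun j => (hU.prim j).add (hV.prim j), ?_⟩
  filter_upwards [hU.eqn, hV.eqn] with x h1 h2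
  rw [bal_add, Pi.add_apply, Pi.add_apply, Pi.add_apply, Matrix.mulVec_add, Matrix.mulVec_add,
    h1, h2]
  abel

lemma smul (hU : IsSol μ J Q R U h) (c : ℂ) : IsSol μ J Q (c • R) (c • U) (c • h) := by
  refine ⟨fun j => (hU.prim j).const_mul c, ?_⟩
  filter_upwards [hU.eqn] with x h1
  rw [bal_smul, Pi.smul_apply, Pi.smul_apply, Pi.smul_apply, Matrix.mulVec_smul,
    Matrix.mulVec_smul, h1, smul_sub]

lemma sub (hU : IsSol μ J Q R U h) (hV : IsSol μ J Q S V k) :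
    IsSol μ J Q (R - S) (U - V) (h - k) := by
  have := hU.add (hV.smul (-1))
  simpa [sub_eq_add_neg] using this

lemma comp_add {ω : ℝ} (hμ : MeasurePreserving (fun x => x + ω) μ μ)
    (hQ : ∀ᵐ x ∂μ, Q (x + ω) = Q x) (hU : IsSol μ J Q R U h) :
    IsSol μ J Q (fun x => R (x + ω)) (fun x => U (x + ω)) (fun x => h (x + ω)) := by
  refine ⟨fun j => (hU.prim j).comp_add hμ, ?_⟩
  have h1 : ∀ᵐ x ∂μ, J *ᵥ h (x + ω) = R (x + ω) - Q (x + ω) *ᵥ bal μ U h (x + ω) :=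
    hμ.quasiMeasurePreserving.ae hU.eqn
  filter_upwards [h1, hQ] with x h1 h2
  rw [bal_comp_add hμ, h1, h2]

lemma star_mulVec_of_real {A : Matrix (Fin 2) (Fin 2) ℂ} (hA : ∀ i j, conj (A i j) = A i j)
    (x : Fin 2 → ℂ) : star (A *ᵥ x) = A *ᵥ star x := by
  ext i
  rw [Pi.star_apply, mulVec_fin_two, mulVec_fin_two]
  simp only [← starRingEnd_apply, map_add, map_mul, hA, Pi.star_apply]

protected lemma star (hJ : ∀ i j, conj (J i j) = J i j) (hQ : ∀ x i j, conj (Q x i j) = Q x i j)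
    (hU : IsSol μ J Q R U h) : IsSol μ J Q (star R) (star U) (star h) := by
  refine ⟨fun j => (hU.prim j).star, ?_⟩
  filter_upwards [hU.eqn] with x h1
  rw [bal_conj, Pi.star_apply, Pi.star_apply, Pi.star_apply, ← star_mulVec_of_real hJ,
    ← star_mulVec_of_real (hQ x), h1, star_sub]

/-- The density is determined only almost everywhere, but μ{x} h(x) is the jump of U at x and hence
is determined by U at every point. -/
lemma bal_eq (hU : IsSol μ J Q R U h) (hV : IsSol μ J Q S V k) (hUV : U = V) :
    bal μ U h = bal μ V k := by
  ext x j
  have h1 := (hU.prim j).tendsto_left x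
  have h2 := (hV.prim j).tendsto_left x
  subst hUV
  have h3 := tendsto_nhds_unique h1 h2
  simp only [bal]
  linear_combination h3 / 2

variable [IsLocallyFiniteMeasure μ]

/-- Lagrange's identity. -/
theorem lagrange (hS : IsRegularSystem μ J Q) (hU : IsSol μ J Q R U h) (hV : IsSol μ J Q S V k) :
    IsPrimitive μ (fun x => V x ⬝ᵥ (J *ᵥ U x))
      (fun x => bal μ V k x ⬝ᵥ R x - S x ⬝ᵥ bal μ U h x) := by
  obtain ⟨h0, h1, h2⟩ := hS.J_apply
  have e : (fun x => V x ⬝ᵥ (J *ᵥ U x)) =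
      fun x => J 1 0 * (V x 1 * U x 0) + (-J 1 0) * (V x 0 * U x 1) := by
    ext x
    simp only [dotProduct, Fin.sum_univ_two, mulVec_fin_two, h0, h1, h2]
    ring
  rw [e]
  refine ((((hV.prim 1).mul (hU.prim 0)).const_mul (J 1 0)).add
    (((hV.prim 0).mul (hU.prim 1)).const_mul (-J 1 0))).congr_ae ?_
  filter_upwards [hU.eqn, hV.eqn] with x e1 e2
  have a0 := congrFun e1 0
  have a1 := congrFun e1 1
  have b0 := congrFun e2 0
  have b1 := congrFun e2 1
  have hq := hS.Q_apply x
  simp only [mulVec_fin_two, Pi.sub_apply, h0, h1, h2, hq] at a0 a1 b0 b1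
  simp only [dotProduct, Fin.sum_univ_two, bal] at a0 a1 b0 b1 ⊢
  linear_combination (V x 0 - μ.real {x} / 2 * k x 0) * a0 +
    (V x 1 - μ.real {x} / 2 * k x 1) * a1 - (U x 0 - μ.real {x} / 2 * h x 0) * b0 -
    (U x 1 - μ.real {x} / 2 * h x 1) * b1

end IsSol

namespace IsRegularSystem

variable {μ : Measure ℝ} [IsLocallyFiniteMeasure μ] {J : Matrix (Fin 2) (Fin 2) ℂ}
  {Q : ℝ → Matrix (Fin 2) (Fin 2) ℂ} {R U h V k : ℝ → Fin 2 → ℂ}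

omit [IsLocallyFiniteMeasure μ] in
lemma eq_zero_of_pairing (S : IsRegularSystem μ J Q) {a b d : Fin 2 → ℂ} (hab : a ⬝ᵥ (J *ᵥ b) ≠ 0)
    (ha : a ⬝ᵥ (J *ᵥ d) = 0) (hb : b ⬝ᵥ (J *ᵥ d) = 0) : d = 0 := by
  obtain ⟨h0, h1, h2⟩ := S.J_apply
  simp only [dotProduct, Fin.sum_univ_two, mulVec_fin_two, h0, h1, h2] at hab ha hb
  have e0 : (a 0 * (0 * b 0 + -J 1 0 * b 1) + a 1 * (J 1 0 * b 0 + 0 * b 1)) * d 0 = 0 := by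
    linear_combination b 0 * ha - a 0 * hb
  have e1 : (a 0 * (0 * b 0 + -J 1 0 * b 1) + a 1 * (J 1 0 * b 0 + 0 * b 1)) * d 1 = 0 := by
    linear_combination b 1 * ha - a 1 * hb
  ext i
  fin_cases i
  · exact (mul_eq_zero.1 e0).resolve_left hab
  · exact (mul_eq_zero.1 e1).resolve_left hab

omit [IsLocallyFiniteMeasure μ] in
lemma pairing_self_eq_zero (S : IsRegularSystem μ J Q) (a : Fin 2 → ℂ) : a ⬝ᵥ (J *ᵥ a) = 0 := by
  obtain ⟨h0, h1, h2⟩ := S.J_apply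
  simp only [dotProduct, Fin.sum_univ_two, mulVec_fin_two, h0, h1, h2]
  ring

lemma wronskian_const (S : IsRegularSystem μ J Q) (hU : IsSol μ J Q 0 U h)
    (hV : IsSol μ J Q 0 V k) (a b : ℝ) : V a ⬝ᵥ (J *ᵥ U a) = V b ⬝ᵥ (J *ᵥ U b) :=
  (hU.lagrange S hV).eq_of_zero (ae_of_all _ fun x => by simp) a b

omit [IsLocallyFiniteMeasure μ] in
lemma basis_pairing (S : IsRegularSystem μ J Q) :
    (Pi.single 1 1 : Fin 2 → ℂ) ⬝ᵥ (J *ᵥ (Pi.single 0 1 : Fin 2 → ℂ)) ≠ 0 := by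
  simpa using S.ne_zero

/-- The J-pairings of the difference with two fundamental solutions are constant by Lagrange's
identity and vanish at x₀. The Wronskian of the fundamental solutions is a nonzero constant, so the
difference is zero at every point. -/
lemma eq_of_apply_eq (S : IsRegularSystem μ J Q) (hU : IsSol μ J Q R U h)
    (hV : IsSol μ J Q R V k) {x₀ : ℝ} (h0 : U x₀ = V x₀) : U = V := by
  obtain ⟨U₀, h₀, s₀, i₀⟩ := S.exists_isSol (R := 0) (fun j => locallyIntegrable_zero)
    (Pi.single 0 1)
  obtain ⟨U₁, h₁, s₁, i₁⟩ := S.exists_isSol (R := 0) (fun j => locallyIntegrable_zero)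
    (Pi.single 1 1)
  have hD := hU.sub hV
  rw [sub_self] at hD
  have key : ∀ x, U₁ x ⬝ᵥ (J *ᵥ U₀ x) ≠ 0 := fun x => by
    rw [S.wronskian_const s₀ s₁ x 0, i₀, i₁]
    exact S.basis_pairing
  ext1 x
  refine sub_eq_zero.1 (S.eq_zero_of_pairing (key x) ?_ ?_)
  · rw [← Pi.sub_apply, S.wronskian_const hD s₁ x x₀, Pi.sub_apply, h0, sub_self]
    simp
  · rw [← Pi.sub_apply, S.wronskian_const hD s₀ x x₀, Pi.sub_apply, h0, sub_self]
    simp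

/-! ### The solution space of the homogeneous equation. -/

lemma exists_hom (S : IsRegularSystem μ J Q) (c : Fin 2 → ℂ) :
    ∃ p : (ℝ → Fin 2 → ℂ) × (ℝ → Fin 2 → ℂ), IsSol μ J Q 0 p.1 p.2 ∧ p.1 0 = c := by
  obtain ⟨U, h, h1, h2⟩ := S.exists_isSol (R := 0) (fun j => locallyIntegrable_zero) c
  exact ⟨(U, h), h1, h2⟩

/-- The right-hand limits of the solution of the homogeneous equation with initial value `c`. -/
def homLim (S : IsRegularSystem μ J Q) (c : Fin 2 → ℂ) : ℝ → Fin 2 → ℂ :=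
  (S.exists_hom c).choose.1

/-- The density of the derivative of the solution with initial value `c`. -/
def homDensity (S : IsRegularSystem μ J Q) (c : Fin 2 → ℂ) : ℝ → Fin 2 → ℂ :=
  (S.exists_hom c).choose.2

lemma isSol_hom (S : IsRegularSystem μ J Q) (c : Fin 2 → ℂ) :
    IsSol μ J Q 0 (S.homLim c) (S.homDensity c) := (S.exists_hom c).choose_spec.1

lemma homLim_zero (S : IsRegularSystem μ J Q) (c : Fin 2 → ℂ) : S.homLim c 0 = c :=
  (S.exists_hom c).choose_spec.2

lemma eq_homLim (S : IsRegularSystem μ J Q) (hU : IsSol μ J Q 0 U h) : U = S.homLim (U 0) :=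
  S.eq_of_apply_eq hU (S.isSol_hom _) (S.homLim_zero _).symm

/-- The balanced solution of the homogeneous equation with initial value `c`. -/
def hom (S : IsRegularSystem μ J Q) : (Fin 2 → ℂ) →ₗ[ℂ] (ℝ → Fin 2 → ℂ) where
  toFun c := bal μ (S.homLim c) (S.homDensity c)
  map_add' c d := by
    have h1 := (S.isSol_hom c).add (S.isSol_hom d)
    rw [add_zero] at h1
    rw [← bal_add]
    refine ((S.isSol_hom _).bal_eq h1 ?_)
    exact S.eq_of_apply_eq (S.isSol_hom _) h1 (x₀ := 0) (by simp [homLim_zero])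
  map_smul' a c := by
    have h1 := (S.isSol_hom c).smul a
    rw [smul_zero] at h1
    rw [RingHom.id_apply, ← bal_smul]
    refine ((S.isSol_hom _).bal_eq h1 ?_)
    exact S.eq_of_apply_eq (S.isSol_hom _) h1 (x₀ := 0) (by simp [homLim_zero])

lemma hom_apply (S : IsRegularSystem μ J Q) (c : Fin 2 → ℂ) :
    S.hom c = bal μ (S.homLim c) (S.homDensity c) := rfl

lemma bal_eq_hom (S : IsRegularSystem μ J Q) (hU : IsSol μ J Q 0 U h) :
    bal μ U h = S.hom (U 0) := hU.bal_eq (S.isSol_hom _) (S.eq_homLim hU)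

lemma homLim_ne_zero (S : IsRegularSystem μ J Q) {c : Fin 2 → ℂ} (hc : c ≠ 0) (x : ℝ) :
    S.homLim c x ≠ 0 := by
  intro h0
  have h1 := S.isSol_hom c
  have h2 := (S.isSol_hom c).smul 0
  rw [smul_zero] at h2
  have h3 := S.eq_of_apply_eq h1 h2 (x₀ := x) (by simp [h0])
  apply hc
  rw [← S.homLim_zero c, h3]
  simp

lemma star_hom (S : IsRegularSystem μ J Q) (hJ : ∀ i j, conj (J i j) = J i j)
    (hQ : ∀ x i j, conj (Q x i j) = Q x i j) (c : Fin 2 → ℂ) :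
    star (S.hom c) = S.hom (star c) := by
  have h1 := (S.isSol_hom c).star hJ hQ
  rw [star_zero] at h1
  rw [hom_apply, ← bal_conj, S.bal_eq_hom h1, Pi.star_apply, S.homLim_zero]

lemma star_homLim (S : IsRegularSystem μ J Q) (hJ : ∀ i j, conj (J i j) = J i j)
    (hQ : ∀ x i j, conj (Q x i j) = Q x i j) (c : Fin 2 → ℂ) :
    star (S.homLim c) = S.homLim (star c) := by
  have h1 := (S.isSol_hom c).star hJ hQ
  rw [star_zero] at h1
  rw [S.eq_homLim h1, Pi.star_apply, S.homLim_zero]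

end IsRegularSystem
end DistributionalSystem

namespace DistributionalSystem

open scoped ENNReal

/-! ### Periodicity of the coefficients -/

lemma locallyIntegrable_toReal_rnDeriv {μ ν : Measure ℝ} [IsLocallyFiniteMeasure ν]
    (h : μ ≤ ν) : LocallyIntegrable (fun x => (μ.rnDeriv ν x).toReal) ν := by
  refine (locallyIntegrable_const (1 : ℝ)).mono
    (Measure.measurable_rnDeriv _ _).ennreal_toReal.aestronglyMeasurable ?_
  filter_upwards [Measure.rnDeriv_le_one_of_le h] with x hx
  rw [Real.norm_of_nonneg ENNReal.toReal_nonneg]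
  simpa using ENNReal.toReal_mono ENNReal.one_ne_top hx

lemma isLocallyFiniteMeasure_add (μ ν : Measure ℝ) [IsLocallyFiniteMeasure μ]
    [IsLocallyFiniteMeasure ν] : IsLocallyFiniteMeasure (μ + ν) := by
  have : IsFiniteMeasureOnCompacts (μ + ν) :=
    ⟨fun K hK => ENNReal.add_lt_top.2 ⟨hK.measure_lt_top, hK.measure_lt_top⟩⟩
  infer_instance

/-- Locally finite measures which agree on test functions coincide. -/
lemma measure_eq_of_integral_contDiff_eq {μ ν : Measure ℝ} [IsLocallyFiniteMeasure μ]
    [IsLocallyFiniteMeasure ν]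
    (h : ∀ φ : ℝ → ℝ, ContDiff ℝ ((⊤ : ℕ∞) : WithTop ℕ∞) φ → HasCompactSupport φ → ∫ x, φ x ∂μ = ∫ x, φ x ∂ν) :
    μ = ν := by
  have := isLocallyFiniteMeasure_add μ ν
  have hμ : μ ≤ μ + ν := Measure.le_add_right le_rfl
  have hν : ν ≤ μ + ν := Measure.le_add_left le_rfl
  have hμ' := Measure.absolutelyContinuous_of_le hμ
  have hν' := Measure.absolutelyContinuous_of_le hν
  -- Both measures have bounded densities with respect to their sum, so the fundamental lemma of the
  -- calculus of variations for functions applies.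
  have key := ae_eq_of_integral_contDiff_smul_eq (locallyIntegrable_toReal_rnDeriv hμ)
    (locallyIntegrable_toReal_rnDeriv hν) (fun φ hφ hφ' => by
      simp only [smul_eq_mul, mul_comm (φ _)]
      rw [integral_toReal_rnDeriv_mul hμ', integral_toReal_rnDeriv_mul hν']
      exact h φ hφ hφ')
  refine (Measure.withDensity_rnDeriv_eq μ (μ + ν) hμ').symm.trans
    (Eq.trans (withDensity_congr_ae ?_) (Measure.withDensity_rnDeriv_eq ν (μ + ν) hν'))
  filter_upwards [key, Measure.rnDeriv_lt_top μ (μ + ν), Measure.rnDeriv_lt_top ν (μ + ν)]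
    with x h1 h2 h3
  exact (ENNReal.toReal_eq_toReal_iff' h2.ne h3.ne).1 h1

/-- Uniqueness of the Jordan decomposition. -/
lemma jordan_unique {p n p' n' : Measure ℝ} (h : p + n' = p' + n) (hs : p.MutuallySingular n)
    (hs' : p'.MutuallySingular n') : p = p' := by
  -- Off a p-null set s the measure n vanishes, and there p ≤ p + n' = p'.
  have key : ∀ {p n p' n' : Measure ℝ}, p + n' = p' + n → p.MutuallySingular n → p ≤ p' := by
    intro p n p' n' h hs
    obtain ⟨s, hsm, h1, h2⟩ := hs
    refine Measure.le_iff.2 fun t ht => ?_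
    have e := congrArg (fun m : Measure ℝ => m (t \ s)) h
    simp only [Measure.add_apply] at e
    have hn : n (t \ s) = 0 := measure_mono_null (fun x hx => hx.2) h2
    have hp : p t ≤ p (t \ s) := by
      calc p t ≤ p (t \ s) + p s := (measure_mono (by simp)).trans (measure_union_le _ _)
        _ = p (t \ s) := by rw [h1, add_zero]
    calc p t ≤ p (t \ s) := hp
      _ ≤ p (t \ s) + n' (t \ s) := le_self_add
      _ = p' (t \ s) := by rw [e, hn, add_zero]
      _ ≤ p' t := measure_mono Set.sdiff_subset
  exact le_antisymm (key h hs) (key h.symm hs')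

lemma isLocallyFiniteMeasure_map_add (μ : Measure ℝ) [IsLocallyFiniteMeasure μ] (ω : ℝ) :
    IsLocallyFiniteMeasure (μ.map fun x => x + ω) := by
  have : IsFiniteMeasureOnCompacts (μ.map fun x => x + ω) := by
    constructor
    intro K hK
    rw [(measurableEmbedding_addRight ω).map_apply]
    exact ((Homeomorph.addRight ω).isCompact_preimage.2 hK).measure_lt_top
  infer_instance

/-- Test functions see only the difference of the two parts. Translating both parts gives another
mutually singular decomposition of the same distribution, so uniqueness of the Jordan decomposition
makes each part invariant separately. -/
lemma OrderZero.IsPeriod.measurePreserving {r : OrderZero} {ω : ℝ} (h : r.IsPeriod ω) :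
    MeasurePreserving (fun x => x + ω) r.pos r.pos ∧
      MeasurePreserving (fun x => x + ω) r.neg r.neg := by
  have hemb := measurableEmbedding_addRight ω
  have := isLocallyFiniteMeasure_map_add r.pos ω
  have := isLocallyFiniteMeasure_map_add r.neg ω
  have hs : (r.pos.map fun x => x + ω).MutuallySingular (r.neg.map fun x => x + ω) :=
    hemb.mutuallySingular_map r.mutuallySingular
  have := isLocallyFiniteMeasure_add r.pos (r.neg.map fun x => x + ω)
  have := isLocallyFiniteMeasure_add (r.pos.map fun x => x + ω) r.neg
  -- The equality of differences is rearranged into an equality of sums, since the parts may have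
  -- infinite total mass.
  have key : r.pos + r.neg.map (fun x => x + ω) = r.pos.map (fun x => x + ω) + r.neg := by
    refine measure_eq_of_integral_contDiff_eq fun φ hφ hφ' => ?_
    have hc : ContDiff ℝ ((⊤ : ℕ∞) : WithTop ℕ∞) fun x => (φ x : ℂ) := Complex.ofRealCLM.contDiff.comp hφ
    have hs : HasCompactSupport fun x => (φ x : ℂ) :=
      hφ'.comp_left (g := Complex.ofReal) Complex.ofReal_zero
    have e := h ⟨fun x => (φ x : ℂ), hc, hs, by simp⟩
    have hi : ∀ (μ : Measure ℝ) [IsLocallyFiniteMeasure μ], Integrable φ μ := fun μ _ =>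
      hφ.continuous.integrable_of_hasCompactSupport hφ'
    have e' : (∫ x, φ (x + ω) ∂r.pos) - ∫ x, φ (x + ω) ∂r.neg =
        (∫ x, φ x ∂r.pos) - ∫ x, φ x ∂r.neg := by
      have : ∀ f : ℝ → ℝ, r.integral (fun x => (f x : ℂ)) =
          (((∫ x, f x ∂r.pos) - ∫ x, f x ∂r.neg : ℝ) : ℂ) := fun f => by
        simp only [OrderZero.integral, integral_complex_ofReal, Complex.ofReal_sub]
      exact Complex.ofReal_injective (by rw [← this, ← this]; exact e)
    rw [integral_add_measure (hi _) (hi _), integral_add_measure (hi _) (hi _),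
      hemb.integral_map, hemb.integral_map]
    linarith
  have h1 := jordan_unique key r.mutuallySingular hs
  refine ⟨⟨hemb.measurable, h1.symm⟩, ⟨hemb.measurable, ?_⟩⟩
  refine jordan_unique (n := r.pos.map fun x => x + ω) (n' := r.pos) ?_ hs.symm
    r.mutuallySingular.symm
  rw [add_comm, key, add_comm]

lemma MeasurePreserving.sum_measure {ι : Type*} (s : Finset ι) {f : ℝ → ℝ} (m : ι → Measure ℝ)
    (hf : Measurable f) (h : ∀ i, MeasurePreserving f (m i) (m i)) :
    MeasurePreserving f (∑ i ∈ s, m i) (∑ i ∈ s, m i) := by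
  classical
  refine ⟨hf, ?_⟩
  induction s using Finset.induction_on with
  | empty => simp
  | insert a s ha ih => rw [Finset.sum_insert ha, Measure.map_add _ _ hf, ih, (h a).map_eq]

lemma rnDeriv_comp_add {μ ν : Measure ℝ} [IsLocallyFiniteMeasure μ] [IsLocallyFiniteMeasure ν]
    {ω : ℝ} (hμ : MeasurePreserving (fun x => x + ω) μ μ)
    (hν : MeasurePreserving (fun x => x + ω) ν ν) :
    ∀ᵐ x ∂ν, μ.rnDeriv ν (x + ω) = μ.rnDeriv ν x := by
  have := (measurableEmbedding_addRight ω).rnDeriv_map μ ν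
  rw [hμ.map_eq, hν.map_eq] at this
  exact this

/-! ### A scalar measure dominating the coefficients -/

variable (q w : Matrix (Fin 2) (Fin 2) OrderZero)

/-- A scalar measure with respect to which all coefficients have densities. -/
def baseMeasure : Measure ℝ := traceMeasure w + ∑ i, ∑ j, ((q i j).pos + (q i j).neg)

lemma traceMeasure_le : traceMeasure w ≤ baseMeasure q w := Measure.le_add_right le_rfl

lemma pos_add_neg_le (i j : Fin 2) : (q i j).pos + (q i j).neg ≤ baseMeasure q w :=
  Measure.le_add_left ((Finset.single_le_sum (f := fun j => (q i j).pos + (q i j).neg)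
    (fun _ _ => Measure.zero_le _) (Finset.mem_univ j)).trans
    (Finset.single_le_sum (f := fun i => ∑ j, ((q i j).pos + (q i j).neg))
    (fun _ _ => Measure.zero_le _) (Finset.mem_univ i)))

lemma pos_le (i j : Fin 2) : (q i j).pos ≤ baseMeasure q w :=
  (Measure.le_add_right le_rfl).trans (pos_add_neg_le q w i j)

lemma neg_le (i j : Fin 2) : (q i j).neg ≤ baseMeasure q w :=
  (Measure.le_add_left le_rfl).trans (pos_add_neg_le q w i j)

instance : IsLocallyFiniteMeasure (baseMeasure q w) := by
  have : IsFiniteMeasureOnCompacts (baseMeasure q w) := by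
    constructor
    intro K hK
    simp only [baseMeasure, Measure.coe_add, Pi.add_apply, Measure.coe_finsetSum, Finset.sum_apply]
    refine ENNReal.add_lt_top.2 ⟨hK.measure_lt_top, ?_⟩
    exact ENNReal.sum_lt_top.2 fun i _ => ENNReal.sum_lt_top.2 fun j _ =>
      ENNReal.add_lt_top.2 ⟨hK.measure_lt_top, hK.measure_lt_top⟩
  infer_instance

/-- The density of `q` with respect to the base measure. -/
def qDensity (x : ℝ) : Matrix (Fin 2) (Fin 2) ℂ :=
  Matrix.of fun i j => ((((q i j).pos.rnDeriv (baseMeasure q w) x).toReal -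
    ((q i j).neg.rnDeriv (baseMeasure q w) x).toReal : ℝ) : ℂ)

/-- The density of `tr w` with respect to the base measure. -/
def traceDensity (x : ℝ) : ℝ := ((traceMeasure w).rnDeriv (baseMeasure q w) x).toReal

/-- The density of `w f` with respect to the base measure. -/
def rhs (f : ℝ → Fin 2 → ℂ) (x : ℝ) : Fin 2 → ℂ :=
  (traceDensity q w x : ℂ) • (density w x *ᵥ f x)

/-- The density of `q - l w` with respect to the base measure. -/
def coeff (l : ℝ) (x : ℝ) : Matrix (Fin 2) (Fin 2) ℂ :=
  qDensity q w x - ((l * traceDensity q w x : ℝ) : ℂ) • density w x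

variable {q w}

lemma measurePreserving_traceMeasure {ω : ℝ} (hw : ∀ i j, (w i j).IsPeriod ω) :
    MeasurePreserving (fun x => x + ω) (traceMeasure w) (traceMeasure w) :=
  MeasurePreserving.sum_measure _ _ (by fun_prop) fun i => (hw i i).measurePreserving.1

lemma measurePreserving_baseMeasure {ω : ℝ} (hq : ∀ i j, (q i j).IsPeriod ω)
    (hw : ∀ i j, (w i j).IsPeriod ω) :
    MeasurePreserving (fun x => x + ω) (baseMeasure q w) (baseMeasure q w) := by
  have hf : Measurable fun x : ℝ => x + ω := by fun_prop
  refine ⟨hf, ?_⟩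
  rw [baseMeasure, Measure.map_add _ _ hf, (measurePreserving_traceMeasure hw).map_eq]
  congr 1
  refine (MeasurePreserving.sum_measure _ _ hf fun i =>
    MeasurePreserving.sum_measure _ _ hf fun j => ⟨hf, ?_⟩).map_eq
  rw [Measure.map_add _ _ hf, (hq i j).measurePreserving.1.map_eq,
    (hq i j).measurePreserving.2.map_eq]

lemma qDensity_comp_add {ω : ℝ} (hq : ∀ i j, (q i j).IsPeriod ω)
    (hw : ∀ i j, (w i j).IsPeriod ω) :
    ∀ᵐ x ∂baseMeasure q w, qDensity q w (x + ω) = qDensity q w x := by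
  have hb := measurePreserving_baseMeasure hq hw
  have h1 := fun i j => rnDeriv_comp_add (hq i j).measurePreserving.1 hb
  have h2 := fun i j => rnDeriv_comp_add (hq i j).measurePreserving.2 hb
  simp only [← ae_all_iff] at h1 h2
  filter_upwards [h1, h2] with x h1 h2
  ext i j
  simp only [qDensity, Matrix.of_apply, h1, h2]

lemma traceDensity_comp_add {ω : ℝ} (hq : ∀ i j, (q i j).IsPeriod ω)
    (hw : ∀ i j, (w i j).IsPeriod ω) :
    ∀ᵐ x ∂baseMeasure q w, traceDensity q w (x + ω) = traceDensity q w x := by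
  filter_upwards [rnDeriv_comp_add (measurePreserving_traceMeasure hw)
    (measurePreserving_baseMeasure hq hw)] with x hx
  rw [traceDensity, hx, traceDensity]

lemma density_comp_add {ω : ℝ} (hw : ∀ i j, (w i j).IsPeriod ω) :
    ∀ᵐ x ∂traceMeasure w, density w (x + ω) = density w x := by
  have hb := measurePreserving_traceMeasure hw
  have h1 := fun i j => rnDeriv_comp_add (hw i j).measurePreserving.1 hb
  have h2 := fun i j => rnDeriv_comp_add (hw i j).measurePreserving.2 hb
  simp only [← ae_all_iff] at h1 h2
  filter_upwards [h1, h2] with x h1 h2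
  have : rawDensity w (x + ω) = rawDensity w x := by
    ext i j
    simp only [rawDensity, Matrix.of_apply, h1, h2]
  rw [density, density, this]

/-- The matrix density of w is meaningful only up to tr w-null sets, which the base measure may
charge. On such a set the scalar density of tr w vanishes almost everywhere, so the product of both
densities is well defined for the base measure. -/
lemma ae_base_of_ae_trace {p : ℝ → Prop} (h : ∀ᵐ x ∂traceMeasure w, p x) :
    ∀ᵐ x ∂baseMeasure q w, traceDensity q w x = 0 ∨ p x := by
  have hle := Measure.absolutelyContinuous_of_le (traceMeasure_le q w)
  rw [← Measure.withDensity_rnDeriv_eq _ _ hle,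
    ae_withDensity_iff (Measure.measurable_rnDeriv _ _)] at h
  filter_upwards [h] with x hx
  by_cases h0 : (traceMeasure w).rnDeriv (baseMeasure q w) x = 0
  · left; simp [traceDensity, h0]
  · exact Or.inr (hx h0)

lemma smul_density_comp_add {ω : ℝ} (hq : ∀ i j, (q i j).IsPeriod ω)
    (hw : ∀ i j, (w i j).IsPeriod ω) :
    ∀ᵐ x ∂baseMeasure q w, (traceDensity q w (x + ω) : ℂ) • density w (x + ω) =
      (traceDensity q w x : ℂ) • density w x := by
  filter_upwards [traceDensity_comp_add hq hw, ae_base_of_ae_trace (density_comp_add hw)]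
    with x h1 h2
  rw [h1]
  rcases h2 with h2 | h2 <;> simp [h2]

lemma rhs_comp_add {ω : ℝ} (hq : ∀ i j, (q i j).IsPeriod ω)
    (hw : ∀ i j, (w i j).IsPeriod ω) (f : ℝ → Fin 2 → ℂ) :
    (fun x => rhs q w f (x + ω)) =ᵐ[baseMeasure q w] rhs q w fun x => f (x + ω) := by
  filter_upwards [smul_density_comp_add hq hw] with x hx
  rw [rhs, rhs, ← Matrix.smul_mulVec, hx, Matrix.smul_mulVec]

lemma coeff_comp_add {ω : ℝ} (hq : ∀ i j, (q i j).IsPeriod ω)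
    (hw : ∀ i j, (w i j).IsPeriod ω) (l : ℝ) :
    ∀ᵐ x ∂baseMeasure q w, coeff q w l (x + ω) = coeff q w l x := by
  filter_upwards [smul_density_comp_add hq hw, qDensity_comp_add hq hw] with x h1 h2
  simp only [coeff, h2, Complex.ofReal_mul, mul_smul, h1]

lemma rhs_congr {f g : ℝ → Fin 2 → ℂ}
    (h : ∀ᵐ x ∂traceMeasure w, density w x *ᵥ f x = density w x *ᵥ g x) :
    rhs q w f =ᵐ[baseMeasure q w] rhs q w g := by
  filter_upwards [ae_base_of_ae_trace h] with x hx
  rcases hx with hx | hx <;> simp [rhs, hx]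

/-! ### Jumps -/

lemma qDensity_jump (x : ℝ) (i j : Fin 2) :
    ((baseMeasure q w).real {x} : ℂ) * qDensity q w x i j = ((q i j).jump x : ℂ) := by
  have key : ∀ m : Measure ℝ, IsLocallyFiniteMeasure m → m ≤ baseMeasure q w →
      (m.rnDeriv (baseMeasure q w) x).toReal * (baseMeasure q w).real {x} = m.real {x} := by
    intro m _ hm
    have := Measure.setLIntegral_rnDeriv (Measure.absolutelyContinuous_of_le hm) {x}
    rw [lintegral_singleton] at this
    rw [Measure.real, Measure.real, ← this, ENNReal.toReal_mul]
  have h1 := key _ inferInstance (pos_le q w i j)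
  have h2 := key _ inferInstance (neg_le q w i j)
  rw [OrderZero.jump, ← h1, ← h2, qDensity, Matrix.of_apply]
  push_cast
  ring

lemma traceDensity_jump (x : ℝ) :
    traceDensity q w x * (baseMeasure q w).real {x} = (traceMeasure w).real {x} := by
  have := Measure.setLIntegral_rnDeriv
    (Measure.absolutelyContinuous_of_le (traceMeasure_le q w)) {x}
  rw [lintegral_singleton] at this
  rw [Measure.real, Measure.real, ← this, ENNReal.toReal_mul, traceDensity]

/-- The singular part of an entry with respect to tr w cannot charge an atom of tr w, so at such a
point absolute continuity is not needed. -/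
lemma rawDensity_jump {x : ℝ} (hx : traceMeasure w {x} ≠ 0) (i j : Fin 2) :
    ((traceMeasure w).real {x} : ℂ) * rawDensity w x i j = ((w i j).jump x : ℂ) := by
  have key : ∀ m : Measure ℝ, IsLocallyFiniteMeasure m →
      (m.rnDeriv (traceMeasure w) x).toReal * (traceMeasure w).real {x} = m.real {x} := by
    intro m _
    have h1 := Measure.haveLebesgueDecomposition_add m (traceMeasure w)
    obtain ⟨s, hs, h2, h3⟩ := Measure.mutuallySingular_singularPart m (traceMeasure w)
    have hxs : x ∈ s := by
      by_contra hxs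
      exact hx (measure_mono_null (by simpa using hxs) h3)
    have h4 : m.singularPart (traceMeasure w) {x} = 0 := measure_mono_null (by simpa using hxs) h2
    have h5 := congrArg (fun m : Measure ℝ => m {x}) h1
    simp only [Measure.add_apply, h4, zero_add] at h5
    rw [withDensity_apply _ (measurableSet_singleton x), lintegral_singleton] at h5
    rw [Measure.real, Measure.real, h5, ENNReal.toReal_mul]
  have h1 := key (w i j).pos inferInstance
  have h2 := key (w i j).neg inferInstance
  rw [OrderZero.jump, ← h1, ← h2, rawDensity, Matrix.of_apply]
  push_cast
  ring

/-- At an atom of `tr w` the matrix `tr w({x}) W̃(x)` is either the jump of `w` or zero. -/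
lemma density_jump (x : ℝ) :
    ∃ t : ℝ, (t = 1 ∨ t = 0) ∧ ∀ i j,
      ((traceMeasure w).real {x} : ℂ) * density w x i j = ((t * (w i j).jump x : ℝ) : ℂ) := by
  by_cases hx : traceMeasure w {x} = 0
  · exact ⟨0, Or.inr rfl, fun i j => by simp [Measure.real, hx]⟩
  · by_cases hp : (rawDensity w x).PosSemidef
    · refine ⟨1, Or.inl rfl, fun i j => ?_⟩
      rw [density, if_pos hp, rawDensity_jump hx, one_mul]
    · refine ⟨0, Or.inr rfl, fun i j => ?_⟩
      rw [density, if_neg hp]; simp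

/-! ### Bounds and symmetry -/

lemma conj_density (x : ℝ) (i j : Fin 2) : conj (density w x i j) = density w x i j := by
  unfold density
  split_ifs
  · simp [rawDensity]
  · simp

lemma density_transpose (x : ℝ) : (density w x)ᵀ = density w x := by
  ext i j
  have := congrFun (congrFun (density_posSemidef w x).isHermitian j) i
  rw [Matrix.transpose_apply, ← this, Matrix.conjTranspose_apply]
  rw [← starRingEnd_apply, conj_density]

/-- The diagonal entries are at most 1 because each diagonal measure is dominated by the trace; the
off-diagonal entry is then controlled by the nonnegative determinant. -/
lemma norm_density_le : ∀ᵐ x ∂traceMeasure w, ∀ i j, ‖density w x i j‖ ≤ 1 := by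
  filter_upwards [density_diag_le_one w 0, density_diag_le_one w 1] with x h0 h1
  have hd := (density_posSemidef w x).det_nonneg
  have hsym : density w x 1 0 = density w x 0 1 := congrFun (congrFun (density_transpose x) 0) 1
  have hreal : ∀ i j, density w x i j = ((density w x i j).re : ℂ) := fun i j =>
    (Complex.conj_eq_iff_re.1 (conj_density x i j)).symm
  have hoff : ‖density w x 0 1‖ ≤ 1 := by
    rw [Matrix.det_fin_two, hsym] at hd
    rw [hreal 0 0, Complex.norm_real, Real.norm_eq_abs] at h0
    rw [hreal 1 1, Complex.norm_real, Real.norm_eq_abs] at h1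
    rw [hreal 0 1, Complex.norm_real, Real.norm_eq_abs]
    rw [hreal 0 0, hreal 0 1, hreal 1 1] at hd
    have hd' : 0 ≤ (density w x 0 0).re * (density w x 1 1).re -
        (density w x 0 1).re * (density w x 0 1).re := by exact_mod_cast hd
    have h2 : (density w x 0 0).re * (density w x 1 1).re ≤ 1 := by
      refine (le_abs_self _).trans ?_
      rw [abs_mul]
      exact mul_le_one₀ h0 (abs_nonneg _) h1
    exact (sq_le_one_iff_abs_le_one _).1 (by nlinarith)
  intro i j
  fin_cases i <;> fin_cases j
  · exact h0
  · exact hoff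
  · simpa [hsym] using hoff
  · exact h1

lemma measurable_qDensity (i j : Fin 2) : Measurable fun x => qDensity q w x i j := by
  simp only [qDensity, Matrix.of_apply]
  exact Complex.measurable_ofReal.comp ((Measure.measurable_rnDeriv _ _).ennreal_toReal.sub
    (Measure.measurable_rnDeriv _ _).ennreal_toReal)

lemma measurable_traceDensity : Measurable (traceDensity q w) :=
  (Measure.measurable_rnDeriv _ _).ennreal_toReal

lemma traceDensity_nonneg (x : ℝ) : 0 ≤ traceDensity q w x := ENNReal.toReal_nonneg

lemma toReal_rnDeriv_le_one {m μ : Measure ℝ} [SigmaFinite μ] (h : m ≤ μ) :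
    ∀ᵐ x ∂μ, (m.rnDeriv μ x).toReal ≤ 1 := by
  filter_upwards [Measure.rnDeriv_le_one_of_le h] with x hx
  simpa using ENNReal.toReal_mono ENNReal.one_ne_top hx

lemma norm_qDensity_le : ∀ᵐ x ∂baseMeasure q w, ∀ i j, ‖qDensity q w x i j‖ ≤ 1 := by
  have h1 := fun i j => toReal_rnDeriv_le_one (pos_le q w i j)
  have h2 := fun i j => toReal_rnDeriv_le_one (neg_le q w i j)
  simp only [← ae_all_iff] at h1 h2
  filter_upwards [h1, h2] with x h1 h2 i j
  rw [qDensity, Matrix.of_apply, Complex.norm_real, Real.norm_eq_abs, abs_le]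
  have := h1 i j
  have := h2 i j
  have : 0 ≤ ((q i j).pos.rnDeriv (baseMeasure q w) x).toReal := ENNReal.toReal_nonneg
  have : 0 ≤ ((q i j).neg.rnDeriv (baseMeasure q w) x).toReal := ENNReal.toReal_nonneg
  constructor <;> linarith

lemma conj_qDensity (x : ℝ) (i j : Fin 2) : conj (qDensity q w x i j) = qDensity q w x i j := by
  simp [qDensity]

lemma conj_coeff (l x : ℝ) (i j : Fin 2) : conj (coeff q w l x i j) = coeff q w l x i j := by
  simp only [coeff, Matrix.sub_apply, Matrix.smul_apply, smul_eq_mul, map_sub, map_mul,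
    conj_qDensity, conj_density, Complex.conj_ofReal]

lemma norm_coeff_le (l : ℝ) : ∀ᵐ x ∂baseMeasure q w, ∀ i j, ‖coeff q w l x i j‖ ≤ 1 + |l| := by
  filter_upwards [norm_qDensity_le, ae_base_of_ae_trace norm_density_le,
    toReal_rnDeriv_le_one (traceMeasure_le q w)] with x h1 h2 h3 i j
  simp only [coeff, Matrix.sub_apply, Matrix.smul_apply, smul_eq_mul]
  refine (norm_sub_le _ _).trans (add_le_add (h1 i j) ?_)
  rw [norm_mul, Complex.norm_real, norm_mul, Real.norm_eq_abs,
    Real.norm_of_nonneg (traceDensity_nonneg x), mul_assoc]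
  refine mul_le_of_le_one_right (abs_nonneg l) ?_
  rcases h2 with h2 | h2
  · simp [h2]
  · exact mul_le_one₀ h3 (norm_nonneg _) (h2 i j)

end DistributionalSystem

namespace DistributionalSystem

open scoped ENNReal

/-! ### Test functions and balanced solutions -/

lemma exists_support_subset {φ : ℝ → ℂ} (hφ : HasCompactSupport φ) :
    ∃ a b : ℝ, a ≤ b ∧ ∀ x, x ∉ Set.Ioo a b → φ x = 0 ∧ deriv φ x = 0 := by
  obtain ⟨r, hr⟩ := hφ.isBounded.subset_closedBall 0
  refine ⟨-(|r| + 1), |r| + 1, by linarith [abs_nonneg r], fun x hx => ?_⟩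
  have hx' : x ∉ tsupport φ := by
    intro h
    have h1 := hr h
    rw [Metric.mem_closedBall, Real.dist_eq, sub_zero] at h1
    have h2 := h1.trans (le_abs_self r)
    exact hx ⟨by linarith [(abs_le.1 h2).1], by linarith [(abs_le.1 h2).2]⟩
  exact ⟨image_eq_zero_of_notMem_tsupport hx', by
    by_contra h0
    exact hx' (support_deriv_subset (Function.mem_support.2 h0))⟩

lemma countable_atoms (μ : Measure ℝ) [SFinite μ] : {x | μ.real {x} ≠ 0}.Countable := by
  refine (Measure.countable_meas_pos_of_disjoint_iUnion (μ := μ) (As := fun x : ℝ => ({x} : Set ℝ))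
    (fun x => measurableSet_singleton x) (fun x y hxy => by simpa using hxy)).mono fun x hx => ?_
  simp only [Set.mem_ofPred_eq] at hx ⊢
  by_contra h0
  exact hx (by simp [Measure.real, nonpos_iff_eq_zero.1 (not_lt.1 h0)])

lemma ae_volume_measureReal_singleton (μ : Measure ℝ) [SFinite μ] :
    ∀ᵐ x, μ.real {x} = 0 := by
  have := (countable_atoms μ).ae_notMem volume
  filter_upwards [this] with x hx
  by_contra h0
  exact hx h0

/-- A primitive of `h μ` has distributional derivative `h μ`. -/
lemma IsPrimitive.integral_deriv_mul {μ : Measure ℝ} [IsLocallyFiniteMeasure μ] {U h : ℝ → ℂ}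
    (hU : IsPrimitive μ U h) {φ : ℝ → ℂ} (hφ : ContDiff ℝ 1 φ) (hφ' : HasCompactSupport φ) :
    ∫ x, deriv φ x * U x = -∫ x, φ x * h x ∂μ := by
  obtain ⟨a, b, hab, hs⟩ := exists_support_subset hφ'
  have hcd : Continuous (deriv φ) := hφ.continuous_deriv le_rfl
  have hV : IsPrimitive volume φ (deriv φ) :=
    ⟨hcd.locallyIntegrable, fun a b =>
      (intervalIntegral.integral_deriv_eq_sub (fun x _ => (hφ.differentiable (by simp)) x)
        (hcd.intervalIntegrable a b)).symm⟩
  obtain ⟨-, -, h3⟩ := hU.mul_sub_mul hV hab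
  rw [(hs b (by simp)).1, (hs a (by simp)).1] at h3
  have e1 : ∫ t in Set.Ioc a b, (U t - μ.real {t} * h t) * deriv φ t =
      ∫ t, deriv φ t * U t := by
    rw [setIntegral_eq_integral_of_forall_compl_eq_zero]
    · refine integral_congr_ae ?_
      filter_upwards [ae_volume_measureReal_singleton μ] with x hx
      rw [hx]; simp [mul_comm]
    · intro x hx
      rw [(hs x (fun h => hx (Set.Ioo_subset_Ioc_self h))).2, mul_zero]
  have e2 : ∫ t in Set.Ioc a b, h t * φ t ∂μ = ∫ t, φ t * h t ∂μ := by
    rw [setIntegral_eq_integral_of_forall_compl_eq_zero]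
    · simp only [mul_comm]
    · intro x hx
      rw [(hs x (fun h => hx (Set.Ioo_subset_Ioc_self h))).1, mul_zero]
  rw [e1, e2] at h3
  linear_combination -h3

/-- The lemma of du Bois-Reymond. -/
lemma exists_ae_eq_const_of_integral_deriv_mul_eq_zero {d : ℝ → ℂ} (hd : LocallyIntegrable d volume)
    (h : ∀ φ : ℝ → ℂ, ContDiff ℝ ((⊤ : ℕ∞) : WithTop ℕ∞) φ → HasCompactSupport φ →
      ∫ x, deriv φ x * d x = 0) : ∃ C : ℂ, ∀ᵐ x, d x = C := by
  let bump : ContDiffBump (0 : ℝ) := ⟨1, 2, by norm_num, by norm_num⟩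
  set η : ℝ → ℝ := bump.normed volume with hη
  have hηc : ContDiff ℝ ((⊤ : ℕ∞) : WithTop ℕ∞) η := bump.contDiff_normed
  have hηs : HasCompactSupport η := bump.hasCompactSupport_normed
  have hη1 : ∫ x, η x = 1 := bump.integral_normed
  refine ⟨∫ x, η x • d x, ?_⟩
  refine ae_eq_of_integral_contDiff_smul_eq hd (locallyIntegrable_const _) fun ψ hψ hψs => ?_
  -- Subtracting the multiple of the bump with the same integral leaves a function of mean zero,
  -- whose antiderivative is compactly supported and thus a legitimate test function.
  set θ : ℝ → ℝ := fun x => ψ x - (∫ y, ψ y) * η x with hθ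
  have hθc : ContDiff ℝ ((⊤ : ℕ∞) : WithTop ℕ∞) θ := hψ.sub (contDiff_const.mul hηc)
  have hθs : HasCompactSupport θ := hψs.sub (hηs.mul_left (f := fun _ => ∫ y, ψ y))
  have hψi : Integrable ψ := hψ.continuous.integrable_of_hasCompactSupport hψs
  have hηi : Integrable η := hηc.continuous.integrable_of_hasCompactSupport hηs
  have hθi : Integrable θ := hψi.sub (hηi.const_mul _)
  have hθ0 : ∫ x, θ x = 0 := by
    rw [integral_sub hψi (hηi.const_mul _), integral_const_mul, hη1]; ring
  obtain ⟨r, hr⟩ := hθs.isBounded.subset_closedBall 0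
  have hz : ∀ x, r < |x| → θ x = 0 := by
    intro x hx
    refine image_eq_zero_of_notMem_tsupport fun hm => ?_
    have := hr hm
    rw [Metric.mem_closedBall, Real.dist_eq, sub_zero] at this
    linarith
  set a := -(|r| + 1) with ha
  set Φ : ℝ → ℝ := fun x => ∫ t in a..x, θ t with hΦ
  have hΦd : ∀ x, HasDerivAt Φ (θ x) x := fun x =>
    intervalIntegral.integral_hasDerivAt_right (hθc.continuous.intervalIntegrable _ _)
      (hθc.continuous.stronglyMeasurableAtFilter _ _) hθc.continuous.continuousAt
  have hΦ' : deriv Φ = θ := funext fun x => (hΦd x).deriv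
  have hΦc : ContDiff ℝ ((⊤ : ℕ∞) : WithTop ℕ∞) Φ :=
    contDiff_infty_iff_deriv.2 ⟨fun x => (hΦd x).differentiableAt, by rw [hΦ']; exact hθc⟩
  have hΦs : HasCompactSupport Φ := by
    refine HasCompactSupport.of_support_subset_isCompact (isCompact_Icc (a := a) (b := |r| + 1))
      fun x hx => ?_
    by_contra hx'
    apply hx
    rw [Set.mem_Icc, not_and_or, not_le, not_le] at hx'
    rcases hx' with hx' | hx'
    · simp only [hΦ]
      rw [intervalIntegral.integral_congr (g := fun _ => 0), intervalIntegral.integral_zero]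
      intro t ht
      rw [Set.uIcc_of_ge hx'.le] at ht
      refine hz t ?_
      have := neg_le_abs t
      have := le_abs_self r
      linarith [ht.2]
    · simp only [hΦ]
      rw [intervalIntegral.integral_of_le (by linarith [abs_nonneg r]),
        setIntegral_eq_integral_of_forall_compl_eq_zero, hθ0]
      intro t ht
      refine hz t ?_
      have := le_abs_self r
      rw [Set.mem_Ioc, not_and_or, not_lt, not_le] at ht
      rcases ht with ht | ht
      · linarith [neg_le_abs t]
      · linarith [le_abs_self t]
  have key := h (fun x => (Φ x : ℂ)) (Complex.ofRealCLM.contDiff.comp hΦc)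
    (hΦs.comp_left (g := Complex.ofReal) Complex.ofReal_zero)
  have hder : ∀ x, deriv (fun x => (Φ x : ℂ)) x = (θ x : ℂ) := fun x =>
    (hΦd x).ofReal_comp.deriv
  have i1 : Integrable (fun x => ψ x • d x) :=
    hd.integrable_smul_left_of_hasCompactSupport hψ.continuous hψs
  have i2 : Integrable (fun x => η x • d x) :=
    hd.integrable_smul_left_of_hasCompactSupport hηc.continuous hηs
  simp only [hder] at key
  have e : (fun x => (θ x : ℂ) * d x) = fun x => ψ x • d x - (∫ y, ψ y) • (η x • d x) := by
    ext x
    simp only [hθ, Complex.real_smul]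
    push_cast
    ring
  have i3 : Integrable (fun x => (∫ y, ψ y) • (η x • d x)) := Integrable.smul (∫ y, ψ y) i2
  rw [e, integral_sub i1 i3, integral_smul, sub_eq_zero] at key
  rw [key, integral_smul_const]

/-- The hypothesis forces g to be monotone, and its increments majorize those of u over every
partition. -/
lemma locallyBoundedVariationOn_of_dist_le {E : Type*} [PseudoMetricSpace E] {u : ℝ → E}
    {g : ℝ → ℝ} (h : ∀ x y, x ≤ y → dist (u x) (u y) ≤ g y - g x) :
    LocallyBoundedVariationOn u Set.univ := by
  have hg : Monotone g := fun x y hxy => by linarith [h x y hxy, dist_nonneg (x := u x) (y := u y)]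
  intro a b ha hb
  refine ne_top_of_le_ne_top ((hg.monotoneOn Set.univ).locallyBoundedVariationOn a b ha hb)
    (iSup_le fun p => ?_)
  refine le_trans (Finset.sum_le_sum fun i _ => ?_)
    (eVariationOn.sum_le (f := g) p.2.2.1 (fun _ => p.2.2.2 _))
  have hi := p.2.2.1 (Nat.le_succ i)
  rw [edist_dist, edist_dist, dist_comm, Real.dist_eq]
  refine ENNReal.ofReal_le_ofReal ((h _ _ hi).trans (le_abs_self _))

/-- The balanced representative of a primitive is balanced and of locally bounded variation. -/
lemma bv_bal {μ : Measure ℝ} {U h : ℝ → Fin 2 → ℂ}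
    (hU : ∀ j, IsPrimitive μ (fun x => U x j) (fun x => h x j)) :
    LocallyBoundedVariationOn (bal μ U h) Set.univ := by
  set n : ℝ → ℝ := fun x => ‖h x 0‖ + ‖h x 1‖ with hn
  have hni : LocallyIntegrable n μ := by
    intro x
    obtain ⟨s, hs, h1⟩ := (hU 0).1 x
    obtain ⟨t, ht, h2⟩ := (hU 1).1 x
    exact ⟨s ∩ t, inter_mem hs ht, (h1.mono_set Set.inter_subset_left).norm.add
      (h2.mono_set Set.inter_subset_right).norm⟩
  have hjn : ∀ j x, ‖h x j‖ ≤ n x := by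
    intro j x
    fin_cases j
    · exact le_add_of_nonneg_right (norm_nonneg _)
    · exact le_add_of_nonneg_left (norm_nonneg _)
  -- The majorant is itself a balanced representative, of the primitive of |h₀| + |h₁|; half atoms
  -- at the endpoints then match on both sides of the estimate.
  refine locallyBoundedVariationOn_of_dist_le
    (g := fun x => (∫ t in (0 : ℝ)..x, n t ∂μ) - μ.real {x} / 2 * n x) fun x y hxy => ?_
  rcases hxy.eq_or_lt with rfl | hxy
  · simp
  have hio : IntegrableOn n (Set.Ioc x y) μ := hni.integrableOn_Ioc x y
  have e1 : (∫ t in (0 : ℝ)..y, n t ∂μ) - ∫ t in (0 : ℝ)..x, n t ∂μ =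
      (∫ t in Set.Ioo x y, n t ∂μ) + μ.real {y} * n y := by
    rw [intervalIntegral.integral_interval_sub_left (hni.intervalIntegrable' _ _)
      (hni.intervalIntegrable' _ _), intervalIntegral.integral_of_le hxy.le,
      ← Set.Ioo_union_right hxy, setIntegral_union (by simp) (measurableSet_singleton y)
      (hio.mono_set Set.Ioo_subset_Ioc_self) (hio.mono_set (by simpa using hxy)),
      integral_singleton, smul_eq_mul]
  have hnn : 0 ≤ (∫ t in Set.Ioo x y, n t ∂μ) + μ.real {y} / 2 * n y + μ.real {x} / 2 * n x := by
    have h0 : ∀ x, 0 ≤ n x := fun x => add_nonneg (norm_nonneg _) (norm_nonneg _)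
    have := integral_nonneg (μ := μ.restrict (Set.Ioo x y)) (f := n) h0
    have := h0 x
    have := h0 y
    have : 0 ≤ μ.real {x} := measureReal_nonneg
    have : 0 ≤ μ.real {y} := measureReal_nonneg
    positivity
  have e2 : (∫ t in (0 : ℝ)..y, n t ∂μ) - μ.real {y} / 2 * n y -
      ((∫ t in (0 : ℝ)..x, n t ∂μ) - μ.real {x} / 2 * n x) =
      (∫ t in Set.Ioo x y, n t ∂μ) + μ.real {y} / 2 * n y + μ.real {x} / 2 * n x := by
    linear_combination e1
  rw [e2, dist_comm, dist_pi_le_iff hnn]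
  intro j
  have e3 : bal μ U h y j - bal μ U h x j = (∫ t in Set.Ioo x y, h t j ∂μ) +
      μ.real {y} / 2 * h y j + μ.real {x} / 2 * h x j := by
    rw [← (hU j).sub_eq_Ioo hxy]
    simp only [bal]
    ring
  have hm : ∀ z, ‖(μ.real {z} / 2 : ℂ) * h z j‖ ≤ μ.real {z} / 2 * n z := by
    intro z
    have h0 : 0 ≤ μ.real {z} := measureReal_nonneg
    rw [norm_mul, norm_div, Complex.norm_real, Real.norm_of_nonneg h0]
    simp only [Complex.norm_ofNat]
    exact mul_le_mul_of_nonneg_left (hjn j z) (by positivity)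
  rw [dist_eq_norm, e3]
  refine (norm_add_le _ _).trans (add_le_add ((norm_add_le _ _).trans (add_le_add ?_ (hm y))) (hm x))
  refine (norm_integral_le_integral_norm _).trans ?_
  refine integral_mono_ae ?_ (hio.mono_set Set.Ioo_subset_Ioc_self) (ae_of_all _ fun t => hjn j t)
  exact (((hU j).1.integrableOn_Ioc x y).mono_set Set.Ioo_subset_Ioc_self).norm

/-- The value V(y) is a limit of values of U near y, and near a point y of the open set s those
values come from s; closed neighbourhoods of L therefore capture V as well. -/
lemma tendsto_of_forall_tendsto_left {U V : ℝ → ℂ} {s : Set ℝ} (hs : IsOpen s) {x : ℝ} {L : ℂ}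
    (hU : Tendsto U (𝓝[s] x) (𝓝 L)) (hV : ∀ y, Tendsto U (𝓝[<] y) (𝓝 (V y))) :
    Tendsto V (𝓝[s] x) (𝓝 L) := by
  refine (closed_nhds_basis L).tendsto_right_iff.2 fun C hC => ?_
  have h1 : ∀ᶠ y in 𝓝[s] x, U y ∈ C := hU hC.1
  filter_upwards [eventually_eventually_nhdsWithin.2 h1, self_mem_nhdsWithin] with y hy hys
  rw [hs.nhdsWithin_eq hys] at hy
  exact hC.2.mem_of_tendsto (hV y) (nhdsWithin_le_nhds hy)

/-! ### One-sided limits of balanced representatives. -/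

section Limits

variable {μ : Measure ℝ} {U h : ℝ → Fin 2 → ℂ}

lemma tendsto_bal (hU : ∀ j, IsPrimitive μ (fun x => U x j) (fun x => h x j)) {s : Set ℝ}
    (hs : IsOpen s) {x : ℝ} {L : Fin 2 → ℂ} (hL : Tendsto U (𝓝[s] x) (𝓝 L)) :
    Tendsto (bal μ U h) (𝓝[s] x) (𝓝 L) := by
  refine tendsto_pi_nhds.2 fun j => ?_
  have h1 := tendsto_pi_nhds.1 hL j
  have h2 := tendsto_of_forall_tendsto_left hs h1 fun y => (hU j).tendsto_left y
  have h3 := (h1.add h2).div_const 2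
  rw [add_self_div_two] at h3
  refine h3.congr fun y => ?_
  simp only [bal]
  ring

lemma tendsto_bal_right (hU : ∀ j, IsPrimitive μ (fun x => U x j) (fun x => h x j)) (x : ℝ) :
    Tendsto (bal μ U h) (𝓝[>] x) (𝓝 (U x)) :=
  tendsto_bal hU isOpen_Ioi (tendsto_pi_nhds.2 fun j => (hU j).tendsto_right x)

lemma tendsto_bal_left (hU : ∀ j, IsPrimitive μ (fun x => U x j) (fun x => h x j)) (x : ℝ) :
    Tendsto (bal μ U h) (𝓝[<] x) (𝓝 fun j => U x j - μ.real {x} * h x j) :=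
  tendsto_bal hU isOpen_Iio (tendsto_pi_nhds.2 fun j => (hU j).tendsto_left x)

lemma isBalanced_bal (hU : ∀ j, IsPrimitive μ (fun x => U x j) (fun x => h x j)) :
    IsBalanced (bal μ U h) := by
  refine fun x => ⟨_, _, tendsto_bal_left hU x, tendsto_bal_right hU x, ?_⟩
  ext j
  simp only [bal, Pi.smul_apply, Pi.add_apply, smul_eq_mul]
  ring

end Limits

end DistributionalSystem

namespace DistributionalSystem

open scoped ENNReal

/-! ### Solutions in the sense of distributions -/

variable {J : Matrix (Fin 2) (Fin 2) ℝ} {q w : Matrix (Fin 2) (Fin 2) OrderZero}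

/-- The complexification of a real matrix. -/
def toComplex (J : Matrix (Fin 2) (Fin 2) ℝ) : Matrix (Fin 2) (Fin 2) ℂ := J.map Complex.ofReal

lemma toComplex_apply (J : Matrix (Fin 2) (Fin 2) ℝ) (i j : Fin 2) : toComplex J i j = J i j := rfl

lemma conj_toComplex (J : Matrix (Fin 2) (Fin 2) ℝ) (i j : Fin 2) :
    conj (toComplex J i j) = toComplex J i j := by simp [toComplex_apply]

lemma det_toComplex (J : Matrix (Fin 2) (Fin 2) ℝ) : (toComplex J).det = (J.det : ℂ) :=
  (Complex.ofRealHom.map_det J).symm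

/-- The hypotheses on the coefficients which make all real spectral parameters admissible. -/
structure Admissible (J : Matrix (Fin 2) (Fin 2) ℝ) (q w : Matrix (Fin 2) (Fin 2) OrderZero) :
    Prop where
  skew : Jᵀ = -J
  isUnit : IsUnit J
  symm : q.IsSymm
  isUnit_add : ∀ x l : ℝ, IsUnit (J + (1 / 2 : ℝ) • (jumpMatrix q x - l • jumpMatrix w x))

/-- The factor t accounts for points where the density of w is set to zero or tr w has no atom:
there the spectral term drops out, which is the parameter 0. Since invertibility is assumed for
every real parameter, l t is admissible in either case. -/
lemma toComplex_add_coeff_jump (J : Matrix (Fin 2) (Fin 2) ℝ)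
    (q w : Matrix (Fin 2) (Fin 2) OrderZero) (x : ℝ) : ∃ t : ℝ, (t = 1 ∨ t = 0) ∧
    (∀ i j, ((traceMeasure w).real {x} : ℂ) * density w x i j =
      ((t * (w i j).jump x : ℝ) : ℂ)) ∧ ∀ l : ℝ,
    toComplex J + ((baseMeasure q w).real {x} / 2 : ℂ) • coeff q w l x =
      toComplex (J + (1 / 2 : ℝ) • (jumpMatrix q x - (l * t) • jumpMatrix w x)) := by
  obtain ⟨t, ht, h⟩ := density_jump (w := w) x
  refine ⟨t, ht, h, fun l => ?_⟩
  ext i j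
  have h1 := qDensity_jump (q := q) (w := w) x i j
  have h2 := h i j
  rw [← traceDensity_jump (q := q)] at h2
  simp only [Matrix.add_apply, Matrix.smul_apply, smul_eq_mul, coeff, Matrix.sub_apply,
    toComplex_apply, jumpMatrix, Matrix.of_apply]
  push_cast at h2 ⊢
  linear_combination (1 / 2 : ℂ) * h1 - l / 2 * h2

namespace Admissible

lemma isRegularSystem (H : Admissible J q w) (l : ℝ) :
    IsRegularSystem (baseMeasure q w) (toComplex J) (coeff q w l) := by
  have hsk : ∀ i j, J j i = -J i j := fun i j => congrFun (congrFun H.skew i) j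
  refine ⟨?_, ?_, ?_, ?_, ⟨_, norm_coeff_le l⟩, ?_⟩
  · ext i j
    simp [toComplex_apply, hsk i j]
  · have h := isUnit_iff_ne_zero.1 ((Matrix.isUnit_iff_isUnit_det _).1 H.isUnit)
    intro h0
    rw [toComplex_apply, Complex.ofReal_eq_zero] at h0
    apply h
    have := hsk 0 0
    have h00 : J 0 0 = 0 := by linarith
    rw [Matrix.det_fin_two, h0, h00]
    ring
  · intro x
    ext i j
    have h1 : qDensity q w x j i = qDensity q w x i j := by
      have : q j i = q i j := congrFun (congrFun H.symm i) j
      simp only [qDensity, Matrix.of_apply, this]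
    have h2 : density w x j i = density w x i j := congrFun (congrFun (density_transpose x) i) j
    simp only [coeff, Matrix.transpose_apply, Matrix.sub_apply, Matrix.smul_apply, h1, h2]
  · intro i j
    simp only [coeff, Matrix.sub_apply, Matrix.smul_apply, smul_eq_mul]
    exact (measurable_qDensity i j).sub ((Complex.measurable_ofReal.comp
      (measurable_const.mul measurable_traceDensity)).mul (measurable_density w i j))
  · intro x
    obtain ⟨t, -, -, h⟩ := toComplex_add_coeff_jump J q w x
    rw [h l, det_toComplex]
    have := H.isUnit_add x (l * t)
    exact_mod_cast isUnit_iff_ne_zero.1 ((Matrix.isUnit_iff_isUnit_det _).1 this)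

end Admissible

/-! ### Distributional solutions are solutions of the integral equation -/

lemma coeff_zero (x : ℝ) : coeff q w 0 x = qDensity q w x := by simp [coeff]

lemma integrable_mul_rhs {f : ℝ → Fin 2 → ℂ} {g : ℝ → ℂ} {i : Fin 2}
    (h : Integrable (fun x => g x * (density w x *ᵥ f x) i) (traceMeasure w)) :
    Integrable (fun x => g x * rhs q w f x i) (baseMeasure q w) := by
  have := (integrable_rnDeriv_smul_iff
    (Measure.absolutelyContinuous_of_le (traceMeasure_le q w))).2 h
  refine this.congr (ae_of_all _ fun x => ?_)
  simp only [rhs, Pi.smul_apply, smul_eq_mul, traceDensity, Complex.real_smul]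
  ring

lemma integral_mul_rhs (f : ℝ → Fin 2 → ℂ) (g : ℝ → ℂ) (i : Fin 2) :
    ∫ x, g x * rhs q w f x i ∂baseMeasure q w =
      ∫ x, g x * (density w x *ᵥ f x) i ∂traceMeasure w := by
  rw [← integral_rnDeriv_smul (Measure.absolutelyContinuous_of_le (traceMeasure_le q w))]
  refine integral_congr_ae (ae_of_all _ fun x => ?_)
  simp only [rhs, Pi.smul_apply, smul_eq_mul, traceDensity, Complex.real_smul]
  ring

lemma exists_cutoff (K : Set ℝ) (hK : IsCompact K) :
    ∃ φ : ℝ → ℂ, Continuous φ ∧ HasCompactSupport φ ∧ ∀ x ∈ K, φ x = 1 := by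
  obtain ⟨f, h1, -, h2, -⟩ := exists_continuous_one_zero_of_isCompact hK isClosed_empty
    (Set.disjoint_empty K)
  refine ⟨fun x => (f x : ℂ), Complex.continuous_ofReal.comp f.continuous,
    h2.comp_left (g := Complex.ofReal) Complex.ofReal_zero, fun x hx => ?_⟩
  change ((f x : ℝ) : ℂ) = 1
  rw [h1 hx]; simp

lemma locallyIntegrable_of_integrable_mul {μ : Measure ℝ} {g : ℝ → ℂ}
    (h : ∀ φ : ℝ → ℂ, Continuous φ → HasCompactSupport φ → Integrable (fun x => φ x * g x) μ) :
    LocallyIntegrable g μ := by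
  intro x
  obtain ⟨φ, h1, h2, h3⟩ := exists_cutoff (Set.Icc (x - 1) (x + 1)) isCompact_Icc
  refine ⟨Set.Icc (x - 1) (x + 1), Icc_mem_nhds (by linarith) (by linarith), ?_⟩
  refine (h φ h1 h2).integrableOn.congr_fun (fun y hy => ?_) measurableSet_Icc
  simp [h3 y hy]

lemma locallyIntegrable_rhs {f : ℝ → Fin 2 → ℂ} (hf : f ∈ sqIntegrable w) (i : Fin 2) :
    LocallyIntegrable (fun x => rhs q w f x i) (baseMeasure q w) :=
  locallyIntegrable_of_integrable_mul fun _ hφ hφ' =>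
    integrable_mul_rhs (integrable_mul_density w hf i hφ hφ')

lemma locallyIntegrable_qDensity_mul {u : ℝ → Fin 2 → ℂ}
    (hu : LocallyBoundedVariationOn u Set.univ) (i j : Fin 2) :
    LocallyIntegrable (fun x => qDensity q w x i j * u x j) (baseMeasure q w) :=
  locallyIntegrable_bdd_mul (locallyIntegrable_of_bv hu _ j)
    (measurable_qDensity i j).aestronglyMeasurable fun _ _ =>
      ⟨1, norm_qDensity_le.mono fun _ hx _ => hx i j⟩

lemma integral_eq_integral_qDensity {g : ℝ → ℂ} {i j : Fin 2} (h1 : Integrable g (q i j).pos)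
    (h2 : Integrable g (q i j).neg) :
    (q i j).integral g = ∫ x, g x * qDensity q w x i j ∂baseMeasure q w := by
  have ac1 := Measure.absolutelyContinuous_of_le (pos_le q w i j)
  have ac2 := Measure.absolutelyContinuous_of_le (neg_le q w i j)
  rw [OrderZero.integral, ← integral_rnDeriv_smul ac1, ← integral_rnDeriv_smul ac2,
    ← integral_sub ((integrable_rnDeriv_smul_iff ac1).2 h1)
      ((integrable_rnDeriv_smul_iff ac2).2 h2)]
  refine integral_congr_ae (ae_of_all _ fun x => ?_)
  simp only [qDensity, Matrix.of_apply, Complex.real_smul]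
  push_cast
  ring

/-- The integral equation implies the distributional one. -/
theorem IsSol.solves {f U h : ℝ → Fin 2 → ℂ}
    (hU : IsSol (baseMeasure q w) (toComplex J) (coeff q w 0) (rhs q w f) U h) :
    Solves J q w (bal (baseMeasure q w) U h) f := by
  intro φ i
  have hu := bv_bal hU.prim
  set u := bal (baseMeasure q w) U h with hudef
  have hφ := φ.continuous
  have hφ' := φ.hasCompactSupport
  have hφ1 : ContDiff ℝ 1 φ := φ.contDiff.of_le (by simp)
  have e1 : ∀ j, ∫ x, deriv φ x * u x j = -∫ x, φ x * h x j ∂baseMeasure q w := by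
    intro j
    rw [← (hU.prim j).integral_deriv_mul hφ1 hφ']
    refine integral_congr_ae ?_
    filter_upwards [ae_volume_measureReal_singleton (baseMeasure q w)] with x hx
    simp [hudef, bal, hx]
  have e2 : ∀ j, (q i j).integral (fun x => φ x * u x j) =
      ∫ x, φ x * u x j * qDensity q w x i j ∂baseMeasure q w := fun j =>
    integral_eq_integral_qDensity (integrable_mul_of_bv hu _ j hφ hφ')
      (integrable_mul_of_bv hu _ j hφ hφ')
  have i1 : ∀ j, Integrable (fun x => φ x * h x j) (baseMeasure q w) := fun j =>
    (hU.prim j).1.integrable_smul_left_of_hasCompactSupport hφ hφ'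
  have i2 : ∀ j, Integrable (fun x => φ x * u x j * qDensity q w x i j) (baseMeasure q w) := by
    intro j
    refine ((locallyIntegrable_qDensity_mul hu i
      j).integrable_smul_left_of_hasCompactSupport hφ hφ').congr (ae_of_all _ fun x => ?_)
    simp only [smul_eq_mul]
    ring
  simp only [e1, e2]
  rw [← integral_mul_rhs (q := q)]
  have e3 : ∫ x, φ x * rhs q w f x i ∂baseMeasure q w =
      ∫ x, (∑ j, ((J i j : ℂ) * (φ x * h x j) + φ x * u x j * qDensity q w x i j))
        ∂baseMeasure q w := by
    refine integral_congr_ae ?_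
    filter_upwards [hU.eqn] with x hx
    have hx' := congrFun hx i
    rw [coeff_zero, Pi.sub_apply, mulVec_fin_two, mulVec_fin_two] at hx'
    simp only [toComplex_apply] at hx'
    rw [Fin.sum_univ_two]
    linear_combination -φ x * hx'
  have i3 : ∀ j, Integrable (fun x => (J i j : ℂ) * (φ x * h x j) +
      φ x * u x j * qDensity q w x i j) (baseMeasure q w) := fun j =>
    ((i1 j).const_mul _).add (i2 j)
  have e4 : ∀ j, ∫ x, ((J i j : ℂ) * (φ x * h x j) + φ x * u x j * qDensity q w x i j)
      ∂baseMeasure q w = (J i j : ℂ) * (∫ x, φ x * h x j ∂baseMeasure q w) +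
        ∫ x, φ x * u x j * qDensity q w x i j ∂baseMeasure q w := fun j => by
    rw [integral_add ((i1 j).const_mul _) (i2 j), integral_const_mul]
  rw [e3, integral_finsetSum _ fun j _ => i3 j]
  simp only [e4]
  simp only [Finset.sum_add_distrib, mul_neg, Finset.sum_neg_distrib, neg_neg]

/-- A balanced distributional solution satisfies the integral equation. -/
theorem exists_isSol_of_solves (H : Admissible J q w) {u f : ℝ → Fin 2 → ℂ}
    (hu : LocallyBoundedVariationOn u Set.univ) (hub : IsBalanced u) (hf : f ∈ sqIntegrable w)
    (hs : Solves J q w u f) :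
    ∃ U h, IsSol (baseMeasure q w) (toComplex J) (coeff q w 0) (rhs q w f) U h ∧
      u = bal (baseMeasure q w) U h := by
  set μ := baseMeasure q w with hμ
  have S := H.isRegularSystem 0
  obtain ⟨j0, j1, j2⟩ := S.J_apply
  have hne := S.ne_zero
  set r : ℝ → Fin 2 → ℂ := fun x => rhs q w f x - qDensity q w x *ᵥ u x with hr
  have hri : ∀ i, LocallyIntegrable (fun x => r x i) μ := by
    intro i
    have h1 := (locallyIntegrable_rhs (q := q) hf i).sub
      ((locallyIntegrable_qDensity_mul (q := q) (w := w) hu i 0).add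
      (locallyIntegrable_qDensity_mul (q := q) (w := w) hu i 1))
    refine h1.congr (ae_of_all _ fun x => ?_)
    simp only [hr, Pi.sub_apply, mulVec_fin_two, Pi.add_apply]
  -- This is J⁻¹ r written out: J has zero diagonal and off-diagonal entries -J₁₀ and J₁₀.
  set h : ℝ → Fin 2 → ℂ := fun x => ![(toComplex J 1 0)⁻¹ * r x 1, -(toComplex J 1 0)⁻¹ * r x 0]
    with hh
  have hhi : ∀ j, LocallyIntegrable (fun x => h x j) μ := by
    intro j
    fin_cases j
    · exact (hri 1).smul (toComplex J 1 0)⁻¹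
    · exact (hri 0).smul (-(toComplex J 1 0)⁻¹)
  have hJh : ∀ x, toComplex J *ᵥ h x = r x := by
    intro x
    ext i
    rw [mulVec_fin_two]
    fin_cases i <;> simp [hh, j0, j1, j2, hne]
  have test : ∀ φ : ℝ → ℂ, ContDiff ℝ ((⊤ : ℕ∞) : WithTop ℕ∞) φ → HasCompactSupport φ → ∀ j,
      ∫ x, deriv φ x * u x j = -∫ x, φ x * h x j ∂μ := by
    intro φ hφ hφ'
    have main : ∀ i, ∑ j, (J i j : ℂ) * (∫ x, deriv φ x * u x j) = -∫ x, φ x * r x i ∂μ := by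
      intro i
      have e := hs ⟨φ, hφ, hφ', by simp⟩ i
      change -∑ j, (J i j : ℂ) * (∫ x, deriv φ x * u x j) +
        ∑ j, (q i j).integral (fun x => φ x * u x j) =
        ∫ x, φ x * (density w x *ᵥ f x) i ∂traceMeasure w at e
      have hc := hφ.continuous
      have e2 : ∀ j, (q i j).integral (fun x => φ x * u x j) =
          ∫ x, φ x * u x j * qDensity q w x i j ∂μ := fun j =>
        integral_eq_integral_qDensity (integrable_mul_of_bv hu _ j hc hφ')
          (integrable_mul_of_bv hu _ j hc hφ')
      have i2 : ∀ j, Integrable (fun x => φ x * u x j * qDensity q w x i j) μ := by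
        intro j
        refine ((locallyIntegrable_qDensity_mul hu i
          j).integrable_smul_left_of_hasCompactSupport hc hφ').congr (ae_of_all _ fun x => ?_)
        simp only [smul_eq_mul]
        ring
      rw [← integral_mul_rhs (q := q)] at e
      simp only [e2] at e
      rw [← integral_finsetSum _ fun j _ => i2 j] at e
      have e3 : ∫ x, φ x * r x i ∂μ = (∫ x, φ x * rhs q w f x i ∂μ) -
          ∫ x, ∑ j, φ x * u x j * qDensity q w x i j ∂μ := by
        rw [← integral_sub (integrable_mul_rhs (integrable_mul_density w hf i hc hφ'))
          (integrable_finsetSum _ fun j _ => i2 j)]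
        refine integral_congr_ae (ae_of_all _ fun x => ?_)
        simp only [hr, Pi.sub_apply, mulVec_fin_two, Fin.sum_univ_two]
        ring
      rw [e3, ← e]
      ring
    have m0 := main 0
    have m1 := main 1
    simp only [Fin.sum_univ_two, ← toComplex_apply, j0, j1, j2] at m0 m1
    intro j
    fin_cases j
    · have e : ∫ x, φ x * h x 0 ∂μ = (toComplex J 1 0)⁻¹ * ∫ x, φ x * r x 1 ∂μ := by
        rw [← integral_const_mul]
        refine integral_congr_ae (ae_of_all _ fun x => ?_)
        simp only [hh, Matrix.cons_val_zero]
        ring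
      change ∫ x, deriv φ x * u x 0 = -∫ x, φ x * h x 0 ∂μ
      rw [e]
      field_simp
      linear_combination m1
    · have e : ∫ x, φ x * h x 1 ∂μ = -(toComplex J 1 0)⁻¹ * ∫ x, φ x * r x 0 ∂μ := by
        rw [← integral_const_mul]
        refine integral_congr_ae (ae_of_all _ fun x => ?_)
        simp only [hh, Matrix.cons_val_one, Matrix.cons_val_fin_one]
        ring
      change ∫ x, deriv φ x * u x 1 = -∫ x, φ x * h x 1 ∂μ
      rw [e]
      field_simp
      linear_combination -m0
  have hP : ∀ j, IsPrimitive μ (fun x => 0 + ∫ t in (0 : ℝ)..x, h t j ∂μ) fun x => h x j :=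
    fun j => isPrimitive_integral (hhi j) 0 0
  -- Both u and the primitive of h μ have distributional derivative h μ, so du Bois-Reymond's lemma
  -- applies to their difference.
  have hC : ∀ j, ∃ C : ℂ, ∀ᵐ x, u x j - (0 + ∫ t in (0 : ℝ)..x, h t j ∂μ) = C := by
    intro j
    have hPl : LocallyIntegrable (fun x => 0 + ∫ t in (0 : ℝ)..x, h t j ∂μ) volume := by
      have hb := locallyIntegrable_of_bv (bv_bal hP) volume j
      refine hb.congr ?_
      filter_upwards [ae_volume_measureReal_singleton μ] with x hx
      simp [bal, hx]
    refine exists_ae_eq_const_of_integral_deriv_mul_eq_zero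
      ((locallyIntegrable_of_bv hu volume j).sub hPl) fun φ hφ hφ' => ?_
    have hd : Continuous (deriv φ) := hφ.continuous_deriv (by simp)
    have e : ∀ x, deriv φ x * (u x j - (0 + ∫ t in (0 : ℝ)..x, h t j ∂μ)) =
        deriv φ x * u x j - deriv φ x * (0 + ∫ t in (0 : ℝ)..x, h t j ∂μ) := fun x => by ring
    change ∫ x, deriv φ x * (u x j - (0 + ∫ t in (0 : ℝ)..x, h t j ∂μ)) = 0
    simp only [e]
    have i5 : Integrable (fun x => deriv φ x * (0 + ∫ t in (0 : ℝ)..x, h t j ∂μ)) :=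
      hPl.integrable_smul_left_of_hasCompactSupport hd hφ'.deriv
    rw [integral_sub (integrable_mul_of_bv hu _ j hd hφ'.deriv) i5, test φ hφ hφ' j,
      (hP j).integral_deriv_mul (hφ.of_le (by simp)) hφ', sub_self]
  choose C hC using hC
  set U : ℝ → Fin 2 → ℂ := fun x j => C j + ∫ t in (0 : ℝ)..x, h t j ∂μ with hUdef
  have hU : ∀ j, IsPrimitive μ (fun x => U x j) fun x => h x j := fun j =>
    isPrimitive_integral (hhi j) 0 (C j)
  have hae : ∀ᵐ x, u x = U x := by
    filter_upwards [hC 0, hC 1] with x h0 h1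
    ext j
    fin_cases j
    · change u x 0 = C 0 + ∫ t in (0 : ℝ)..x, h t 0 ∂μ
      linear_combination h0
    · change u x 1 = C 1 + ∫ t in (0 : ℝ)..x, h t 1 ∂μ
      linear_combination h1
  have hfreq : ∀ (s : Set ℝ) (x : ℝ), (∀ t ∈ 𝓝[s] x, volume t ≠ 0) → ∃ᶠ y in 𝓝[s] x, u y = U y := by
    intro s x ht hev
    exact ht _ hev (measure_mono_null (fun y hy => by simpa using hy) (ae_iff.1 hae))
  have hfr : ∀ x, ∃ᶠ y in 𝓝[>] x, u y = U y := by
    intro x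
    refine hfreq _ x fun t ht h0 => ?_
    obtain ⟨b, hb, hb'⟩ := (mem_nhdsGT_iff_exists_Ioo_subset).1 ht
    have := measure_mono_null hb' h0
    rw [Real.volume_Ioo, ENNReal.ofReal_eq_zero] at this
    linarith [Set.mem_Ioi.1 hb]
  have hfl : ∀ x, ∃ᶠ y in 𝓝[<] x, u y = U y := by
    intro x
    refine hfreq _ x fun t ht h0 => ?_
    obtain ⟨b, hb, hb'⟩ := (mem_nhdsLT_iff_exists_Ioo_subset).1 ht
    have := measure_mono_null hb' h0
    rw [Real.volume_Ioo, ENNReal.ofReal_eq_zero] at this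
    linarith [Set.mem_Iio.1 hb]
  -- Equality Lebesgue-almost everywhere holds at points arbitrarily close to x on either side. It
  -- therefore identifies the one-sided limits, and their mean is u(x) because u is balanced.
  have heq : u = bal μ U h := by
    ext x j
    obtain ⟨a, b, ha, hb, hx⟩ := hub x
    have hb' : b = U x := tendsto_nhds_unique_of_frequently_eq hb
      (tendsto_pi_nhds.2 fun j => (hU j).tendsto_right x) (hfr x)
    have ha' : a = fun j => U x j - μ.real {x} * h x j := tendsto_nhds_unique_of_frequently_eq ha
      (tendsto_pi_nhds.2 fun j => (hU j).tendsto_left x) (hfl x)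
    rw [hx, ha', hb']
    simp only [bal, Pi.smul_apply, Pi.add_apply, smul_eq_mul]
    ring
  refine ⟨U, h, ⟨hU, ae_of_all _ fun x => ?_⟩, heq⟩
  rw [hJh x, ← heq, coeff_zero]

end DistributionalSystem

namespace DistributionalSystem

open scoped ENNReal

/-! ### Periods -/

/-- Translates of test functions are test functions. -/
def translate (φ : 𝓓((⊤ : Opens ℝ), ℂ)) (a : ℝ) : 𝓓((⊤ : Opens ℝ), ℂ) :=
  ⟨fun x => φ (x + a), φ.contDiff.comp (contDiff_id.add contDiff_const),
    φ.hasCompactSupport.comp_homeomorph (Homeomorph.addRight a), by simp⟩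

namespace OrderZero.IsPeriod

variable {r : OrderZero} {a b : ℝ}

lemma add (ha : r.IsPeriod a) (hb : r.IsPeriod b) : r.IsPeriod (a + b) := by
  intro φ
  have h : r.integral (fun x => φ (x + a + b)) = r.integral (fun x => φ (x + b)) :=
    ha (translate φ b)
  rw [← hb φ, ← h]
  simp only [add_assoc]

lemma neg (ha : r.IsPeriod a) : r.IsPeriod (-a) := by
  intro φ
  have h : r.integral (fun x => φ (x + a + -a)) = r.integral (fun x => φ (x + -a)) :=
    ha (translate φ (-a))
  simpa only [add_neg_cancel_right] using h.symm

lemma zero (r : OrderZero) : r.IsPeriod 0 := by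
  intro φ; simp

lemma nat_mul (ha : r.IsPeriod a) (n : ℕ) : r.IsPeriod (n * a) := by
  induction n with
  | zero => simpa using zero r
  | succ n ih =>
    have := ih.add ha
    push_cast
    rwa [add_mul, one_mul]

end OrderZero.IsPeriod

/-! ### The semi-inner product -/

variable {w : Matrix (Fin 2) (Fin 2) OrderZero}

/-- `w f = 0`. -/
def IsNull (w : Matrix (Fin 2) (Fin 2) OrderZero) (f : ℝ → Fin 2 → ℂ) : Prop :=
  ∀ᵐ x ∂traceMeasure w, density w x *ᵥ f x = 0

lemma pairing_eq_zero_right {f g : ℝ → Fin 2 → ℂ} {x : ℝ} (h : density w x *ᵥ f x = 0) :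
    pairing w g f x = 0 := by simp [pairing, h]

lemma pairing_eq_zero_left {f g : ℝ → Fin 2 → ℂ} {x : ℝ} (h : density w x *ᵥ f x = 0) :
    pairing w f g x = 0 := by
  rw [← conj_pairing, pairing_eq_zero_right h, map_zero]

lemma mulVec_eq_zero_of_pairing {f : ℝ → Fin 2 → ℂ} {x : ℝ} (h : pairing w f f x = 0) :
    density w x *ᵥ f x = 0 :=
  ((density_posSemidef w x).dotProduct_mulVec_zero_iff _).1 h

lemma isNull_of_integral_eq_zero {f : ℝ → Fin 2 → ℂ} (hf : f ∈ sqIntegrable w)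
    (h : ∫ x, pairing w f f x ∂traceMeasure w = 0) : IsNull w f := by
  have h1 := (integral_eq_zero_iff_of_nonneg (μ := traceMeasure w)
    (f := fun x => (pairing w f f x).re)
    (fun x => (Complex.le_def.1 (pairing_self_nonneg w f x)).1) hf.2.re).1 (by
      have := Complex.reCLM.integral_comp_comm hf.2
      rw [h] at this
      simpa using this)
  filter_upwards [h1] with x hx
  refine mulVec_eq_zero_of_pairing ?_
  have := pairing_self_nonneg w f x
  rw [Complex.le_def] at this
  exact Complex.ext hx this.2.symm

/-- The element of `𝓛²(w)` given by a function. -/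
def mkPre (f : ℝ → Fin 2 → ℂ) (hf : f ∈ sqIntegrable w) : PreL2 w :=
  (⟨f, hf⟩ : sqIntegrable w)

@[simp]
lemma mkPre_toFun (f : ℝ → Fin 2 → ℂ) (hf : f ∈ sqIntegrable w) :
    (mkPre f hf).toFun = f := rfl

lemma inner_mkPre {f g : ℝ → Fin 2 → ℂ} (hf : f ∈ sqIntegrable w) (hg : g ∈ sqIntegrable w) :
    inner ℂ (mkPre f hf) (mkPre g hg) = ∫ x, pairing w f g x ∂traceMeasure w := rfl

lemma norm_sq_mkPre {f : ℝ → Fin 2 → ℂ} (hf : f ∈ sqIntegrable w) :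
    ‖mkPre f hf‖ ^ 2 = (∫ x, pairing w f f x ∂traceMeasure w).re := by
  rw [← inner_mkPre hf hf]
  exact (inner_self_eq_norm_sq (𝕜 := ℂ) _).symm

lemma toL2_eq_zero_iff {F : PreL2 w} : toL2 w F = 0 ↔ IsNull w F.toFun := by
  rw [← inner_self_eq_zero (𝕜 := ℂ), inner_toL2]
  refine ⟨isNull_of_integral_eq_zero F.toFun_mem, fun h => ?_⟩
  refine integral_eq_zero_of_ae ?_
  filter_upwards [h] with x hx using pairing_eq_zero_right hx

lemma toL2_eq_iff {F G : PreL2 w} : toL2 w F = toL2 w G ↔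
    ∀ᵐ x ∂traceMeasure w, density w x *ᵥ F.toFun x = density w x *ᵥ G.toFun x := by
  rw [← sub_eq_zero, ← map_sub, toL2_eq_zero_iff]
  simp only [IsNull, map_sub, Pi.sub_apply, Matrix.mulVec_sub, sub_eq_zero]

lemma pairing_congr {f f' g g' : ℝ → Fin 2 → ℂ} {x : ℝ}
    (hf : density w x *ᵥ f x = density w x *ᵥ f' x)
    (hg : density w x *ᵥ g x = density w x *ᵥ g' x) : pairing w f g x = pairing w f' g' x := by
  have h1 : pairing w f g x = pairing w f g' x := by simp only [pairing, hg]
  rw [h1, ← conj_pairing, ← conj_pairing (f := f')]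
  simp only [pairing, hf]

lemma mem_sqIntegrable_congr {f g : ℝ → Fin 2 → ℂ} (hf : f ∈ sqIntegrable w)
    (hg : AEMeasurable g (traceMeasure w))
    (h : ∀ᵐ x ∂traceMeasure w, density w x *ᵥ f x = density w x *ᵥ g x) : g ∈ sqIntegrable w :=
  ⟨hg, hf.2.congr (h.mono fun _ hx => pairing_congr hx hx)⟩

lemma pairing_indicator (s : Set ℝ) (f g : ℝ → Fin 2 → ℂ) :
    pairing w (s.indicator f) g = s.indicator (pairing w f g) := by
  ext x
  by_cases hx : x ∈ s <;> simp [pairing, hx]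

lemma pairing_indicator' (s : Set ℝ) (f g : ℝ → Fin 2 → ℂ) :
    pairing w f (s.indicator g) = s.indicator (pairing w f g) := by
  ext x
  by_cases hx : x ∈ s <;> simp [pairing, hx]

lemma pairing_indicator_self (s : Set ℝ) (f : ℝ → Fin 2 → ℂ) :
    pairing w (s.indicator f) (s.indicator f) = s.indicator (pairing w f f) := by
  rw [pairing_indicator, pairing_indicator', Set.indicator_indicator, Set.inter_self]

lemma indicator_mem_sqIntegrable {f : ℝ → Fin 2 → ℂ} (hf : f ∈ sqIntegrable w) {s : Set ℝ}
    (hs : MeasurableSet s) : s.indicator f ∈ sqIntegrable w :=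
  ⟨hf.1.indicator hs, by rw [pairing_indicator_self]; exact hf.2.indicator hs⟩

lemma aemeasurable_of_bv {u : ℝ → Fin 2 → ℂ} (hu : LocallyBoundedVariationOn u Set.univ)
    (μ : Measure ℝ) [IsLocallyFiniteMeasure μ] : AEMeasurable u μ :=
  aemeasurable_pi_iff.2 fun j => (locallyIntegrable_of_bv hu μ j).aestronglyMeasurable.aemeasurable

lemma exists_norm_le_of_bv {u : ℝ → Fin 2 → ℂ} (hu : LocallyBoundedVariationOn u Set.univ)
    (a b : ℝ) : ∃ C : ℝ, ∀ x ∈ Set.Icc a b, ‖u x‖ ≤ C := by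
  refine ⟨‖u a‖ + (eVariationOn u (Set.univ ∩ Set.Icc a b)).toReal, fun x hx => ?_⟩
  have hb := hu a b trivial trivial
  have h1 : dist (u x) (u a) ≤ (eVariationOn u (Set.univ ∩ Set.Icc a b)).toReal := by
    rw [dist_edist]
    exact ENNReal.toReal_mono hb (eVariationOn.edist_le u ⟨trivial, hx⟩
      ⟨trivial, le_rfl, hx.1.trans hx.2⟩)
  rw [dist_eq_norm] at h1
  have := norm_le_norm_add_norm_sub' (u x) (u a)
  linarith

lemma norm_pairing_le {f g : ℝ → Fin 2 → ℂ} {x : ℝ} (h : ∀ i j, ‖density w x i j‖ ≤ 1) :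
    ‖pairing w f g x‖ ≤ 4 * (‖f x‖ * ‖g x‖) := by
  have hm : ∀ i, ‖(density w x *ᵥ g x) i‖ ≤ 2 * ‖g x‖ := by
    intro i
    rw [mulVec_fin_two]
    refine (norm_add_le _ _).trans ?_
    rw [norm_mul, norm_mul]
    have a0 := mul_le_mul (h i 0) (norm_le_pi_norm (g x) 0) (norm_nonneg _) zero_le_one
    have a1 := mul_le_mul (h i 1) (norm_le_pi_norm (g x) 1) (norm_nonneg _) zero_le_one
    linarith
  rw [pairing, dotProduct, Fin.sum_univ_two]
  refine (norm_add_le _ _).trans ?_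
  rw [norm_mul, norm_mul, Pi.star_apply, Pi.star_apply, norm_star, norm_star]
  have a0 := mul_le_mul (norm_le_pi_norm (f x) 0) (hm 0) (norm_nonneg _) (norm_nonneg _)
  have a1 := mul_le_mul (norm_le_pi_norm (f x) 1) (hm 1) (norm_nonneg _) (norm_nonneg _)
  linarith

lemma indicator_mem_of_bv {u : ℝ → Fin 2 → ℂ} (hu : LocallyBoundedVariationOn u Set.univ)
    (a b : ℝ) : (Set.Ioc a b).indicator u ∈ sqIntegrable w := by
  have hm := (aemeasurable_of_bv hu (traceMeasure w))
  refine ⟨hm.indicator measurableSet_Ioc, ?_⟩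
  rw [pairing_indicator_self, integrable_indicator_iff measurableSet_Ioc]
  obtain ⟨C, hC⟩ := exists_norm_le_of_bv hu a b
  refine Measure.integrableOn_of_bounded (M := 4 * (C * C)) measure_Ioc_lt_top.ne
    (aemeasurable_pairing w hm hm).aestronglyMeasurable ?_
  refine (ae_restrict_iff' measurableSet_Ioc).2 ?_
  filter_upwards [norm_density_le (w := w)] with x hx hxs
  refine (norm_pairing_le hx).trans ?_
  have h1 := hC x (Set.Ioc_subset_Icc_self hxs)
  have h0 := (norm_nonneg (u x)).trans h1
  gcongr

/-! ### Translations -/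

section Translation

variable {a : ℝ} (ha : ∀ i j, (w i j).IsPeriod a)
include ha

lemma pairing_comp_add (f g : ℝ → Fin 2 → ℂ) : ∀ᵐ x ∂traceMeasure w,
    pairing w (fun x => f (x + a)) (fun x => g (x + a)) x = pairing w f g (x + a) := by
  filter_upwards [density_comp_add ha] with x hx
  simp only [pairing, hx]

lemma comp_add_mem_sqIntegrable {f : ℝ → Fin 2 → ℂ} (hf : f ∈ sqIntegrable w) :
    (fun x => f (x + a)) ∈ sqIntegrable w := by
  have hp := measurePreserving_traceMeasure ha
  refine ⟨hf.1.comp_quasiMeasurePreserving hp.quasiMeasurePreserving, ?_⟩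
  refine Integrable.congr ?_ ((pairing_comp_add ha f f).mono fun x hx => hx.symm)
  exact (hp.integrable_comp_emb (measurableEmbedding_addRight a)).2 hf.2

lemma integral_pairing_comp_add (f g : ℝ → Fin 2 → ℂ) :
    ∫ x, pairing w (fun x => f (x + a)) (fun x => g (x + a)) x ∂traceMeasure w =
      ∫ x, pairing w f g x ∂traceMeasure w := by
  rw [integral_congr_ae (pairing_comp_add ha f g)]
  exact (measurePreserving_traceMeasure ha).integral_comp (measurableEmbedding_addRight a) _

end Translation

/-- Translations by periods tending to infinity converge weakly to zero. -/
theorem tendsto_integral_pairing_comp_add {τ : ℕ → ℝ} (hτ : ∀ n i j, (w i j).IsPeriod (τ n))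
    (hlim : Tendsto (fun n => |τ n|) atTop atTop) {v f : ℝ → Fin 2 → ℂ} (hv : v ∈ sqIntegrable w)
    (hf : f ∈ sqIntegrable w) :
    Tendsto (fun n => ∫ x, pairing w v (fun x => f (x + τ n)) x ∂traceMeasure w) atTop (𝓝 0) := by
  set fn : ℕ → ℝ → Fin 2 → ℂ := fun n x => f (x + τ n) with hfn
  have hfnm : ∀ n, fn n ∈ sqIntegrable w := fun n => comp_add_mem_sqIntegrable (hτ n) hf
  have hfnn : ∀ n, ‖mkPre (fn n) (hfnm n)‖ = ‖mkPre f hf‖ := by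
    intro n
    refine (sq_eq_sq₀ (norm_nonneg _) (norm_nonneg _)).1 ?_
    rw [norm_sq_mkPre, norm_sq_mkPre, hfn, integral_pairing_comp_add (hτ n)]
  have hms : ∀ R : ℝ, MeasurableSet (Set.Icc (-R) R) := fun R => measurableSet_Icc
  have h1 : ∀ R : ℕ, (Set.Icc (-(R : ℝ)) R)ᶜ.indicator v ∈ sqIntegrable w := fun R =>
    indicator_mem_sqIntegrable hv (hms R).compl
  have h2 : ∀ (R : ℕ) n, (Set.Icc (-(R : ℝ)) R).indicator (fn n) ∈ sqIntegrable w := fun R n =>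
    indicator_mem_sqIntegrable (hfnm n) (hms R)
  -- The part of v outside [-R, R] is small uniformly in n, as translation preserves the norm.
  -- Inside, the translate carries the mass of f on [-R + τ, R + τ] with τ = τ n, a window that
  -- escapes to infinity.
  have split : ∀ (R : ℕ) n, ∫ x, pairing w v (fn n) x ∂traceMeasure w =
      inner ℂ (mkPre _ (h1 R)) (mkPre _ (hfnm n)) + inner ℂ (mkPre _ hv) (mkPre _ (h2 R n)) := by
    intro R n
    rw [inner_mkPre, inner_mkPre, ← integral_add (integrable_pairing w (h1 R) (hfnm n))
      (integrable_pairing w hv (h2 R n))]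
    congr 1
    ext x
    rw [pairing_indicator, pairing_indicator', Set.indicator_compl_add_self_apply]
  have t1 : Tendsto (fun R : ℕ => ‖mkPre _ (h1 R)‖) atTop (𝓝 0) := by
    have : Tendsto (fun R : ℕ => ‖mkPre _ (h1 R)‖ ^ 2) atTop (𝓝 0) := by
      simp only [norm_sq_mkPre, pairing_indicator_self]
      have : Tendsto (fun R : ℕ => ∫ x, (Set.Icc (-(R : ℝ)) R)ᶜ.indicator (pairing w v v) x
          ∂traceMeasure w) atTop (𝓝 (∫ x, (0 : ℂ) ∂traceMeasure w)) := by
        refine tendsto_integral_of_dominated_convergence (fun x => ‖pairing w v v x‖)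
          (fun R => (hv.2.indicator (hms R).compl).aestronglyMeasurable) hv.2.norm
          (fun R => ae_of_all _ fun x => norm_indicator_le_norm_self _ _)
          (ae_of_all _ fun x => ?_)
        refine tendsto_const_nhds.congr' ?_
        filter_upwards [eventually_ge_atTop ⌈|x|⌉₊] with R hR
        rw [Set.indicator_of_notMem]
        simp only [Set.mem_compl_iff, not_not]
        exact abs_le.1 ((Nat.le_ceil _).trans (by exact_mod_cast hR))
      have := (Complex.continuous_re.tendsto _).comp this
      simpa [Function.comp_def] using this
    have := this.sqrt
    simpa [Real.sqrt_sq] using this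
  have t2 : ∀ R : ℕ, Tendsto (fun n => ‖mkPre _ (h2 R n)‖) atTop (𝓝 0) := by
    intro R
    have : Tendsto (fun n => ‖mkPre _ (h2 R n)‖ ^ 2) atTop (𝓝 0) := by
      simp only [norm_sq_mkPre, pairing_indicator_self]
      have e : ∀ n, ∫ x, (Set.Icc (-(R : ℝ)) R).indicator (pairing w (fn n) (fn n)) x
          ∂traceMeasure w = ∫ x, (Set.Icc (-(R : ℝ) + τ n) (R + τ n)).indicator (pairing w f f) x
          ∂traceMeasure w := by
        intro n
        refine Eq.trans (integral_congr_ae ?_)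
          ((measurePreserving_traceMeasure (hτ n)).integral_comp
            (measurableEmbedding_addRight (τ n)) _)
        filter_upwards [pairing_comp_add (hτ n) f f] with x hx
        by_cases hxs : x ∈ Set.Icc (-(R : ℝ)) R
        · rw [Set.indicator_of_mem hxs, Set.indicator_of_mem, ← hx]
          exact ⟨by linarith [hxs.1], by linarith [hxs.2]⟩
        · rw [Set.indicator_of_notMem hxs, Set.indicator_of_notMem]
          exact fun h => hxs ⟨by linarith [h.1], by linarith [h.2]⟩
      simp only [e]
      have : Tendsto (fun n => ∫ x, (Set.Icc (-(R : ℝ) + τ n) (R + τ n)).indicator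
          (pairing w f f) x ∂traceMeasure w) atTop (𝓝 (∫ x, (0 : ℂ) ∂traceMeasure w)) := by
        refine tendsto_integral_of_dominated_convergence (fun x => ‖pairing w f f x‖)
          (fun n => (hf.2.indicator measurableSet_Icc).aestronglyMeasurable) hf.2.norm
          (fun n => ae_of_all _ fun x => norm_indicator_le_norm_self _ _)
          (ae_of_all _ fun x => ?_)
        refine tendsto_const_nhds.congr' ?_
        filter_upwards [hlim.eventually_gt_atTop (|x| + R)] with n hn
        rw [Set.indicator_of_notMem]
        rintro ⟨a1, a2⟩
        have : |τ n| ≤ |x| + R := abs_le.2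
          ⟨by linarith [neg_abs_le x], by linarith [le_abs_self x]⟩
        linarith
      have := (Complex.continuous_re.tendsto _).comp this
      simpa [Function.comp_def] using this
    have := this.sqrt
    simpa [Real.sqrt_sq] using this
  refine Metric.tendsto_atTop.2 fun ε hε => ?_
  obtain ⟨R, hR⟩ := ((t1.mul_const ‖mkPre f hf‖).eventually
    (gt_mem_nhds (show 0 * ‖mkPre f hf‖ < ε / 2 by simpa using hε))).exists
  have h3 := ((t2 R).const_mul ‖mkPre v hv‖).eventually
    (gt_mem_nhds (show ‖mkPre v hv‖ * 0 < ε / 2 by simpa using hε))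
  obtain ⟨N, hN⟩ := eventually_atTop.1 h3
  refine ⟨N, fun n hn => ?_⟩
  rw [dist_zero_right, split R n]
  refine (norm_add_le _ _).trans_lt ?_
  have b1 := norm_inner_le_norm (𝕜 := ℂ) (mkPre _ (h1 R)) (mkPre _ (hfnm n))
  have b2 := norm_inner_le_norm (𝕜 := ℂ) (mkPre _ hv) (mkPre _ (h2 R n))
  rw [hfnn n] at b1
  linarith [hN n hn]

end DistributionalSystem

namespace DistributionalSystem

open scoped ENNReal

/-! ### Solutions of the inhomogeneous equation -/

variable {J : Matrix (Fin 2) (Fin 2) ℝ} {q w : Matrix (Fin 2) (Fin 2) OrderZero}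

/-- `bal _ U h` is a balanced solution of `J u' + q u = w f`, with right-hand limits `U`. -/
abbrev IsSolution (J : Matrix (Fin 2) (Fin 2) ℝ) (q w : Matrix (Fin 2) (Fin 2) OrderZero)
    (f U h : ℝ → Fin 2 → ℂ) : Prop :=
  IsSol (baseMeasure q w) (toComplex J) (coeff q w 0) (rhs q w f) U h

lemma rhs_zero : rhs q w 0 = 0 := by ext x; simp [rhs]

lemma star_mulVec_density (x : ℝ) (v : Fin 2 → ℂ) :
    star (density w x *ᵥ v) = density w x *ᵥ star v :=
  IsSol.star_mulVec_of_real (conj_density x) v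

lemma rhs_star (f : ℝ → Fin 2 → ℂ) : rhs q w (star f) = star (rhs q w f) := by
  ext1 x
  rw [rhs, Pi.star_apply, Pi.star_apply, rhs, star_smul, star_mulVec_density]
  simp

lemma pairing_star_star (f g : ℝ → Fin 2 → ℂ) (x : ℝ) :
    pairing w (star f) (star g) x = pairing w g f x := by
  rw [← conj_pairing w g f, pairing, pairing, Pi.star_apply, Pi.star_apply, ← star_mulVec_density,
    starRingEnd_apply, Matrix.star_dotProduct, star_star, dotProduct_comm]

lemma star_mem_sqIntegrable {f : ℝ → Fin 2 → ℂ} (hf : f ∈ sqIntegrable w) :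
    star f ∈ sqIntegrable w := by
  refine ⟨?_, hf.2.congr (ae_of_all _ fun x => (pairing_star_star f f x).symm)⟩
  exact aemeasurable_pi_iff.2 fun j =>
    Complex.continuous_conj.measurable.comp_aemeasurable (aemeasurable_pi_iff.1 hf.1 j)

lemma IsNull.star {f : ℝ → Fin 2 → ℂ} (hf : IsNull w f) : IsNull w (star f) := by
  filter_upwards [hf] with x hx
  rw [Pi.star_apply, ← star_mulVec_density, hx, star_zero]

namespace IsSolution

variable {f g U h V k : ℝ → Fin 2 → ℂ}

protected lemma star (hU : IsSolution J q w f U h) :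
    IsSolution J q w (star f) (star U) (star h) := by
  unfold IsSolution
  rw [rhs_star]
  exact IsSol.star (conj_toComplex J) (conj_coeff 0) hU

lemma comp_add {a : ℝ} (hq : ∀ i j, (q i j).IsPeriod a) (hw : ∀ i j, (w i j).IsPeriod a)
    (hU : IsSolution J q w f U h) :
    IsSolution J q w (fun x => f (x + a)) (fun x => U (x + a)) (fun x => h (x + a)) :=
  (IsSol.comp_add (measurePreserving_baseMeasure hq hw) (coeff_comp_add hq hw 0) hU).congr
    (rhs_comp_add hq hw f)

lemma add (hU : IsSolution J q w f U h) (hV : IsSolution J q w g V k) :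
    IsSolution J q w (f + g) (U + V) (h + k) := by
  refine (IsSol.add hU hV).congr (ae_of_all _ fun x => ?_)
  rw [Pi.add_apply, rhs, rhs, rhs, Pi.add_apply, Matrix.mulVec_add, smul_add]

lemma smul (hU : IsSolution J q w f U h) (c : ℂ) : IsSolution J q w (c • f) (c • U) (c • h) := by
  refine (IsSol.smul hU c).congr (ae_of_all _ fun x => ?_)
  rw [Pi.smul_apply, rhs, rhs, Pi.smul_apply, Matrix.mulVec_smul, smul_comm]

lemma sub (hU : IsSolution J q w f U h) (hV : IsSolution J q w g V k) :
    IsSolution J q w (f - g) (U - V) (h - k) := by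
  have := hU.add (hV.smul (-1))
  simpa [sub_eq_add_neg] using this

end IsSolution

lemma setIntegral_rnDeriv_mul (F : ℝ → ℂ) {s : Set ℝ} (hs : MeasurableSet s) :
    ∫ x in s, (traceDensity q w x : ℂ) * F x ∂baseMeasure q w = ∫ x in s, F x ∂traceMeasure w := by
  rw [← setIntegral_rnDeriv_smul (Measure.absolutelyContinuous_of_le (traceMeasure_le q w)) hs]
  rfl

lemma integrableOn_pairing_of_bv {u f : ℝ → Fin 2 → ℂ}
    (hu : LocallyBoundedVariationOn u Set.univ) (hf : f ∈ sqIntegrable w) (a b : ℝ) :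
    IntegrableOn (pairing w u f) (Set.Ioc a b) (traceMeasure w) := by
  rw [← integrable_indicator_iff measurableSet_Ioc, ← pairing_indicator]
  exact integrable_pairing w (indicator_mem_of_bv hu a b) hf

lemma bv_star {u : ℝ → Fin 2 → ℂ} (hu : LocallyBoundedVariationOn u Set.univ) :
    LocallyBoundedVariationOn (star u) Set.univ := by
  have h : LipschitzWith 1 (fun v : Fin 2 → ℂ => star v) := by
    refine LipschitzWith.of_dist_le_mul fun a b => ?_
    rw [NNReal.coe_one, one_mul, dist_eq_norm, dist_eq_norm, ← star_sub, norm_star]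
  exact h.comp_locallyBoundedVariationOn hu

namespace Admissible

variable (H : Admissible J q w)
include H

/-- Lagrange's identity for solutions of inhomogeneous equations. -/
theorem lagrange {f g U h V k : ℝ → Fin 2 → ℂ} (hU : IsSolution J q w f U h)
    (hV : IsSolution J q w g V k) {a b : ℝ} (hab : a ≤ b) :
    V b ⬝ᵥ (toComplex J *ᵥ U b) - V a ⬝ᵥ (toComplex J *ᵥ U a) =
      ∫ x in Set.Ioc a b, (pairing w (star (bal (baseMeasure q w) V k)) f x -
        pairing w (star (bal (baseMeasure q w) U h)) g x) ∂traceMeasure w := by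
  rw [(IsSol.lagrange (H.isRegularSystem 0) hU hV).sub_eq_Ioc hab,
    ← setIntegral_rnDeriv_mul (q := q) _ measurableSet_Ioc]
  congr 1
  ext x
  rw [dotProduct_comm (rhs q w g x)]
  simp only [rhs, dotProduct_smul, pairing, Pi.star_apply, star_star, smul_eq_mul]
  ring

lemma isSolution_hom (c : Fin 2 → ℂ) :
    IsSolution J q w 0 ((H.isRegularSystem 0).homLim c) ((H.isRegularSystem 0).homDensity c) := by
  unfold IsSolution
  rw [rhs_zero]
  exact (H.isRegularSystem 0).isSol_hom c

lemma bv_hom (l : ℝ) (c : Fin 2 → ℂ) :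
    LocallyBoundedVariationOn ((H.isRegularSystem l).hom c) Set.univ :=
  bv_bal ((H.isRegularSystem l).isSol_hom c).prim

end Admissible

lemma IsSol.isSol_zero_of_eigen {u f U h : ℝ → Fin 2 → ℂ} {l : ℝ} (hU : IsSolution J q w f U h)
    (hu : u = bal (baseMeasure q w) U h)
    (hf : ∀ᵐ x ∂traceMeasure w, density w x *ᵥ f x = density w x *ᵥ ((l : ℂ) • u) x) :
    IsSol (baseMeasure q w) (toComplex J) (coeff q w l) 0 U h := by
  have h1 := hU.congr (rhs_congr hf)
  refine ⟨h1.prim, ?_⟩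
  filter_upwards [h1.eqn] with x hx
  rw [hx, hu, coeff_zero, coeff, rhs, Pi.smul_apply, Matrix.mulVec_smul, Matrix.sub_mulVec,
    Matrix.smul_mulVec, smul_smul, Pi.zero_apply, Complex.ofReal_mul, mul_comm (l : ℂ)]
  abel

/-- In finite dimension, weakly convergent sequences converge. -/
lemma tendsto_norm_sq_of_weak {E : Type*} [NormedAddCommGroup E] [InnerProductSpace ℂ E]
    [FiniteDimensional ℂ E] {x : ℕ → E} (h : ∀ v, Tendsto (fun n => inner ℂ v (x n)) atTop (𝓝 0)) :
    Tendsto (fun n => ‖x n‖ ^ 2) atTop (𝓝 0) := by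
  simp only [← (stdOrthonormalBasis ℂ E).sum_sq_norm_inner_right]
  simpa using tendsto_finsetSum Finset.univ
    fun i _ => ((h (stdOrthonormalBasis ℂ E i)).norm.pow 2)

/-- The class of a square integrable solution of the homogeneous equation. -/
def IsRegularSystem.homL2 {μ : Measure ℝ} [IsLocallyFiniteMeasure μ]
    {A : Matrix (Fin 2) (Fin 2) ℂ} {Q : ℝ → Matrix (Fin 2) (Fin 2) ℂ}
    (S : IsRegularSystem μ A Q) (w : Matrix (Fin 2) (Fin 2) OrderZero) :
    (sqIntegrable w).comap S.hom →ₗ[ℂ] L2 w where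
  toFun d := toL2 w (mkPre (S.hom d) d.2)
  map_add' d e := by
    rw [← map_add]
    exact congrArg _ (Subtype.ext (S.hom.map_add d e))
  map_smul' a d := by
    rw [← map_smul]
    exact congrArg _ (Subtype.ext (S.hom.map_smul a d))

lemma inner_toL2_mkPre {f g : ℝ → Fin 2 → ℂ} (hf : f ∈ sqIntegrable w) (hg : g ∈ sqIntegrable w) :
    inner ℂ (toL2 w (mkPre f hf)) (toL2 w (mkPre g hg)) =
      ∫ x, pairing w f g x ∂traceMeasure w := rfl

/-! ### Square integrable solutions for real spectral parameters. -/

section Periodic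

variable {ω : ℝ} (H : Admissible J q w) (hω : 0 < ω) (hq : ∀ i j, (q i j).IsPeriod ω)
  (hw : ∀ i j, (w i j).IsPeriod ω)
include H hω hq hw

/-- For a real spectral parameter, square integrable solutions of the homogeneous equation
vanish. -/
theorem Admissible.isNull_of_hom (l : ℝ) (c : Fin 2 → ℂ)
    (hc : (H.isRegularSystem l).hom c ∈ sqIntegrable w) :
    IsNull w ((H.isRegularSystem l).hom c) := by
  set S := H.isRegularSystem l with hS
  have hqn : ∀ n : ℕ, ∀ i j, (q i j).IsPeriod (n * ω) := fun n i j => (hq i j).nat_mul n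
  have hwn : ∀ n : ℕ, ∀ i j, (w i j).IsPeriod (n * ω) := fun n i j => (hw i j).nat_mul n
  -- By periodicity a translate of a homogeneous solution solves the same equation, so all
  -- translates stay in the two-dimensional solution space.
  have hshift : ∀ n : ℕ, (fun x => S.hom c (x + n * ω)) = S.hom (S.homLim c (n * ω)) := by
    intro n
    have hb := measurePreserving_baseMeasure (hqn n) (hwn n)
    have h1 := (S.isSol_hom c).comp_add hb (coeff_comp_add (hqn n) (hwn n) l)
    have h2 := S.bal_eq_hom h1
    rw [bal_comp_add hb] at h2
    rw [S.hom_apply c, h2]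
    simp
  have hmem : ∀ n : ℕ, S.homLim c (n * ω) ∈ (sqIntegrable w).comap S.hom := fun n => by
    rw [Submodule.mem_comap, ← hshift n]
    exact comp_add_mem_sqIntegrable (hwn n) hc
  have hlim : Tendsto (fun n : ℕ => |(n : ℝ) * ω|) atTop atTop := by
    refine (tendsto_natCast_atTop_atTop.atTop_mul_const hω).congr fun n => ?_
    rw [abs_of_nonneg (by positivity)]
  -- The classes are taken in the finite-dimensional range of `homL2`, where weak convergence to
  -- zero implies norm convergence. Since the norms do not depend on n, they vanish.
  set x : ℕ → LinearMap.range (S.homL2 w) :=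
    fun n => ⟨S.homL2 w ⟨_, hmem n⟩, LinearMap.mem_range_self _ _⟩ with hx
  have hweak : ∀ v, Tendsto (fun n => inner ℂ v (x n)) atTop (𝓝 0) := by
    rintro ⟨v, d, rfl⟩
    refine (tendsto_integral_pairing_comp_add hwn hlim d.2 hc).congr fun n => ?_
    rw [hshift n]
    exact (inner_toL2_mkPre d.2 (hmem n)).symm
  have hnorm : ∀ n, ((‖x n‖ ^ 2 : ℝ) : ℂ) =
      ∫ y, pairing w (S.hom c) (S.hom c) y ∂traceMeasure w := by
    intro n
    rw [← integral_pairing_comp_add (hwn n), hshift n, ← inner_toL2_mkPre (hmem n) (hmem n)]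
    exact_mod_cast (inner_self_eq_norm_sq_to_K (𝕜 := ℂ) (x n)).symm
  refine isNull_of_integral_eq_zero hc ?_
  have h0 := (Complex.continuous_ofReal.tendsto _).comp (tendsto_norm_sq_of_weak hweak)
  rw [Complex.ofReal_zero] at h0
  exact tendsto_nhds_unique (tendsto_const_nhds.congr fun n => (hnorm n).symm) h0

/-- The eigenvalue relation is known only for classes, that is w f = l w u almost everywhere. This
suffices to absorb l w u into the coefficient, and u becomes a homogeneous solution for the
parameter l. -/
theorem Admissible.isNull_of_eigen {u f : PreL2 w} (huf : (u, f) ∈ preTmax J q w) {l : ℝ}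
    (hf : toL2 w f = (l : ℂ) • toL2 w u) : IsNull w u.toFun := by
  obtain ⟨U, h, hU, hu⟩ := exists_isSol_of_solves H huf.1 huf.2.1 f.toFun_mem huf.2.2
  rw [← map_smul, toL2_eq_iff] at hf
  have h1 := IsSol.isSol_zero_of_eigen hU hu (by simpa only [map_smul] using hf)
  have h2 : u.toFun = (H.isRegularSystem l).hom (U 0) :=
    hu.trans ((H.isRegularSystem l).bal_eq_hom h1)
  rw [h2]
  refine H.isNull_of_hom hω hq hw l _ ?_
  rw [← h2]
  exact u.toFun_mem

end Periodic

end DistributionalSystem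

namespace DistributionalSystem

open scoped ENNReal

/-! ### Solutions of the homogeneous equation annihilated by `w` -/

namespace IsRegularSystem

variable {μ : Measure ℝ} {A : Matrix (Fin 2) (Fin 2) ℂ} {Q : ℝ → Matrix (Fin 2) (Fin 2) ℂ}

/-- For a 2×2 skew matrix the pairing is a nonzero multiple of the determinant of the pair, so its
vanishing means that the vectors are parallel. -/
lemma exists_eq_smul_of_pairing_eq_zero (S : IsRegularSystem μ A Q) {a d : Fin 2 → ℂ} (ha : a ≠ 0)
    (h : a ⬝ᵥ (A *ᵥ d) = 0) : ∃ t : ℂ, d = t • a := by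
  obtain ⟨h0, h1, h2⟩ := S.J_apply
  have hj := S.ne_zero
  simp only [dotProduct, Fin.sum_univ_two, mulVec_fin_two, h0, h1, h2] at h
  have h3 : a 1 * d 0 = a 0 * d 1 := by
    apply mul_left_cancel₀ hj
    linear_combination h
  by_cases ha0 : a 0 = 0
  · have ha1 : a 1 ≠ 0 := fun h => ha (by ext i; fin_cases i <;> assumption)
    refine ⟨d 1 / a 1, ?_⟩
    ext i
    fin_cases i <;> simp <;> field_simp
    linear_combination h3
  · refine ⟨d 0 / a 0, ?_⟩
    ext i
    fin_cases i <;> simp <;> field_simp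
    linear_combination -h3

lemma exists_pairing_eq_one (S : IsRegularSystem μ A Q) {a : Fin 2 → ℂ} (ha : a ≠ 0) :
    ∃ d, a ⬝ᵥ (A *ᵥ d) = 1 := by
  obtain ⟨h0, h1, h2⟩ := S.J_apply
  have hj := S.ne_zero
  by_cases ha0 : a 0 = 0
  · have ha1 : a 1 ≠ 0 := fun h => ha (by ext i; fin_cases i <;> assumption)
    refine ⟨![1 / (A 1 0 * a 1), 0], ?_⟩
    simp only [dotProduct, Fin.sum_univ_two, mulVec_fin_two, h0, h1, h2]
    simp
    field_simp
  · refine ⟨![0, -1 / (A 1 0 * a 0)], ?_⟩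
    simp only [dotProduct, Fin.sum_univ_two, mulVec_fin_two, h0, h1, h2]
    simp
    field_simp

/-- A real vector orthogonal to a real vector `k ≠ 0` is a real multiple of `A k`. -/
lemma exists_eq_real_smul (S : IsRegularSystem μ A Q) (hA : ∀ i j, conj (A i j) = A i j)
    {k d : Fin 2 → ℂ} (hk : star k = k) (hd : star d = d) (hk0 : k ≠ 0) (h : k ⬝ᵥ d = 0) :
    ∃ t : ℝ, d = (t : ℂ) • (A *ᵥ k) := by
  obtain ⟨h0, h1, h2⟩ := S.J_apply
  have hj := S.ne_zero
  have ck : ∀ i, conj (k i) = k i := fun i => congrFun hk i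
  have cd : ∀ i, conj (d i) = d i := fun i => congrFun hd i
  simp only [dotProduct, Fin.sum_univ_two] at h
  suffices ∃ t : ℂ, conj t = t ∧ d = t • (A *ᵥ k) by
    obtain ⟨t, ht, h⟩ := this
    obtain ⟨r, rfl⟩ := Complex.conj_eq_iff_real.1 ht
    exact ⟨r, h⟩
  by_cases hk00 : k 0 = 0
  · have hk1 : k 1 ≠ 0 := fun h => hk0 (by ext i; fin_cases i <;> assumption)
    refine ⟨-d 0 / (A 1 0 * k 1), by simp [ck, cd, hA], ?_⟩
    ext i
    simp only [Pi.smul_apply, smul_eq_mul, mulVec_fin_two]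
    fin_cases i
    · simp only [Fin.zero_eta, h0, h2]
      field_simp
      ring
    · have : d 1 = 0 := by simpa [hk1, hk00] using h
      simp [this, h1, hk00]
  · refine ⟨d 1 / (A 1 0 * k 0), by simp [ck, cd, hA], ?_⟩
    ext i
    simp only [Pi.smul_apply, smul_eq_mul, mulVec_fin_two]
    fin_cases i
    · simp only [Fin.zero_eta, h0, h2]
      field_simp
      linear_combination A 1 0 * h
    · simp only [Fin.mk_one, h1]
      field_simp
      ring

/-- If the left-hand limit were zero, the balanced value would be half the jump, and the equation at
the atom would put D in the kernel of the invertible matrix A + (μ{x}/2) Q. -/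
lemma sub_jump_ne_zero (S : IsRegularSystem μ A Q) {K D : Fin 2 → ℂ} {x : ℝ} (hK : K ≠ 0)
    (hD : A *ᵥ D = -(Q x *ᵥ (K - (μ.real {x} / 2 : ℂ) • D))) :
    K - (μ.real {x} : ℂ) • D ≠ 0 := by
  intro h
  have hK' : K = (μ.real {x} : ℂ) • D := sub_eq_zero.1 h
  have h1 : (A + (μ.real {x} / 2 : ℂ) • Q x) *ᵥ D = 0 := by
    rw [Matrix.add_mulVec, hD, hK', ← sub_smul, Matrix.smul_mulVec, Matrix.mulVec_smul,
      show (μ.real {x} : ℂ) - μ.real {x} / 2 = μ.real {x} / 2 by ring]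
    abel
  have h2 := Matrix.eq_zero_of_mulVec_eq_zero (S.det_ne x) h1
  exact hK (by rw [hK', h2, smul_zero])

end IsRegularSystem

/-- If all matrices `A + (Q - l W) / 2`, `l` real, are invertible, then `W` annihilates the jump of a
solution of `A u' + Q u = 0` which it annihilates. -/
lemma mulVec_jump_eq_zero {μ : Measure ℝ} {P : ℝ → Matrix (Fin 2) (Fin 2) ℂ}
    {A Q W : Matrix (Fin 2) (Fin 2) ℂ} (S : IsRegularSystem μ A P)
    (hA : ∀ i j, conj (A i j) = A i j) (hQ : ∀ i j, conj (Q i j) = Q i j)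
    (hW : ∀ i j, conj (W i j) = W i j) (hQs : Qᵀ = Q) (hWs : Wᵀ = W)
    (hdet : ∀ l : ℝ, (A + (1 / 2 : ℂ) • (Q - (l : ℂ) • W)).det ≠ 0)
    {k D : Fin 2 → ℂ} (hk : star k = k) (hD : star D = D) (hne : k + (1 / 2 : ℂ) • D ≠ 0)
    (hAD : A *ᵥ D = -(Q *ᵥ k)) (hWk : W *ᵥ k = 0) : W *ᵥ D = 0 := by
  have hswap : ∀ M : Matrix (Fin 2) (Fin 2) ℂ, Mᵀ = M → k ⬝ᵥ (M *ᵥ D) = D ⬝ᵥ (M *ᵥ k) := by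
    intro M hM
    rw [Matrix.dotProduct_mulVec, ← Matrix.mulVec_transpose, hM, dotProduct_comm]
  have hk0 : k ≠ 0 := by
    rintro rfl
    rw [Matrix.mulVec_zero, neg_zero] at hAD
    have hdA : A.det ≠ 0 := by
      obtain ⟨h0, h1, h2⟩ := S.J_apply
      rw [Matrix.det_fin_two, h0, h1, h2]
      simp [S.ne_zero]
    have := Matrix.eq_zero_of_mulVec_eq_zero hdA hAD
    exact hne (by simp [this])
  -- By symmetry kᵀQD = DᵀQk = -DᵀAD = 0, so QD is orthogonal to k and hence a multiple of Ak. In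
  -- the same way WD is a multiple of Ak, because Wk = 0. Reality of k and D makes both factors
  -- real.
  obtain ⟨t, ht⟩ := S.exists_eq_real_smul hA hk (d := Q *ᵥ D)
    (by rw [IsSol.star_mulVec_of_real hQ, hD]) hk0 (by
      rw [hswap Q hQs, ← neg_neg (Q *ᵥ k), ← hAD, dotProduct_neg, S.pairing_self_eq_zero, neg_zero])
  obtain ⟨s, hs⟩ := S.exists_eq_real_smul hA hk (d := W *ᵥ D)
    (by rw [IsSol.star_mulVec_of_real hW, hD]) hk0 (by rw [hswap W hWs, hWk, dotProduct_zero])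
  by_cases hs0 : s = 0
  · rw [hs, hs0]; simp
  exfalso
  -- Using AD + Qk = 0 and Wk = 0, the matrix with parameter l sends k + D/2 to (1 + (t - l s)/4)
  -- Ak. This vanishes at the real value l = (4 + t)/s, which contradicts invertibility.
  refine hne (Matrix.eq_zero_of_mulVec_eq_zero (hdet ((4 + t) / s)) ?_)
  have e : (((4 + t) / s : ℝ) : ℂ) * s = 4 + t := by
    push_cast
    field_simp
  simp only [Matrix.add_mulVec, Matrix.smul_mulVec, Matrix.sub_mulVec, Matrix.mulVec_add,
    Matrix.mulVec_smul, hWk, hs, ht, hAD]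
  ext i
  simp only [Pi.add_apply, Pi.smul_apply, Pi.sub_apply, Pi.neg_apply, smul_eq_mul, Pi.zero_apply]
  linear_combination (-(A *ᵥ k) i / 4) * e

variable {J : Matrix (Fin 2) (Fin 2) ℝ} {q w : Matrix (Fin 2) (Fin 2) OrderZero}

/-- The exceptional points are atoms of the base measure, hence countably many, and none of them is
charged by tr w. -/
lemma ae_atom_or (q w : Matrix (Fin 2) (Fin 2) OrderZero) : ∀ᵐ x ∂traceMeasure w,
    (baseMeasure q w).real {x} = 0 ∨ (traceMeasure w).real {x} ≠ 0 := by
  set s : Set ℝ := {x | (baseMeasure q w).real {x} ≠ 0 ∧ (traceMeasure w).real {x} = 0} with hs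
  have hc : s.Countable := (countable_atoms (baseMeasure q w)).mono fun x hx => hx.1
  have h0 : traceMeasure w s = 0 := by
    rw [← Set.biUnion_of_singleton s, measure_biUnion_null_iff hc]
    intro x hx
    exact (measureReal_eq_zero_iff isCompact_singleton.measure_lt_top.ne).1 hx.2
  filter_upwards [measure_eq_zero_iff_ae_notMem.1 h0] with x hx
  by_contra! h
  exact hx ⟨h.1, h.2⟩

namespace Admissible

variable (H : Admissible J q w)
include H

/-- If a solution of the homogeneous equation with real initial value is annihilated by `w`, then so
are its one-sided limits. -/
lemma density_mulVec_limits {c : Fin 2 → ℂ} (hc : star c = c) (hc0 : c ≠ 0) {x : ℝ}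
    (hx : (traceMeasure w).real {x} ≠ 0)
    (heq : toComplex J *ᵥ (H.isRegularSystem 0).homDensity c x =
      0 - coeff q w 0 x *ᵥ (H.isRegularSystem 0).hom c x)
    (hn : density w x *ᵥ (H.isRegularSystem 0).hom c x = 0) :
    density w x *ᵥ ((baseMeasure q w).real {x} : ℂ) • (H.isRegularSystem 0).homDensity c x = 0 := by
  set S := H.isRegularSystem 0 with hS
  set μ := baseMeasure q w with hμ
  set m : ℂ := (μ.real {x} : ℂ) with hm
  set D := m • S.homDensity c x with hD
  have hkK : S.hom c x + (1 / 2 : ℂ) • D = S.homLim c x := by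
    ext i
    simp only [S.hom_apply, bal, hD, Pi.add_apply, Pi.smul_apply, smul_eq_mul, hm]
    ring
  have hk : star (S.hom c x) = S.hom c x := by
    have := congrFun (S.star_hom (conj_toComplex J) (conj_coeff 0) c) x
    rwa [hc] at this
  have hK : star (S.homLim c x) = S.homLim c x := by
    have := congrFun (S.star_homLim (conj_toComplex J) (conj_coeff 0) c) x
    rwa [hc] at this
  have hDr : star D = D := by
    have e : D = (2 : ℂ) • (S.homLim c x - S.hom c x) := by
      rw [← hkK]; simp [smul_smul]
    rw [e, star_smul, star_sub, hK, hk]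
    simp
  have hmr : conj m = m := Complex.conj_ofReal _
  have hν : m * (traceDensity q w x : ℂ) = ((traceMeasure w).real {x} : ℂ) := by
    rw [← traceDensity_jump (q := q) x, hm]
    push_cast
    ring
  have key := mulVec_jump_eq_zero (A := toComplex J) (Q := m • coeff q w 0 x)
    (W := ((traceMeasure w).real {x} : ℂ) • density w x) S (conj_toComplex J)
    (fun i j => by
      rw [Matrix.smul_apply, smul_eq_mul, map_mul, hmr, conj_coeff])
    (fun i j => by
      rw [Matrix.smul_apply, smul_eq_mul, map_mul, Complex.conj_ofReal, conj_density])
    (by rw [Matrix.transpose_smul, S.symm]) (by rw [Matrix.transpose_smul, density_transpose])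
    (fun l => by
      have h1 := (H.isRegularSystem l).det_ne x
      convert h1 using 3
      ext i j
      simp only [coeff, ← hν, Matrix.smul_apply, Matrix.sub_apply, smul_eq_mul,
        Complex.ofReal_mul, Complex.ofReal_zero]
      ring)
    hk hDr (by rw [hkK]; exact S.homLim_ne_zero hc0 x)
    (by rw [hD, Matrix.mulVec_smul, heq, Matrix.smul_mulVec, zero_sub, smul_neg])
    (by rw [Matrix.smul_mulVec, hn, smul_zero])
  rw [Matrix.smul_mulVec] at key
  exact (smul_eq_zero.1 key).resolve_left (by exact_mod_cast hx)

/-- If some nontrivial solution of the homogeneous equation is annihilated by `w`, then some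
nontrivial solution with real initial value is annihilated by `w`. -/
lemma exists_real_null {c : Fin 2 → ℂ} (hc0 : c ≠ 0) (hn : IsNull w ((H.isRegularSystem 0).hom c)) :
    ∃ d : Fin 2 → ℂ, star d = d ∧ d ≠ 0 ∧ IsNull w ((H.isRegularSystem 0).hom d) := by
  have hs : IsNull w ((H.isRegularSystem 0).hom (star c)) := by
    rw [← (H.isRegularSystem 0).star_hom (conj_toComplex J) (conj_coeff 0)]
    exact hn.star
  have hcomb : ∀ a b : ℂ, IsNull w ((H.isRegularSystem 0).hom (a • c + b • star c)) := by
    intro a b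
    filter_upwards [hn, hs] with x h1 h2
    rw [map_add, map_smul, map_smul, Pi.add_apply, Pi.smul_apply, Pi.smul_apply, Matrix.mulVec_add,
      Matrix.mulVec_smul, Matrix.mulVec_smul, h1, h2]
    simp
  -- The real part of c serves unless it vanishes, in which case the imaginary part does; up to
  -- factors these are c + c̄ and i(c - c̄).
  by_cases h : (1 : ℂ) • c + (1 : ℂ) • star c = 0
  · refine ⟨Complex.I • c + (-Complex.I) • star c, ?_, ?_, hcomb _ _⟩
    · simp [star_add, star_smul, add_comm]
    · intro h0
      apply hc0
      have h1 : (2 * Complex.I) • c = 0 := by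
        have := congrArg (fun v => Complex.I • v) h
        simp only [smul_add, smul_smul, mul_one, smul_zero] at this
        rw [two_mul, add_smul]
        calc Complex.I • c + Complex.I • c = (Complex.I • c + Complex.I • star c) +
              (Complex.I • c + (-Complex.I) • star c) := by rw [neg_smul]; abel
          _ = 0 := by rw [this, h0, add_zero]
      exact (smul_eq_zero.1 h1).resolve_left (by simp)
  · exact ⟨_, by simp [star_add, add_comm], h, hcomb _ _⟩

/-- If `w` annihilates a nontrivial solution of the homogeneous equation, then it annihilates all
square integrable solutions of inhomogeneous equations. -/
theorem isNull_of_exists_null {ω : ℝ} (hω : 0 < ω) (hq : ∀ i j, (q i j).IsPeriod ω)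
    (hw : ∀ i j, (w i j).IsPeriod ω) {c₀ : Fin 2 → ℂ} (hc₀ : c₀ ≠ 0)
    (hn₀ : IsNull w ((H.isRegularSystem 0).hom c₀)) {f U h : ℝ → Fin 2 → ℂ}
    (hU : IsSolution J q w f U h) (hu : bal (baseMeasure q w) U h ∈ sqIntegrable w) :
    IsNull w (bal (baseMeasure q w) U h) := by
  obtain ⟨c, hc, hc0, hn⟩ := H.exists_real_null hc₀ hn₀
  set S := H.isRegularSystem 0 with hS
  set κ := c ⬝ᵥ (toComplex J *ᵥ U 0) with hκ
  -- Lagrange's identity against the annihilated solution k has no source term: k solves the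
  -- homogeneous equation, and kᵀ w f = 0 because w k = 0.
  have hpair : ∀ x, S.homLim c x ⬝ᵥ (toComplex J *ᵥ U x) = κ := by
    intro x
    rw [hκ]
    conv_rhs => rw [← S.homLim_zero c]
    refine (IsSol.lagrange S hU (H.isSolution_hom c)).eq_of_zero ?_ x 0
    have h1 : ∀ᵐ x ∂traceMeasure w, S.hom c x ⬝ᵥ (density w x *ᵥ f x) = 0 := by
      filter_upwards [hn] with x hx
      rw [Matrix.dotProduct_mulVec, ← Matrix.mulVec_transpose, density_transpose, hx,
        zero_dotProduct]
    filter_upwards [ae_base_of_ae_trace h1] with x hx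
    rw [rhs_zero, ← S.hom_apply]
    simp only [rhs, dotProduct_smul, Pi.zero_apply, zero_dotProduct, sub_zero, smul_eq_mul]
    rcases hx with hx | hx
    · rw [hx, Complex.ofReal_zero, zero_mul]
    · rw [hx, mul_zero]
  -- A homogeneous solution with constant pairing 1 against k; subtracting κ times it from U makes
  -- the pairing of the remainder Z with k zero.
  obtain ⟨d, hd⟩ := S.exists_pairing_eq_one hc0
  have hpd : ∀ x, S.homLim c x ⬝ᵥ (toComplex J *ᵥ S.homLim d x) = 1 := by
    intro x
    rw [S.wronskian_const (S.isSol_hom d) (S.isSol_hom c) x 0, S.homLim_zero, S.homLim_zero, hd]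
  set Z := U - κ • S.homLim d with hZ
  set k := h - κ • S.homDensity d with hk
  have hZs : ∀ j, IsPrimitive (baseMeasure q w) (fun x => Z x j) (fun x => k x j) :=
    (hU.sub ((H.isSolution_hom d).smul κ)).prim
  have hpZ : ∀ x, S.homLim c x ⬝ᵥ (toComplex J *ᵥ Z x) = 0 := by
    intro x
    rw [hZ, Pi.sub_apply, Pi.smul_apply, Matrix.mulVec_sub, Matrix.mulVec_smul, dotProduct_sub,
      dotProduct_smul, hpair, hpd, smul_eq_mul, mul_one, sub_self]
  have hbal : bal (baseMeasure q w) Z k = bal (baseMeasure q w) U h - κ • S.hom d := by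
    ext x j
    simp only [hZ, hk, bal, S.hom_apply, Pi.sub_apply, Pi.smul_apply, smul_eq_mul]
    ring
  have hpl : ∀ x, (S.homLim c x - ((baseMeasure q w).real {x} : ℂ) • S.homDensity c x) ⬝ᵥ
      (toComplex J *ᵥ (Z x - ((baseMeasure q w).real {x} : ℂ) • k x)) = 0 := by
    intro x
    have t1 := tendsto_pi_nhds.2 fun j => ((S.isSol_hom c).prim j).tendsto_left x
    have t2 := tendsto_pi_nhds.2 fun j => (hZs j).tendsto_left x
    have hcont : Continuous fun p : (Fin 2 → ℂ) × (Fin 2 → ℂ) =>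
        p.1 ⬝ᵥ (toComplex J *ᵥ p.2) := by fun_prop
    have t3 := (hcont.tendsto _).comp (t1.prodMk_nhds t2)
    simp only [Function.comp_def, hpZ] at t3
    exact (tendsto_nhds_unique t3 tendsto_const_nhds)
  -- Zero pairing makes each one-sided limit of Z a multiple of the corresponding limit of k. The
  -- two factors may differ at an atom, so it is essential that w annihilates both limits of k and
  -- not just their mean.
  have hz : IsNull w (bal (baseMeasure q w) Z k) := by
    have heq := (Measure.absolutelyContinuous_of_le (traceMeasure_le q w)).ae_le
      (S.isSol_hom c).eqn
    filter_upwards [hn, ae_atom_or q w, heq] with x hx hat hex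
    obtain ⟨α, hα⟩ := S.exists_eq_smul_of_pairing_eq_zero (S.homLim_ne_zero hc0 x) (hpZ x)
    rcases hat with hat | hat
    · have e1 : S.hom c x = S.homLim c x := by
        ext j; simp [S.hom_apply, bal, hat]
      have e2 : bal (baseMeasure q w) Z k x = Z x := by
        ext j; simp [bal, hat]
      rw [e2, hα, ← e1, Matrix.mulVec_smul, hx, smul_zero]
    · have hD := H.density_mulVec_limits hc hc0 hat hex hx
      set m : ℂ := ((baseMeasure q w).real {x} : ℂ) with hm
      have e1 : S.homLim c x = S.hom c x + (1 / 2 : ℂ) • m • S.homDensity c x := by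
        ext j; simp only [S.hom_apply, bal, Pi.add_apply, Pi.smul_apply, smul_eq_mul, hm]; ring
      have e2 : S.homLim c x - m • S.homDensity c x =
          S.hom c x - (1 / 2 : ℂ) • m • S.homDensity c x := by
        ext j
        simp only [S.hom_apply, bal, Pi.sub_apply, Pi.smul_apply, smul_eq_mul, hm]; ring
      have hne : S.homLim c x - m • S.homDensity c x ≠ 0 := by
        refine S.sub_jump_ne_zero (S.homLim_ne_zero hc0 x) ?_
        rw [hex, Pi.zero_apply, zero_sub]
        rfl
      obtain ⟨β, hβ⟩ := S.exists_eq_smul_of_pairing_eq_zero hne (hpl x)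
      have e3 : bal (baseMeasure q w) Z k x = (1 / 2 : ℂ) • (Z x + (Z x - m • k x)) := by
        ext j
        simp only [bal, Pi.add_apply, Pi.sub_apply, Pi.smul_apply, smul_eq_mul, hm]; ring
      rw [e3, hβ, hα, e2, e1]
      simp only [Matrix.mulVec_smul, Matrix.mulVec_add, Matrix.mulVec_sub, hx, hD, smul_zero,
        add_zero, sub_zero]
  rw [hbal] at hz
  -- Modulo w-null functions the solution with initial value d equals u / κ, so it is square
  -- integrable and therefore null.
  have hd0 : κ ≠ 0 → IsNull w (S.hom d) := by
    intro hκ0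
    refine H.isNull_of_hom hω hq hw 0 d ?_
    refine mem_sqIntegrable_congr ((sqIntegrable w).smul_mem κ⁻¹ hu)
      (aemeasurable_of_bv (H.bv_hom 0 d) _) ?_
    filter_upwards [hz] with x hx
    rw [Pi.sub_apply, Matrix.mulVec_sub, sub_eq_zero, Pi.smul_apply, Matrix.mulVec_smul] at hx
    rw [Pi.smul_apply, Matrix.mulVec_smul, hx, smul_smul, inv_mul_cancel₀ hκ0, one_smul]
  by_cases hκ0 : κ = 0
  · simpa [hκ0] using hz
  · filter_upwards [hz, hd0 hκ0] with x hx hdx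
    rw [Pi.sub_apply, Matrix.mulVec_sub, sub_eq_zero, Pi.smul_apply, Matrix.mulVec_smul] at hx
    rw [hx, hdx, smul_zero]

end Admissible

end DistributionalSystem

namespace DistributionalSystem

open scoped ENNReal

/-! ### Boundary values and symmetry -/

/-- Evaluation at x is a linear map of initial values that is injective by uniqueness, hence
surjective. It moves the initial point from 0 to x. -/
lemma IsRegularSystem.exists_homLim_eq {μ : Measure ℝ} [IsLocallyFiniteMeasure μ]
    {A : Matrix (Fin 2) (Fin 2) ℂ} {Q : ℝ → Matrix (Fin 2) (Fin 2) ℂ} (S : IsRegularSystem μ A Q)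
    (x : ℝ) (d : Fin 2 → ℂ) : ∃ c, S.homLim c x = d := by
  let F : (Fin 2 → ℂ) →ₗ[ℂ] (Fin 2 → ℂ) :=
    { toFun := fun c => S.homLim c x
      map_add' := fun c e => by
        have h := (S.isSol_hom c).add (S.isSol_hom e)
        rw [add_zero] at h
        have := congrFun (S.eq_homLim h) x
        rwa [Pi.add_apply, Pi.add_apply, S.homLim_zero, S.homLim_zero, eq_comm] at this
      map_smul' := fun a c => by
        have h := (S.isSol_hom c).smul a
        rw [smul_zero] at h
        have := congrFun (S.eq_homLim h) x
        rwa [Pi.smul_apply, Pi.smul_apply, S.homLim_zero, eq_comm] at this }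
  refine LinearMap.injective_iff_surjective.1 ((injective_iff_map_eq_zero F).2 fun c hc => ?_) d
  by_contra h
  exact S.homLim_ne_zero h x hc

variable {J : Matrix (Fin 2) (Fin 2) ℝ} {q w : Matrix (Fin 2) (Fin 2) OrderZero}

lemma pairing_star_left (f g : ℝ → Fin 2 → ℂ) (x : ℝ) :
    pairing w (star f) g x = pairing w (star g) f x := by
  rw [← pairing_star_star, star_star]

namespace Admissible

variable (H : Admissible J q w)
include H

lemma exists_isSolution {f : ℝ → Fin 2 → ℂ} (hf : f ∈ sqIntegrable w) (x : ℝ) (d : Fin 2 → ℂ) :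
    ∃ U h, IsSolution J q w f U h ∧ U x = d := by
  set S := H.isRegularSystem 0
  obtain ⟨U, h, hU, -⟩ := S.exists_isSol (locallyIntegrable_rhs (q := q) hf) 0
  obtain ⟨c, hc⟩ := S.exists_homLim_eq x (d - U x)
  refine ⟨_, _, by simpa using IsSolution.add hU (H.isSolution_hom c), ?_⟩
  rw [Pi.add_apply, hc, add_sub_cancel]

/-! ### Intervals of definiteness and boundary values. -/

/-- No nontrivial solution of the homogeneous equation is annihilated by `w` on `(a, b]`. -/
def IsDefiniteOn (a b : ℝ) : Prop :=
  ∀ c, (∀ᵐ x ∂traceMeasure w, x ∈ Set.Ioc a b →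
    density w x *ᵥ (H.isRegularSystem 0).hom c x = 0) → c = 0

/-- Solutions of the homogeneous equation, truncated to an interval. -/
def homTrunc (a b : ℝ) : (Fin 2 → ℂ) →ₗ[ℂ] PreL2 w where
  toFun c := mkPre ((Set.Ioc a b).indicator ((H.isRegularSystem 0).hom c))
    (indicator_mem_of_bv (H.bv_hom 0 c) a b)
  map_add' c d := Subtype.ext (by
    change (Set.Ioc a b).indicator _ = (Set.Ioc a b).indicator _ + (Set.Ioc a b).indicator _
    rw [map_add, Set.indicator_add'])
  map_smul' t c := Subtype.ext (by
    change (Set.Ioc a b).indicator _ = t • (Set.Ioc a b).indicator _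
    rw [map_smul]
    ext1 x
    by_cases hx : x ∈ Set.Ioc a b <;> simp [hx])

lemma homTrunc_toFun (a b : ℝ) (c : Fin 2 → ℂ) :
    (H.homTrunc a b c).toFun = (Set.Ioc a b).indicator ((H.isRegularSystem 0).hom c) := rfl

lemma inner_homTrunc (a b : ℝ) (c : Fin 2 → ℂ) (f : PreL2 w) :
    inner ℂ (H.homTrunc a b c) f =
      ∫ x in Set.Ioc a b, pairing w ((H.isRegularSystem 0).hom c) f.toFun x ∂traceMeasure w := by
  rw [← integral_indicator measurableSet_Ioc, ← pairing_indicator]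
  rfl

lemma star_hom_single (i : Fin 2) : star ((H.isRegularSystem 0).hom (Pi.single i 1)) =
    (H.isRegularSystem 0).hom (Pi.single i 1) := by
  rw [(H.isRegularSystem 0).star_hom (conj_toComplex J) (conj_coeff 0), Pi.star_single, star_one]

-- Definiteness says that the Gram matrix of the truncated fundamental solutions has trivial kernel,
-- so every pair of inner products is attained.
variable {H} in
lemma IsDefiniteOn.exists_inner_eq {a b : ℝ} (hd : H.IsDefiniteOn a b) (y : Fin 2 → ℂ) :
    ∃ c, ∀ i, inner ℂ (H.homTrunc a b (Pi.single i 1)) (H.homTrunc a b c) = y i := by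
  let A : (Fin 2 → ℂ) →ₗ[ℂ] (Fin 2 → ℂ) :=
    { toFun := fun c i => inner ℂ (H.homTrunc a b (Pi.single i 1)) (H.homTrunc a b c)
      map_add' := fun c d => by ext i; simp [inner_add_right]
      map_smul' := fun t c => by ext i; simp [inner_smul_right] }
  suffices hA : Function.Surjective A by
    obtain ⟨c, hc⟩ := hA y
    exact ⟨c, congrFun hc⟩
  refine LinearMap.injective_iff_surjective.1 ((injective_iff_map_eq_zero A).2 fun c hc => hd c ?_)
  have h0 : ∀ i, inner ℂ (H.homTrunc a b (Pi.single i 1)) (H.homTrunc a b c) = 0 := congrFun hc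
  have h1 : inner ℂ (H.homTrunc a b c) (H.homTrunc a b c) = 0 := by
    have e : c = c 0 • (Pi.single 0 1 : Fin 2 → ℂ) + c 1 • (Pi.single 1 1 : Fin 2 → ℂ) := by
      ext i; fin_cases i <;> simp
    conv_lhs => enter [2]; rw [e]
    rw [map_add, map_smul, map_smul, inner_add_left, inner_smul_left, inner_smul_left, h0, h0]
    simp
  filter_upwards [isNull_of_integral_eq_zero (H.homTrunc a b c).toFun_mem h1] with x hx hxs
  rwa [homTrunc_toFun, Set.indicator_of_mem hxs] at hx

lemma eq_of_pairing_hom_eq {a : ℝ} {d e : Fin 2 → ℂ}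
    (h : ∀ i, (H.isRegularSystem 0).homLim (Pi.single i 1) a ⬝ᵥ (toComplex J *ᵥ d) =
      (H.isRegularSystem 0).homLim (Pi.single i 1) a ⬝ᵥ (toComplex J *ᵥ e)) : d = e := by
  set S := H.isRegularSystem 0
  have hne : S.homLim (Pi.single 1 1) a ⬝ᵥ (toComplex J *ᵥ S.homLim (Pi.single 0 1) a) ≠ 0 := by
    rw [S.wronskian_const (S.isSol_hom _) (S.isSol_hom _) a 0, S.homLim_zero, S.homLim_zero]
    exact S.basis_pairing
  refine sub_eq_zero.1 (S.eq_zero_of_pairing hne ?_ ?_)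
  · rw [Matrix.mulVec_sub, dotProduct_sub, h, sub_self]
  · rw [Matrix.mulVec_sub, dotProduct_sub, h, sub_self]

lemma lagrange_hom {f U h : ℝ → Fin 2 → ℂ} (hU : IsSolution J q w f U h) (i : Fin 2) {a b : ℝ}
    (hab : a ≤ b) : (H.isRegularSystem 0).homLim (Pi.single i 1) b ⬝ᵥ (toComplex J *ᵥ U b) -
      (H.isRegularSystem 0).homLim (Pi.single i 1) a ⬝ᵥ (toComplex J *ᵥ U a) =
      ∫ x in Set.Ioc a b, pairing w ((H.isRegularSystem 0).hom (Pi.single i 1)) f x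
        ∂traceMeasure w := by
  rw [H.lagrange hU (H.isSolution_hom _) hab, ← (H.isRegularSystem 0).hom_apply, H.star_hom_single]
  congr 1
  ext x
  simp [pairing]

variable {H} in
/-- On an interval of definiteness every boundary value at the left endpoint is attained by a
solution which vanishes at the right endpoint. -/
lemma IsDefiniteOn.exists_isSolution {a b : ℝ} (hd : H.IsDefiniteOn a b) (hab : a ≤ b)
    (e : Fin 2 → ℂ) : ∃ r P p, r ∈ sqIntegrable w ∧ IsSolution J q w r P p ∧
      (∀ x, x ∉ Set.Ioc a b → r x = 0) ∧ P b = 0 ∧ P a = e := by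
  -- With P(b) = 0, Lagrange's identity on (a, b] equates these inner products with minus the
  -- pairings of the fundamental solutions with P(a). The right-hand side is chosen to make the
  -- pairings those of e, and they determine P(a).
  obtain ⟨c, hc⟩ := hd.exists_inner_eq
    fun i => -((H.isRegularSystem 0).homLim (Pi.single i 1) a ⬝ᵥ (toComplex J *ᵥ e))
  have hr := (H.homTrunc a b c).toFun_mem
  obtain ⟨P, p, hP, hb⟩ := H.exists_isSolution hr b 0
  refine ⟨_, P, p, hr, hP, fun x hx => Set.indicator_of_notMem hx _, hb,
    H.eq_of_pairing_hom_eq (a := a) fun i => ?_⟩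
  have h1 := H.lagrange_hom hP i hab
  rw [← inner_homTrunc H, hc, hb, Matrix.mulVec_zero, dotProduct_zero, zero_sub, neg_inj] at h1
  exact h1

variable {H} in
/-- If the equation is definite on some interval, then the solutions in the maximal relation tend to
zero along periods. -/
theorem IsDefiniteOn.tendsto_zero {a b : ℝ} (hd : H.IsDefiniteOn a b) (hab : a ≤ b) {τ : ℕ → ℝ}
    (hq : ∀ n i j, (q i j).IsPeriod (τ n)) (hw : ∀ n i j, (w i j).IsPeriod (τ n))
    (hlim : Tendsto (fun n => |τ n|) atTop atTop) {f U h : ℝ → Fin 2 → ℂ}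
    (hU : IsSolution J q w f U h) (hu : bal (baseMeasure q w) U h ∈ sqIntegrable w)
    (hf : f ∈ sqIntegrable w) : Tendsto (fun n => U (a + τ n)) atTop (𝓝 0) := by
  -- Lagrange's identity on (a, b] for a translate of u and the solution P with P(b) = 0, P(a) = e
  -- expresses -eᵀJU(a + τ) through pairings of fixed elements with translates of f and u, which
  -- tend to zero.
  have key : ∀ e : Fin 2 → ℂ,
      Tendsto (fun n => e ⬝ᵥ (toComplex J *ᵥ U (a + τ n))) atTop (𝓝 0) := by
    intro e
    obtain ⟨r, P, p, hr, hP, hr0, hPb, hPa⟩ := hd.exists_isSolution hab e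
    have hbv := bv_star (bv_bal hP.prim)
    have t1 := tendsto_integral_pairing_comp_add hw hlim
      (indicator_mem_of_bv (w := w) hbv a b) hf
    have t2 := tendsto_integral_pairing_comp_add hw hlim (star_mem_sqIntegrable hr) hu
    have t3 := t2.sub t1
    rw [sub_zero] at t3
    refine t3.congr fun n => ?_
    have hUn := hU.comp_add (hq n) (hw n)
    have hb := bal_comp_add (measurePreserving_baseMeasure (hq n) (hw n)) U h
    have h1 := H.lagrange hUn hP hab
    rw [hPb, hPa, zero_dotProduct, zero_sub, hb] at h1
    have i1 := integrableOn_pairing_of_bv hbv (comp_add_mem_sqIntegrable (hw n) hf) a b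
    have i2 := (integrable_pairing w (star_mem_sqIntegrable (comp_add_mem_sqIntegrable (hw n) hu))
      hr).integrableOn (s := Set.Ioc a b)
    rw [integral_sub i1 i2, setIntegral_eq_integral_of_forall_compl_eq_zero (f := pairing w _ r)
      (fun x hx => by simp [pairing, hr0 x hx])] at h1
    simp only [pairing_star_left _ r] at h1
    rw [pairing_indicator, integral_indicator measurableSet_Ioc]
    linear_combination h1
  obtain ⟨h0, h1, h2⟩ := (H.isRegularSystem 0).J_apply
  have hj := (H.isRegularSystem 0).ne_zero
  refine tendsto_pi_nhds.2 fun i => ?_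
  fin_cases i
  · have := (key (Pi.single 1 1)).const_mul (toComplex J 1 0)⁻¹
    simpa [mulVec_fin_two, h1, hj] using this
  · have := (key (Pi.single 0 1)).const_mul (-(toComplex J 1 0)⁻¹)
    simpa [mulVec_fin_two, h0, h2, hj] using this

/-- The initial values of the solutions of the homogeneous equation which are annihilated by `w`
on `s`. -/
def nullOn (s : Set ℝ) : Submodule ℂ (Fin 2 → ℂ) where
  carrier := {c | ∀ᵐ x ∂traceMeasure w, x ∈ s →
    density w x *ᵥ (H.isRegularSystem 0).hom c x = 0}
  zero_mem' := by simp
  add_mem' {c d} hc hd := by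
    rw [Set.mem_ofPred_eq] at hc hd ⊢
    filter_upwards [hc, hd] with x h1 h2 hx
    rw [map_add, Pi.add_apply, Matrix.mulVec_add, h1 hx, h2 hx, add_zero]
  smul_mem' t c hc := by
    rw [Set.mem_ofPred_eq] at hc ⊢
    filter_upwards [hc] with x h1 hx
    rw [map_smul, Pi.smul_apply, Matrix.mulVec_smul, h1 hx, smul_zero]

lemma mem_nullOn {s : Set ℝ} {c : Fin 2 → ℂ} : c ∈ H.nullOn s ↔ ∀ᵐ x ∂traceMeasure w, x ∈ s →
    density w x *ᵥ (H.isRegularSystem 0).hom c x = 0 := Iff.rfl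

lemma nullOn_anti {s t : Set ℝ} (h : s ⊆ t) : H.nullOn t ≤ H.nullOn s := by
  intro c hc
  rw [mem_nullOn] at hc ⊢
  exact hc.mono fun x hx hxs => hx (h hxs)

/-- Either some nontrivial solution of the homogeneous equation is annihilated by `w`, or the
equation is definite on a large interval. -/
lemma exists_isDefiniteOn {ω : ℝ} (hω : 0 < ω)
    (hn : ∀ c, c ≠ 0 → ¬ IsNull w ((H.isRegularSystem 0).hom c)) :
    ∃ n : ℕ, H.IsDefiniteOn (-(n * ω)) (n * ω) := by
  have hanti : Antitone fun n : ℕ => H.nullOn (Set.Ioc (-(n * ω)) (n * ω)) := by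
    intro m n hmn
    have hle : (m : ℝ) * ω ≤ n * ω := by gcongr
    exact H.nullOn_anti (Set.Ioc_subset_Ioc (neg_le_neg hle) hle)
  -- The annihilated subspaces of ℂ² decrease as the interval grows and so become stationary. An
  -- element of the final subspace is annihilated on the whole line and is zero by hypothesis.
  obtain ⟨n, hN⟩ := IsArtinian.monotone_stabilizes
    (⟨fun n => OrderDual.toDual (H.nullOn (Set.Ioc (-(n * ω)) (n * ω))), hanti⟩ :
      ℕ →o (Submodule ℂ (Fin 2 → ℂ))ᵒᵈ)
  refine ⟨n, fun c hc => ?_⟩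
  by_contra hc0
  refine hn c hc0 ?_
  have h1 : ∀ m : ℕ, c ∈ H.nullOn (Set.Ioc (-(m * ω)) (m * ω)) := by
    intro m
    rcases le_total n m with hnm | hnm
    · have e : H.nullOn (Set.Ioc (-(n * ω)) (n * ω)) = H.nullOn (Set.Ioc (-(m * ω)) (m * ω)) :=
        hN m hnm
      rw [← e]
      exact hc
    · exact hanti hnm hc
  simp only [mem_nullOn] at h1
  filter_upwards [ae_all_iff.2 h1] with x hx
  obtain ⟨m, hm⟩ := exists_nat_gt (|x| / ω)
  rw [div_lt_iff₀ hω] at hm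
  have := abs_lt.1 hm
  exact hx m ⟨this.1, this.2.le⟩

/-- The maximal relation is symmetric. -/
theorem integral_pairing_eq {ω : ℝ} (hω : 0 < ω) (hq : ∀ i j, (q i j).IsPeriod ω)
    (hw : ∀ i j, (w i j).IsPeriod ω) {f g U h V k : ℝ → Fin 2 → ℂ}
    (hU : IsSolution J q w f U h) (hV : IsSolution J q w g V k)
    (hu : bal (baseMeasure q w) U h ∈ sqIntegrable w)
    (hv : bal (baseMeasure q w) V k ∈ sqIntegrable w) (hf : f ∈ sqIntegrable w)
    (hg : g ∈ sqIntegrable w) :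
    ∫ x, pairing w (bal (baseMeasure q w) V k) f x ∂traceMeasure w =
      ∫ x, pairing w g (bal (baseMeasure q w) U h) x ∂traceMeasure w := by
  by_cases hn : ∃ c, c ≠ 0 ∧ IsNull w ((H.isRegularSystem 0).hom c)
  · obtain ⟨c, hc0, hc⟩ := hn
    rw [integral_eq_zero_of_ae ((H.isNull_of_exists_null hω hq hw hc0 hc hV hv).mono
        fun x hx => pairing_eq_zero_left hx),
      integral_eq_zero_of_ae ((H.isNull_of_exists_null hω hq hw hc0 hc hU hu).mono
        fun x hx => pairing_eq_zero_right hx)]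
  push Not at hn
  obtain ⟨m, hd⟩ := H.exists_isDefiniteOn hω hn
  have hm : -((m : ℝ) * ω) ≤ m * ω := by
    have : 0 ≤ (m : ℝ) * ω := by positivity
    linarith
  have hlim : Tendsto (fun n : ℕ => (n : ℝ) * ω) atTop atTop :=
    tendsto_natCast_atTop_atTop.atTop_mul_const hω
  have hlim1 : Tendsto (fun n : ℕ => |(n : ℝ) * ω|) atTop atTop := tendsto_abs_atTop_atTop.comp hlim
  have hlim2 : Tendsto (fun n : ℕ => |-((n : ℝ) * ω)|) atTop atTop := by simpa only [abs_neg]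
  -- Lagrange's identity is bilinear whereas the inner product is sesquilinear, so the conjugate of
  -- V enters; it is a solution because the coefficients are real.
  have hVs := hV.star
  have hvs : bal (baseMeasure q w) (star V) (star k) ∈ sqIntegrable w := by
    rw [bal_conj]; exact star_mem_sqIntegrable hv
  have hgs := star_mem_sqIntegrable hg
  have qp := fun n : ℕ => fun i j => (hq i j).nat_mul n
  have wp := fun n : ℕ => fun i j => (hw i j).nat_mul n
  have qn := fun n : ℕ => fun i j => ((hq i j).nat_mul n).neg
  have wn := fun n : ℕ => fun i j => ((hw i j).nat_mul n).neg
  have a1 := hd.tendsto_zero hm qp wp hlim1 hU hu hf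
  have a2 := hd.tendsto_zero hm qn wn hlim2 hU hu hf
  have b1 := hd.tendsto_zero hm qp wp hlim1 hVs hvs hgs
  have b2 := hd.tendsto_zero hm qn wn hlim2 hVs hvs hgs
  have hcont : Continuous fun p : (Fin 2 → ℂ) × (Fin 2 → ℂ) =>
      p.1 ⬝ᵥ (toComplex J *ᵥ p.2) := by fun_prop
  have t1 := (hcont.tendsto _).comp (b1.prodMk_nhds a1)
  have t2 := (hcont.tendsto _).comp (b2.prodMk_nhds a2)
  have t3 := t1.sub t2
  simp only [Matrix.mulVec_zero, dotProduct_zero, sub_zero, Function.comp_def] at t3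
  have hi : Integrable (fun x => pairing w (bal (baseMeasure q w) V k) f x -
      pairing w g (bal (baseMeasure q w) U h) x) (traceMeasure w) :=
    (integrable_pairing w hv hf).sub (integrable_pairing w hg hu)
  -- The intervals have endpoints -mω ± nω, the translates of the left endpoint of the definite
  -- interval, where the boundary terms are known to vanish in the limit.
  have t4 : Tendsto (fun n : ℕ => ∫ x in Set.Ioc (-((m : ℝ) * ω) + -(n * ω)) (-((m : ℝ) * ω) + n * ω),
      (pairing w (bal (baseMeasure q w) V k) f x -
      pairing w g (bal (baseMeasure q w) U h) x) ∂traceMeasure w) atTop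
      (𝓝 (∫ x, (pairing w (bal (baseMeasure q w) V k) f x -
      pairing w g (bal (baseMeasure q w) U h) x) ∂traceMeasure w)) := by
    have hcov : AECover (traceMeasure w) atTop
        fun n : ℕ => Set.Ioc (-((m : ℝ) * ω) + -(n * ω)) (-((m : ℝ) * ω) + n * ω) :=
      aecover_Ioc (tendsto_atBot_add_const_left _ _ (tendsto_neg_atTop_atBot.comp hlim))
        (tendsto_atTop_add_const_left _ _ hlim)
    exact hcov.integral_tendsto_of_countably_generated hi
  have t5 := tendsto_nhds_unique (t4.congr fun n => ?_) t3
  · rw [integral_sub (integrable_pairing w hv hf) (integrable_pairing w hg hu)] at t5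
    exact sub_eq_zero.1 t5
  · have hn : 0 ≤ (n : ℝ) * ω := by positivity
    rw [H.lagrange hU hVs (by linarith), bal_conj, star_star]
    simp only [pairing_star_star]

end Admissible

end DistributionalSystem

namespace DistributionalSystem

open scoped ENNReal

/-! ### The adjoint -/

variable {J : Matrix (Fin 2) (Fin 2) ℝ} {q w : Matrix (Fin 2) (Fin 2) OrderZero}

/-- The elements of `𝓛²(w)` which vanish outside a bounded interval. -/
def boundedSupport (w : Matrix (Fin 2) (Fin 2) OrderZero) : Submodule ℂ (ℝ → Fin 2 → ℂ) where
  carrier := {f | f ∈ sqIntegrable w ∧ ∃ n : ℕ, ∀ x, x ∉ Set.Ioc (-(n : ℝ)) n → f x = 0}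
  zero_mem' := ⟨zero_mem _, 0, fun _ _ => rfl⟩
  add_mem' := by
    rintro f g ⟨hf, m, hm⟩ ⟨hg, n, hn⟩
    refine ⟨add_mem hf hg, max m n, fun x hx => ?_⟩
    push_cast at hx
    rw [Pi.add_apply, hm, hn, add_zero]
    · exact fun h => hx ⟨(neg_le_neg (le_max_right _ _)).trans_lt h.1, h.2.trans (le_max_right _ _)⟩
    · exact fun h => hx ⟨(neg_le_neg (le_max_left _ _)).trans_lt h.1, h.2.trans (le_max_left _ _)⟩
  smul_mem' := by
    rintro c f ⟨hf, m, hm⟩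
    refine ⟨Submodule.smul_mem _ c hf, m, fun x hx => ?_⟩
    rw [Pi.smul_apply, hm x hx, smul_zero]

/-- `d` is locally square integrable. -/
def IsLocallySqIntegrable (w : Matrix (Fin 2) (Fin 2) OrderZero) (d : ℝ → Fin 2 → ℂ) : Prop :=
  ∀ n : ℕ, (Set.Ioc (-(n : ℝ)) n).indicator d ∈ sqIntegrable w

namespace IsLocallySqIntegrable

variable {d e : ℝ → Fin 2 → ℂ}

lemma of_mem (hd : d ∈ sqIntegrable w) : IsLocallySqIntegrable w d := fun _ =>
  indicator_mem_sqIntegrable hd measurableSet_Ioc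

lemma of_bv (hd : LocallyBoundedVariationOn d Set.univ) : IsLocallySqIntegrable w d := fun _ =>
  indicator_mem_of_bv hd _ _

lemma sub (hd : IsLocallySqIntegrable w d) (he : IsLocallySqIntegrable w e) :
    IsLocallySqIntegrable w (d - e) := fun n => by
  rw [Set.indicator_sub']
  exact sub_mem (hd n) (he n)

lemma integrable (hd : IsLocallySqIntegrable w d) {f : ℝ → Fin 2 → ℂ} (hf : f ∈ boundedSupport w) :
    Integrable (pairing w d f) (traceMeasure w) := by
  obtain ⟨hf, n, hn⟩ := hf
  refine (integrable_pairing w (hd n) hf).congr (ae_of_all _ fun x => ?_)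
  by_cases hx : x ∈ Set.Ioc (-(n : ℝ)) n
  · rw [pairing_indicator, Set.indicator_of_mem hx]
  · simp [pairing, hn x hx]

/-- The functional `f ↦ ∫ d* w f`. -/
def functional (hd : IsLocallySqIntegrable w d) : boundedSupport w →ₗ[ℂ] ℂ where
  toFun f := ∫ x, pairing w d f x ∂traceMeasure w
  map_add' f g := by
    rw [← integral_add (hd.integrable f.2) (hd.integrable g.2)]
    simp only [Submodule.coe_add, pairing_add_right]
  map_smul' c f := by
    rw [RingHom.id_apply, smul_eq_mul, ← integral_const_mul]
    simp only [Submodule.coe_smul, pairing_smul_right]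

lemma functional_apply (hd : IsLocallySqIntegrable w d) (f : boundedSupport w) :
    hd.functional f = ∫ x, pairing w d f x ∂traceMeasure w := rfl

/-- Each truncation of d is itself an admissible test element, so its norm is zero. -/
lemma isNull (hd : IsLocallySqIntegrable w d)
    (h : ∀ f ∈ boundedSupport w, ∫ x, pairing w d f x ∂traceMeasure w = 0) : IsNull w d := by
  have h1 : ∀ n : ℕ, IsNull w ((Set.Ioc (-(n : ℝ)) n).indicator d) := by
    intro n
    refine isNull_of_integral_eq_zero (hd n) ?_
    rw [← h _ ⟨hd n, n, fun x hx => Set.indicator_of_notMem hx _⟩]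
    rw [pairing_indicator_self, pairing_indicator']
  filter_upwards [ae_all_iff.2 h1] with x hx
  obtain ⟨n, hn⟩ := exists_nat_gt |x|
  have hxn := abs_lt.1 hn
  have := hx n
  rwa [Set.indicator_of_mem (show x ∈ Set.Ioc (-(n : ℝ)) n from ⟨hxn.1, hxn.2.le⟩)] at this

end IsLocallySqIntegrable

lemma IsSolution.mem_preTmax {f U h : ℝ → Fin 2 → ℂ} (hU : IsSolution J q w f U h)
    (hu : bal (baseMeasure q w) U h ∈ sqIntegrable w) (hf : f ∈ sqIntegrable w) :
    (mkPre _ hu, mkPre _ hf) ∈ preTmax J q w :=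
  ⟨bv_bal hU.prim, isBalanced_bal hU.prim, IsSol.solves hU⟩

namespace Admissible

variable (H : Admissible J q w)
include H

/-- If `f` has bounded support and is orthogonal to all solutions of the homogeneous equation, then
there is a solution of `J u' + q u = w f` with bounded support. -/
lemma exists_isSolution_bounded {f : ℝ → Fin 2 → ℂ} (hf : f ∈ sqIntegrable w) {n : ℕ}
    (hn : ∀ x, x ∉ Set.Ioc (-(n : ℝ)) n → f x = 0)
    (ho : ∀ i, ∫ x, pairing w ((H.isRegularSystem 0).hom (Pi.single i 1)) f x
      ∂traceMeasure w = 0) :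
    ∃ U h, IsSolution J q w f U h ∧ U (-n) = 0 ∧ U n = 0 ∧
      ∀ x, x ∉ Set.Ioc (-(n : ℝ)) n → bal (baseMeasure q w) U h x = 0 := by
  obtain ⟨U, h, hU, h0⟩ := H.exists_isSolution hf (-n) 0
  have hnn : -(n : ℝ) ≤ n := by
    have : (0 : ℝ) ≤ n := by positivity
    linarith
  have hz : ∀ {a b : ℝ}, (∀ x ∈ Set.Ioc a b, x ∉ Set.Ioc (-(n : ℝ)) n) → ∀ i,
      ∫ x in Set.Ioc a b, pairing w ((H.isRegularSystem 0).hom (Pi.single i 1)) f x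
        ∂traceMeasure w = 0 := by
    intro a b hab i
    refine setIntegral_eq_zero_of_forall_eq_zero fun x hx => ?_
    simp [pairing, hn x (hab x hx)]
  -- Orthogonality of f to the fundamental solutions makes their pairings with U vanish at n as they
  -- do at -n. Outside (-n, n] there is no source, so U stays zero.
  have hUn : U n = 0 := H.eq_of_pairing_hom_eq (a := n) fun i => by
    have h1 := H.lagrange_hom hU i hnn
    rw [setIntegral_eq_integral_of_forall_compl_eq_zero
      (fun x hx => by simp [pairing, hn x hx]), ho, h0] at h1
    simpa using h1
  have hright : ∀ x, (n : ℝ) ≤ x → U x = 0 := fun x hx =>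
    H.eq_of_pairing_hom_eq (a := x) fun i => by
      have h1 := H.lagrange_hom hU i hx
      rw [hz (fun y hy hy' => absurd hy'.2 (not_le.2 hy.1)), hUn] at h1
      simpa using h1
  have hleft : ∀ x, x ≤ -(n : ℝ) → U x = 0 := fun x hx =>
    H.eq_of_pairing_hom_eq (a := x) fun i => by
      have h1 := H.lagrange_hom hU i hx
      rw [hz (fun y hy hy' => absurd hy'.1 (not_lt.2 hy.2)), h0, sub_eq_zero, Matrix.mulVec_zero,
        dotProduct_zero] at h1
      rw [← h1, Matrix.mulVec_zero, dotProduct_zero]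
  refine ⟨U, h, hU, h0, hUn, fun x hx => ?_⟩
  -- The balanced value also involves the left-hand limit. At x = -n this limit vanishes too, since
  -- U is zero on the left of -n; this is why the support lies in the half-open interval.
  have hev : ∀ᶠ y in 𝓝[<] x, U y = 0 := by
    rcases le_or_gt x (-n) with hxn | hxn
    · filter_upwards [self_mem_nhdsWithin] with y hy
      exact hleft y (le_of_lt (lt_of_lt_of_le hy hxn))
    · have hxn' : (n : ℝ) < x := not_le.1 fun h => hx ⟨hxn, h⟩
      filter_upwards [Ioo_mem_nhdsLT hxn'] with y hy
      exact hright y hy.1.le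
  have hUx : U x = 0 := by
    rcases le_or_gt x (-n) with hxn | hxn
    · exact hleft x hxn
    · exact hright x (not_le.1 fun h => hx ⟨hxn, h⟩).le
  ext j
  have h1 := (hU.prim j).tendsto_left x
  have h2 := tendsto_nhds_unique h1
    (tendsto_const_nhds.congr' (hev.mono fun y hy => (congrFun hy j).symm))
  rw [hUx] at h2
  simp only [bal, hUx, Pi.zero_apply] at h2 ⊢
  linear_combination h2 / 2

/-- The adjoint of the maximal relation is contained in the maximal relation. -/
theorem adjoint_le : (Tmax J q w).adjoint ≤ Tmax J q w := by
  rintro ⟨v', g'⟩ hvg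
  rw [Submodule.mem_adjoint_iff] at hvg
  obtain ⟨v, rfl⟩ := SeparationQuotient.surjective_mk v'
  obtain ⟨g, rfl⟩ := SeparationQuotient.surjective_mk g'
  have hadj : ∀ u f : PreL2 w, (u, f) ∈ preTmax J q w →
      ∫ x, pairing w f.toFun v.toFun x ∂traceMeasure w =
        ∫ x, pairing w u.toFun g.toFun x ∂traceMeasure w := fun u f huf =>
    sub_eq_zero.1 (hvg (toL2 w u) (toL2 w f) ⟨(u, f), huf, rfl⟩)
  -- Some solution y of Jy' + qy = wg, not necessarily in L²(w); it is only locally square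
  -- integrable.
  obtain ⟨Y, k, hY, -⟩ := H.exists_isSolution g.toFun_mem 0 0
  set S := H.isRegularSystem 0
  set y := bal (baseMeasure q w) Y k with hy
  have hly : IsLocallySqIntegrable w y := .of_bv (bv_bal hY.prim)
  have hlv : IsLocallySqIntegrable w v.toFun := .of_mem v.toFun_mem
  have hlk : ∀ c, IsLocallySqIntegrable w (S.hom c) := fun c => .of_bv (H.bv_hom 0 c)
  -- For f of bounded support orthogonal to the homogeneous solutions, the boundedly supported
  -- solution u gives a pair in the maximal relation. The adjoint condition yields ⟨v, f⟩ = ⟨g, u⟩,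
  -- and Lagrange's identity without boundary terms yields ⟨y, f⟩ = ⟨g, u⟩.
  have hker : ⨅ i : Fin 2, LinearMap.ker (hlk (Pi.single i 1)).functional ≤
      LinearMap.ker (hlv.sub hly).functional := by
    rintro ⟨f, hfb⟩ hf
    simp only [Submodule.mem_iInf, LinearMap.mem_ker,
      IsLocallySqIntegrable.functional_apply] at hf ⊢
    obtain ⟨hfs, n, hn⟩ := hfb
    obtain ⟨U, h, hU, hU0, hU1, hUs⟩ := H.exists_isSolution_bounded hfs hn hf
    have hus : bal (baseMeasure q w) U h ∈ sqIntegrable w := by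
      have e : (Set.Ioc (-(n : ℝ)) n).indicator (bal (baseMeasure q w) U h) =
          bal (baseMeasure q w) U h := Set.indicator_eq_self.2 fun x hx => by
        by_contra h; exact hx (hUs x h)
      rw [← e]
      exact indicator_mem_of_bv (bv_bal hU.prim) _ _
    have h1 := hadj _ _ (IsSolution.mem_preTmax hU hus hfs)
    have h2 : ∫ x, pairing w v.toFun f x ∂traceMeasure w =
        ∫ x, pairing w g.toFun (bal (baseMeasure q w) U h) x ∂traceMeasure w := by
      have := congrArg conj h1
      rw [← integral_conj, ← integral_conj] at this
      simpa only [conj_pairing, mkPre_toFun] using this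
    have hnn : -(n : ℝ) ≤ n := by
      have : (0 : ℝ) ≤ n := by positivity
      linarith
    have h3 := H.lagrange hU hY.star hnn
    rw [hU0, hU1, bal_conj, star_star] at h3
    simp only [Matrix.mulVec_zero, dotProduct_zero, sub_zero, pairing_star_star] at h3
    have i1 := hly.integrable (f := f) ⟨hfs, n, hn⟩
    have i2 := integrable_pairing w g.toFun_mem hus
    rw [setIntegral_eq_integral_of_forall_compl_eq_zero
      (fun x hx => by simp [pairing, hn x hx, hUs x hx]), integral_sub i1 i2] at h3
    have e : ∀ x, pairing w (v.toFun - y) f x = pairing w v.toFun f x - pairing w y f x := by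
      intro x
      simp [pairing, sub_dotProduct]
    simp only [e]
    rw [integral_sub (integrable_pairing w v.toFun_mem hfs) i1, h2]
    linear_combination h3
  -- A functional vanishing on the common kernel of finitely many functionals is a combination of
  -- them.
  have hspan := mem_span_of_iInf_ker_le_ker hker
  rw [Submodule.mem_span_range_iff_exists_fun] at hspan
  obtain ⟨a, ha⟩ := hspan
  -- Conjugated, because the functional of d depends on d conjugate-linearly.
  set c : Fin 2 → ℂ := star a with hc
  have hcs : S.hom c = ∑ i, conj (a i) • S.hom (Pi.single i 1) := by
    simp only [← map_smul, ← map_sum]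
    congr 1
    ext i
    fin_cases i <;> simp [hc, Fin.sum_univ_two]
  have hnull : IsNull w (v.toFun - y - S.hom c) := by
    refine ((hlv.sub hly).sub (hlk c)).isNull fun f hf => ?_
    have h1 := congrArg (fun F => F ⟨f, hf⟩) ha
    simp only [LinearMap.sum_apply, LinearMap.smul_apply, smul_eq_mul,
      IsLocallySqIntegrable.functional_apply] at h1
    rw [Fin.sum_univ_two] at h1
    have e : ∀ x, pairing w (v.toFun - y - S.hom c) f x = pairing w (v.toFun - y) f x -
        (a 0 * pairing w (S.hom (Pi.single 0 1)) f x +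
          a 1 * pairing w (S.hom (Pi.single 1 1)) f x) := by
      intro x
      rw [hcs, Fin.sum_univ_two]
      simp [pairing, sub_dotProduct, add_dotProduct]
    simp only [e]
    have i0 := ((hlk (Pi.single 0 1)).integrable hf).const_mul (a 0)
    have i1 := ((hlk (Pi.single 1 1)).integrable hf).const_mul (a 1)
    rw [integral_sub ((hlv.sub hly).integrable hf) (by exact i0.add i1), integral_add i0 i1,
      integral_const_mul, integral_const_mul, h1, sub_self]
  have hV := IsSolution.add hY (H.isSolution_hom c)
  rw [add_zero] at hV
  have hb : bal (baseMeasure q w) (Y + S.homLim c) (k + S.homDensity c) = y + S.hom c := bal_add _ _ _ _ _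
  have hae : ∀ᵐ x ∂traceMeasure w, density w x *ᵥ v.toFun x = density w x *ᵥ (y + S.hom c) x := by
    filter_upwards [hnull] with x hx
    rw [← sub_eq_zero, ← Matrix.mulVec_sub, ← hx]
    congr 1
    simp only [Pi.sub_apply, Pi.add_apply]
    abel
  -- Square integrability of the representative is inherited from v, with which it agrees after
  -- multiplication by w.
  have hmem : bal (baseMeasure q w) (Y + S.homLim c) (k + S.homDensity c) ∈ sqIntegrable w :=
    mem_sqIntegrable_congr v.toFun_mem (aemeasurable_of_bv (bv_bal hV.prim) _) (by rwa [hb])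
  refine ⟨(mkPre _ hmem, g), IsSolution.mem_preTmax hV hmem g.toFun_mem, ?_⟩
  refine Prod.ext ?_ rfl
  refine (toL2_eq_iff (G := v)).2 ?_
  filter_upwards [hae] with x hx
  rw [hx, ← hb]
  rfl

variable {ω : ℝ} (hω : 0 < ω) (hq : ∀ i j, (q i j).IsPeriod ω) (hw : ∀ i j, (w i j).IsPeriod ω)
include hω hq hw

/-- The maximal relation is symmetric. -/
theorem le_adjoint : Tmax J q w ≤ (Tmax J q w).adjoint := by
  rintro _ ⟨⟨v, g⟩, hvg, rfl⟩
  rw [Submodule.mem_adjoint_iff]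
  rintro _ _ ⟨⟨u, f⟩, huf, h⟩
  obtain ⟨rfl, rfl⟩ := Prod.ext_iff.1 h
  obtain ⟨U, h, hU, hu⟩ := exists_isSol_of_solves H huf.1 huf.2.1 f.toFun_mem huf.2.2
  obtain ⟨V, k, hV, hv⟩ := exists_isSol_of_solves H hvg.1 hvg.2.1 g.toFun_mem hvg.2.2
  have := H.integral_pairing_eq hω hq hw hV hU (hv ▸ v.toFun_mem) (hu ▸ u.toFun_mem)
    g.toFun_mem f.toFun_mem
  rw [← hu, ← hv] at this
  exact sub_eq_zero.2 this.symm

theorem adjoint_eq : (Tmax J q w).adjoint = Tmax J q w :=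
  le_antisymm H.adjoint_le (H.le_adjoint hω hq hw)

/-- For nonreal z symmetry alone suffices: z̄⟨x, x⟩ = z⟨x, x⟩ forces x = 0. For real z the
translation argument applies. -/
theorem not_isEigenvalue (z : ℂ) : ¬ IsEigenvalue (Tmax J q w) z := by
  rintro ⟨x, hx0, hx⟩
  by_cases hz : conj z = z
  · obtain ⟨l, rfl⟩ := Complex.conj_eq_iff_real.1 hz
    obtain ⟨⟨u, f⟩, huf, h⟩ := hx
    obtain ⟨h1, h2⟩ := Prod.ext_iff.1 h
    refine hx0 (h1.symm.trans (toL2_eq_zero_iff.2 ?_))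
    exact H.isNull_of_eigen hω hq hw huf (l := l) (h2.trans (congrArg _ h1.symm))
  · have h1 := (Submodule.mem_adjoint_iff _ _).1 (H.le_adjoint hω hq hw hx) x (z • x) hx
    rw [inner_smul_left, inner_smul_right, ← sub_mul, mul_eq_zero, inner_self_eq_zero] at h1
    exact h1.elim (fun h => hz (sub_eq_zero.1 h)) hx0

end Admissible

end DistributionalSystem

end

open DistributionalSystem

theorem theorem6p2 (J : Matrix (Fin 2) (Fin 2) ℝ) (q w : Matrix (Fin 2) (Fin 2) OrderZero) (ω : ℝ)
    (hJ_skew : Jᵀ = -J) (hJ_inv : IsUnit J)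
    (hq_symm : q.IsSymm) (hw_nonneg : IsNonneg w)
    (hω : 0 < ω)
    (hq_per : ∀ i j, (q i j).IsPeriod ω) (hw_per : ∀ i j, (w i j).IsPeriod ω)
    (hB : ∀ x l : ℝ,
      IsUnit (J + (1 / 2 : ℝ) • (jumpMatrix q x - l • jumpMatrix w x)) ∧
      IsUnit (J - (1 / 2 : ℝ) • (jumpMatrix q x - l • jumpMatrix w x))) :
    (∀ z : ℂ, ¬ IsEigenvalue (Tmax J q w) z) ∧ (Tmax J q w).adjoint = Tmax J q w := by
  have H : Admissible J q w := ⟨hJ_skew, hJ_inv, hq_symm, fun x l => (hB x l).1⟩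
  exact ⟨H.not_isEigenvalue hω hq_per hw_per, H.adjoint_eq hω hq_per hw_per⟩
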